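/- **Setting.** Let $m>0$, $\alpha\ge 0$ and $Z$ be real numbers with $0\le \alpha Z<\sqrt3/2$, and let $\mathfrak H=L^2(\mathbb R^3)\otimes\mathbb C^4$. Write $x=(\mathbf x,s)$ with $\mathbf x\in\mathbb R^3$, $s\in\{1,2,3,4\}$, and $dx$ for the product of Lebesgue and counting measure. Let $D_0=\boldsymbol\alpha\cdot\frac1i\nabla+m\beta$ be the free Dirac operator and $D_Z=D_0-\alpha Z/|\mathbf x|$, both self-adjoint in $\mathfrak H$ with domain $H^1(\mathbb R^3)\otimes\mathbb C^4$. Let $F$ be the space of self-adjoint operators $\delta$ on $\mathfrak H$ with $\|\delta\|_F=\operatorname{tr}(|D_0|^{1/2}|\delta||D_0|^{1/2})<\infty$. For $\delta\in F$ with eigenvalues $\lambda_n$ and a corresponding orthonormal basis of eigenvectors $\xi_n$ put $$\delta(x,y)=\sum_n\lambda_n\xi_n(x)\overline{\xi_n(y)},\qquad \rho_\delta(\mathbf x)=\sum_{s=1}^4\sum_n\lambda_n|\xi_n(\mathbf x,s)|^2,$$ $$\varphi^{(\delta)}(\mathbf x)=\int_{\mathbb R^3}\frac{\rho_\delta(\mathbf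 y)}{|\mathbf x-\mathbf y|}\,d\mathbf y,\qquad (X^{(\delta)}\psi)(x)=\int\frac{\delta(x,y)\psi(y)}{|\mathbf x-\mathbf y|}\,dy,$$ $$D^{(\delta)}=D_Z+\alpha\,(\varphi^{(\delta)}-X^{(\delta)}),\qquad \Lambda_+=\Lambda^{(\delta)}_+=\chi_{[0,\infty)}(D^{(\delta)}),\qquad \Lambda_-=1-\Lambda_+,$$ and $c_{\alpha,Z,m,\delta}=\sup\{c\in\mathbb R : |D^{(\delta)}|\ge c\,|D_0|\}$ (inequality of quadratic forms). For $q\ge0$ let $$S^{(\delta)}=\{\gamma\in F : -\Lambda_-\le\gamma\le\Lambda_+,\ \Lambda_-\gamma\Lambda_+=0\},\qquad S^{(\delta)}_{\partial q}=\{\gamma\in S^{(\delta)} : \operatorname{tr}\gamma=q\}.$$ The Hartree–Fock functional on $S^{(\delta)}$ is $$\mathcal E(\gamma)=\operatorname{tr}(D_Z\gamma)+\frac\alpha2\int_{\mathbb R^3}\int_{\mathbb R^3}\frac{\rho_\gamma(\mathbf x)\rho_\gamma(\mathbf y)}{|\mathbf x-\mathbf y|}\,d\mathbf x\,d\mathbf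 y-\frac\alpha2\int\int\frac{|\gamma(x,y)|^2}{|\mathbf x-\mathbf y|}\,dx\,dy,$$ where $\operatorname{tr}(D_Z\gamma)=\sum_n\lambda_n\langle\xi_n,D_Z\xi_n\rangle$ in the sense of quadratic forms, $(\lambda_n,\xi_n)$ being the eigenvalues and eigenvectors of $\gamma$. **Theorem.** Assume that $0\le\delta\in F$, that $q$ is a nonnegative integer, and that $$0<\pi\alpha\bigl(\tfrac14+\max\{\operatorname{tr}\delta,q\}\bigr)<c_{\alpha,Z,m,\delta}.$$ If $\gamma$ is a minimizer of $\mathcal E$ on $S^{(\delta)}_{\partial q}$, then $\gamma=\gamma^*=\gamma^2=\Lambda_+\gamma\Lambda_+$. So every minimizer is a purely electronic orthogonal projection. -/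

import Mathlib

open MeasureTheory Set
open scoped ENNReal FourierTransform InnerProductSpace

namespace DiracFock

noncomputable section

/-! ### Unbounded operators, spectral measures, trace -/

section Abstract

variable {H : Type*} [NormedAddCommGroup H] [InnerProductSpace ℂ H] [CompleteSpace H]

/-- A projection-valued measure on the Borel sets of `ℝ`: orthogonal projections `E s` with
`E ℝ = 1` such that `s ↦ ‖E s u‖² = ⟪u, E s u⟫` is a (countably additive) measure for each `u`. -/
structure SpectralMeasure (H : Type*) [NormedAddCommGroup H] [InnerProductSpace ℂ H]
    [CompleteSpace H] where
  /-- the spectral projections `E s` -/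
  proj : Set ℝ → H →L[ℂ] H
  /-- the scalar measures `⟪u, E(·) u⟫` -/
  measure : H → Measure ℝ
  isStarProjection : ∀ s, MeasurableSet s → IsStarProjection (proj s)
  proj_univ : proj univ = 1
  measure_apply : ∀ u s, MeasurableSet s → measure u s = ENNReal.ofReal (‖proj s u‖ ^ 2)

/-- `A = ∫ t dE(t)`: the domain of `A` is `{u | ∫ t² d⟪u, E(t) u⟫ < ∞}`, and on it
`⟪u, A u⟫ = ∫ t d⟪u, E(t) u⟫` (by polarization this determines the linear operator `A`). -/
def SpectralMeasure.Represents (E : SpectralMeasure H) (A : H →ₗ.[ℂ] H) : Prop :=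
  (∀ u : H, u ∈ A.domain ↔ ∫⁻ t, ENNReal.ofReal (t ^ 2) ∂(E.measure u) < ∞) ∧
  ∀ u : A.domain, ⟪(u : H), A u⟫_ℂ = ((∫ t, t ∂(E.measure (u : H)) : ℝ) : ℂ)

open Classical in
/-- The spectral projection `χ_s(A)` of a self-adjoint operator `A`. -/
def spectralProj (A : H →ₗ.[ℂ] H) (s : Set ℝ) : H →L[ℂ] H :=
  if h : ∃ E : SpectralMeasure H, E.Represents A then h.choose.proj s else 0

open Classical in
/-- The closed quadratic form `u ↦ ⟪u, |A| u⟫ = ∫ |t| d⟪u, E(t) u⟫` of the absolute value of a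
self-adjoint operator `A`, with the value `∞` off the form domain of `|A|`. -/
def absForm (A : H →ₗ.[ℂ] H) (u : H) : ℝ≥0∞ :=
  if h : ∃ E : SpectralMeasure H, E.Represents A then
    ∫⁻ t, ENNReal.ofReal |t| ∂(h.choose.measure u) else 0

variable (H) in
/-- The index set of an orthonormal basis of `H`. -/
def basisIndex : Set H := (exists_hilbertBasis ℂ H).choose

variable (H) in
/-- An orthonormal basis of `H`. -/
def stdBasis : HilbertBasis (basisIndex H) ℂ H := (exists_hilbertBasis ℂ H).choose_spec.choose

/-- The trace `∑ᵢ ⟪eᵢ, T eᵢ⟫` (used for trace-class operators only, where it does not depend on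
the orthonormal basis). -/
def opTrace (T : H →L[ℂ] H) : ℂ := ∑' i, ⟪stdBasis H i, T (stdBasis H i)⟫_ℂ

/-- `|T|^{1/2}` for a bounded operator `T`, `|T| = (T* T)^{1/2}`. -/
def sqrtAbs (T : H →L[ℂ] H) : H →L[ℂ] H := CFC.sqrt (CFC.abs T)

end Abstract

/-! ### The one-particle space and the free Dirac operator -/

/-- Physical (or Fourier) space `ℝ³`. -/
abbrev R3 : Type := EuclideanSpace ℝ (Fin 3)

/-- The spinor space `ℂ⁴`. -/
abbrev Spinor : Type := EuclideanSpace ℂ (Fin 4)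

/-- `𝔥 = L²(ℝ³) ⊗ ℂ⁴ = L²(ℝ³; ℂ⁴)`. -/
abbrev Hil : Type := Lp Spinor 2 (volume : Measure R3)

/-- The maximal domain of multiplication by a matrix-valued function. -/
def mulDomain (M : R3 → (Spinor →ₗ[ℂ] Spinor)) : Submodule ℂ Hil where
  carrier := {u | MemLp (fun x => M x (u x)) 2 volume}
  add_mem' := by
    intro u v hu hv
    refine (MemLp.add hu hv).ae_eq ?_
    filter_upwards [Lp.coeFn_add u v] with x hx
    rw [hx]
    simp only [Pi.add_apply, map_add]
  zero_mem' := by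
    refine (MemLp.zero (ε := Spinor) (p := 2) (μ := (volume : Measure R3))).ae_eq ?_
    filter_upwards [Lp.coeFn_zero Spinor 2 (volume : Measure R3)] with x hx
    rw [hx]
    simp only [Pi.zero_apply, map_zero]
  smul_mem' := by
    intro c u hu
    refine (MemLp.const_smul hu c).ae_eq ?_
    filter_upwards [Lp.coeFn_smul c u] with x hx
    rw [hx]
    simp only [Pi.smul_apply, map_smul]

theorem memLp_of_mem_mulDomain {M : R3 → (Spinor →ₗ[ℂ] Spinor)} {u : Hil}
    (hu : u ∈ mulDomain M) : MemLp (fun x => M x (u x)) 2 volume := hu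

/-- Multiplication by a matrix-valued function on its maximal domain. -/
def mulOp (M : R3 → (Spinor →ₗ[ℂ] Spinor)) : Hil →ₗ.[ℂ] Hil where
  domain := mulDomain M
  toFun :=
    { toFun := fun u => MemLp.toLp (fun x => M x ((u : Hil) x)) (memLp_of_mem_mulDomain u.2)
      map_add' := by
        intro u v
        rw [← MemLp.toLp_add]
        refine MemLp.toLp_congr _ _ ?_
        filter_upwards [Lp.coeFn_add (u : Hil) (v : Hil)] with x hx
        rw [Submodule.coe_add, hx]
        simp only [Pi.add_apply, map_add]
      map_smul' := by
        intro c u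
        rw [RingHom.id_apply, ← MemLp.toLp_const_smul]
        refine MemLp.toLp_congr _ _ ?_
        filter_upwards [Lp.coeFn_smul c (u : Hil)] with x hx
        rw [Submodule.coe_smul, hx]
        simp only [Pi.smul_apply, map_smul] }

/-- Multiplication by a real function on its maximal domain. -/
def potOp (V : R3 → ℝ) : Hil →ₗ.[ℂ] Hil := mulOp fun x => (V x : ℂ) • LinearMap.id

/-- The Fourier transform on `𝔥`, `f̂(ξ) = ∫ exp(-2πi ξ·x) f(x) dx`; the momentum is
`p = -i∇ = 2πξ`. -/
def fourierL2 : Hil ≃ₗᵢ[ℂ] Hil := Lp.fourierTransformₗᵢ R3 Spinor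

/-- `F⁻¹ A F` for the Fourier transform `F`. -/
def fourierConj (A : Hil →ₗ.[ℂ] Hil) : Hil →ₗ.[ℂ] Hil where
  domain := A.domain.comap (fourierL2.toLinearEquiv : Hil →ₗ[ℂ] Hil)
  toFun :=
    { toFun := fun u => fourierL2.symm (A ⟨fourierL2 (u : Hil), u.2⟩)
      map_add' := by
        intro u v
        rw [← map_add, ← LinearPMap.map_add]
        congr 2
        exact Subtype.ext (map_add fourierL2 (u : Hil) (v : Hil))
      map_smul' := by
        intro c u
        rw [RingHom.id_apply, ← map_smul, ← LinearPMap.map_smul]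
        congr 2
        exact Subtype.ext (map_smul fourierL2 c (u : Hil)) }

/-- The Dirac matrices `α₁, α₂, α₃`, with the Pauli matrices as off-diagonal blocks. -/
def diracAlpha : Fin 3 → Matrix (Fin 4) (Fin 4) ℂ :=
  ![!![0, 0, 0, 1; 0, 0, 1, 0; 0, 1, 0, 0; 1, 0, 0, 0],
    !![0, 0, 0, -Complex.I; 0, 0, Complex.I, 0; 0, -Complex.I, 0, 0; Complex.I, 0, 0, 0],
    !![0, 0, 1, 0; 0, 0, 0, -1; 1, 0, 0, 0; 0, -1, 0, 0]]

/-- The Dirac matrix `β`. -/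
def diracBeta : Matrix (Fin 4) (Fin 4) ℂ :=
  !![1, 0, 0, 0; 0, 1, 0, 0; 0, 0, -1, 0; 0, 0, 0, -1]

/-- The Fourier symbol `𝛂·p + m β`, `p = 2πξ`, of the free Dirac operator. -/
def diracSymbol (m : ℝ) (ξ : R3) : Spinor →ₗ[ℂ] Spinor :=
  Matrix.toEuclideanLin
    ((∑ j : Fin 3, ((2 * Real.pi * ξ j : ℝ) : ℂ) • diracAlpha j) + (m : ℂ) • diracBeta)

/-- The free Dirac operator `D₀ = 𝛂·(1/i)∇ + mβ`, with domain `H¹(ℝ³; ℂ⁴)`. -/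
def freeDirac (m : ℝ) : Hil →ₗ.[ℂ] Hil := fourierConj (mulOp (diracSymbol m))

/-- The Fourier symbol `(p² + m²)^{1/2}`, `p = 2πξ`, of `|D₀| = (-Δ + m²)^{1/2}`. -/
def freeEnergy (m : ℝ) (ξ : R3) : ℝ := Real.sqrt ((2 * Real.pi * ‖ξ‖) ^ 2 + m ^ 2)

/-- The closed quadratic form `u ↦ ⟪u, |D₀| u⟫ = ‖|D₀|^{1/2} u‖²`, with the value `∞` off
`H^{1/2}(ℝ³; ℂ⁴)`. -/
def freeAbsForm (m : ℝ) (u : Hil) : ℝ≥0∞ :=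
  ∫⁻ ξ, ENNReal.ofReal (freeEnergy m ξ * ‖fourierL2 u ξ‖ ^ 2)

/-- The Coulomb-Dirac operator `D_Z = D₀ - αZ/|x|`, with domain `H¹` (which lies in the domain of
`1/|x|` by Hardy's inequality). -/
def coulombDirac (α Z m : ℝ) : Hil →ₗ.[ℂ] Hil :=
  freeDirac m - ((α * Z : ℝ) : ℂ) • potOp fun x => ‖x‖⁻¹

/-- The quadratic form of `D_Z` on `H^{1/2}`. -/
def coulombDiracForm (α Z m : ℝ) (u : Hil) : ℝ :=
  (∫ ξ, ⟪fourierL2 u ξ, diracSymbol m ξ (fourierL2 u ξ)⟫_ℂ).re - α * Z * ∫ x, ‖u x‖ ^ 2 / ‖x‖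

/-! ### The space `F`, integral kernels, densities -/

/-- `‖δ‖_F = tr(|D₀|^{1/2} |δ| |D₀|^{1/2})`, the trace of `T T*` for `T = |D₀|^{1/2} |δ|^{1/2}`,
that is, `∑ᵢ ‖|D₀|^{1/2} |δ|^{1/2} eᵢ‖²`. -/
def normF (m : ℝ) (δ : Hil →L[ℂ] Hil) : ℝ≥0∞ :=
  ∑' i, freeAbsForm m (sqrtAbs δ (stdBasis Hil i))

/-- The space `F` of self-adjoint operators with finite `F`-norm. -/
def spaceF (m : ℝ) : Set (Hil →L[ℂ] Hil) := {δ | IsSelfAdjoint δ ∧ normF m δ < ∞}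

/-- `ξ` is an orthonormal basis of eigenvectors of `δ` with eigenvalues `l`. -/
def IsEigensystem (δ : Hil →L[ℂ] Hil) (l : ℕ → ℝ) (ξ : HilbertBasis ℕ ℂ Hil) : Prop :=
  ∀ n, δ (ξ n) = (l n : ℂ) • ξ n

open Classical in
/-- The eigenvalues `λₙ` of `δ`, belonging to the basis `eigenvector δ`. -/
def eigenvalue (δ : Hil →L[ℂ] Hil) : ℕ → ℝ :=
  if h : ∃ p : (ℕ → ℝ) × HilbertBasis ℕ ℂ Hil, IsEigensystem δ p.1 p.2 then h.choose.1 else 0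

open Classical in
/-- An orthonormal basis `ξₙ` of eigenvectors of `δ` (which exists for every `δ ∈ F`). -/
def eigenvector (δ : Hil →L[ℂ] Hil) : ℕ → Hil :=
  if h : ∃ p : (ℕ → ℝ) × HilbertBasis ℕ ℂ Hil, IsEigensystem δ p.1 p.2 then h.choose.2 else 0

/-- The integral kernel `δ(x, y) = ∑ₙ λₙ ξₙ(x) conj(ξₙ(y))`, `x = (𝐱, s)`, `y = (𝐲, t)`. -/
def kernel (δ : Hil →L[ℂ] Hil) (x y : R3) (s t : Fin 4) : ℂ :=
  ∑' n, (eigenvalue δ n : ℂ) * eigenvector δ n x s * star (eigenvector δ n y t)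

/-- The one-particle density `ρ_δ(𝐱) = ∑ₛ ∑ₙ λₙ |ξₙ(𝐱, s)|²`. -/
def density (δ : Hil →L[ℂ] Hil) (x : R3) : ℝ :=
  ∑ s : Fin 4, ∑' n, eigenvalue δ n * ‖eigenvector δ n x s‖ ^ 2

/-! ### The mean-field operator and the electron subspace -/

/-- The electric potential `φ^(δ)`. -/
def electricPotential (δ : Hil →L[ℂ] Hil) (x : R3) : ℝ := ∫ y, density δ y / ‖x - y‖

open Classical in
/-- The exchange operator `(X^(δ) ψ)(x) = ∫ δ(x, y) ψ(y) / |𝐱 - 𝐲| dy`, which is bounded for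
every `δ ∈ F`. -/
def exchangeOp (δ : Hil →L[ℂ] Hil) : Hil →L[ℂ] Hil :=
  if h : ∃ X : Hil →L[ℂ] Hil, ∀ ψ : Hil, ∀ᵐ x, ∀ s : Fin 4,
      X ψ x s = ∫ y, (∑ t : Fin 4, kernel δ x y s t * ψ y t) / (‖x - y‖ : ℂ)
  then h.choose else 0

/-- The mean-field potential `W^(δ) = φ^(δ) - X^(δ)`. -/
def meanField (δ : Hil →L[ℂ] Hil) : Hil →ₗ.[ℂ] Hil :=
  potOp (electricPotential δ) - (exchangeOp δ : Hil →ₗ[ℂ] Hil).toPMap ⊤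

/-- The Dirac-Fock operator `D^(δ) = D_Z + α W^(δ)`. -/
def diracFock (α Z m : ℝ) (δ : Hil →L[ℂ] Hil) : Hil →ₗ.[ℂ] Hil :=
  coulombDirac α Z m + (α : ℂ) • meanField δ

/-- `Λ₊ = χ_[0,∞)(D^(δ))`. -/
def projPlus (α Z m : ℝ) (δ : Hil →L[ℂ] Hil) : Hil →L[ℂ] Hil :=
  spectralProj (diracFock α Z m δ) (Ici 0)

/-- `Λ₋ = 1 - Λ₊`. -/
def projMinus (α Z m : ℝ) (δ : Hil →L[ℂ] Hil) : Hil →L[ℂ] Hil := 1 - projPlus α Z m δ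

/-- `c_{α,Z,m,δ} = sup {c ∈ ℝ | |D^(δ)| ≥ c |D₀|}`, the inequality being one of quadratic forms.
Since `|D^(δ)| ≥ 0`, the numbers `c ≤ 0` all belong to the set. -/
def modulusConst (α Z m : ℝ) (δ : Hil →L[ℂ] Hil) : ℝ :=
  sSup {c : ℝ | ∀ u : Hil,
    ENNReal.ofReal c * freeAbsForm m u ≤ absForm (diracFock α Z m δ) u}

/-! ### Density matrices and the energy -/

/-- `S^(δ) = {γ ∈ F | -Λ₋ ≤ γ ≤ Λ₊, Λ₋ γ Λ₊ = 0}`. -/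
def densityMatrices (α Z m : ℝ) (δ : Hil →L[ℂ] Hil) : Set (Hil →L[ℂ] Hil) :=
  {γ | γ ∈ spaceF m ∧ -projMinus α Z m δ ≤ γ ∧ γ ≤ projPlus α Z m δ ∧
    projMinus α Z m δ * γ * projPlus α Z m δ = 0}

/-- `S^(δ)_{∂q} = {γ ∈ S^(δ) | tr γ = q}`. -/
def densityMatricesOfCharge (α Z m : ℝ) (δ : Hil →L[ℂ] Hil) (q : ℝ) : Set (Hil →L[ℂ] Hil) :=
  {γ | γ ∈ densityMatrices α Z m δ ∧ opTrace γ = (q : ℂ)}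

/-- The Coulomb scalar product `D[ρ, σ]` of real densities. -/
def coulombEnergy (ρ σ : R3 → ℝ) : ℝ := 1 / 2 * ∫ x, ∫ y, ρ x * σ y / ‖x - y‖

/-- The exchange scalar product `E[γ, γ']`. -/
def exchangeEnergy (γ γ' : Hil →L[ℂ] Hil) : ℂ :=
  1 / 2 * ∫ x, ∫ y, (∑ s : Fin 4, ∑ t : Fin 4, star (kernel γ x y s t) * kernel γ' x y s t)
    / (‖x - y‖ : ℂ)

/-- `Q[γ, γ'] = D[ρ_γ, ρ_γ'] - E[γ, γ']`, which is real for self-adjoint `γ` and `γ'`. -/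
def interaction (γ γ' : Hil →L[ℂ] Hil) : ℝ :=
  coulombEnergy (density γ) (density γ') - (exchangeEnergy γ γ').re

/-- The one-particle energy `tr(D_Z γ) = ∑ₙ λₙ ⟪ξₙ, D_Z ξₙ⟫`, in the sense of quadratic forms. -/
def oneParticleEnergy (α Z m : ℝ) (γ : Hil →L[ℂ] Hil) : ℝ :=
  ∑' n, eigenvalue γ n * coulombDiracForm α Z m (eigenvector γ n)

/-- The Hartree-Fock functional `ℰ(γ) = tr(D_Z γ) + α Q[γ, γ]`. -/
def energy (α Z m : ℝ) (γ : Hil →L[ℂ] Hil) : ℝ :=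
  oneParticleEnergy α Z m γ + α * interaction γ γ

end

end DiracFock

/-! Everything is reduced to occupation numbers. Because `γ` is self-adjoint and `Λ₋ γ Λ₊ = 0`, it
commutes with `Λ₊`. In an eigenbasis `ξₙ` of `γ` the eigenvalues `lₙ` lie in `[-1, 1]`, modes with
`lₙ > 0` lie in the range of `Λ₊` and modes with `lₙ < 0` in that of `Λ₋` (`eigenvector_spectral`).
For operators diagonal in this basis the energy is `∑ lₙ ⟪ξₙ, D_Z ξₙ⟫ + α ∑ lₙ lₖ pairTerm ξₙ ξₖ`
(`energy_eq`). Here `pairTerm u v` is, up to normalization, the Coulomb energy of the Slater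
determinant of `u` and `v`: it is symmetric, zero for `u = v`, and strictly positive for orthonormal
`u, v`.

No positrons (`occupation_nonneg`). Write `γ = γ₊ - γ₋` and `t = tr γ₋`, and compare `γ` with `θ
γ₊`, `θ = q/(q+t)`, which again has trace `q`. With `a = απ/2` and `c` slightly below `c_{α,Z,m,δ}`,
Kato's inequality bounds the mean field between `0` and `(π/2)(tr δ)|D₀|`. So `D_Z ≥ (c - a tr
δ)|D₀|` on `Λ₊` and `D_Z ≤ -c|D₀|` on `Λ₋` (`exists_projPlus_gap`), and giving up `γ₋` gains kinetic
energy. The possible loss is the cross interaction of `γ₊` and `γ₋`. For moderate `q + t` it is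
estimated by Kato's inequality in either factor (`pairSum_le`). For large `q + t` the whole
interaction is bounded below through positivity of the Coulomb kernel and the exchange estimate by
`(π/4) tr(|D₀|γ²)`, which does not grow with the number of particles (`neg_le_pairSum_self`). The
hypothesis `a(1/2 + 2M) < c`, `M = max(tr δ, q)`, makes the gain win unless `γ₋ = 0`
(`kinetic_balance`).

No fractional occupation (`occupation_zero_or_one`). If some `lₙ` were strictly between `0` and `1`,
integrality of the trace would produce a second such index. Moving charge `ε` from one mode to the
other, or back, leaves the state admissible, and the sum of the two energy changes is `-4αε²
pairTerm < 0`. One of the two moves therefore lowers the energy, contradicting minimality.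

The analysis supports these two arguments: Kato's inequality with constant `π/2` (`kato`), the
passage from `|D^(δ)| ≥ c|D₀|` to signed form bounds on the spectral subspaces (`form_lower_bound`),
and the independence of the energy of the chosen eigenbasis. -/

namespace DiracFock

open Filter Topology

/-! ### Spectral measures -/

namespace SpectralMeasure

variable {H : Type*} [NormedAddCommGroup H] [InnerProductSpace ℂ H] [CompleteSpace H]
  (E : SpectralMeasure H)

theorem inner_proj_left {s : Set ℝ} (hs : MeasurableSet s) (u v : H) :
    ⟪E.proj s u, v⟫_ℂ = ⟪u, E.proj s v⟫_ℂ := by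
  have h : star (E.proj s) = E.proj s := (E.isStarProjection s hs).isSelfAdjoint
  rw [ContinuousLinearMap.star_eq_adjoint] at h
  conv_rhs => rw [← h]
  rw [ContinuousLinearMap.adjoint_inner_right]

theorem proj_proj {s : Set ℝ} (hs : MeasurableSet s) (u : H) :
    E.proj s (E.proj s u) = E.proj s u :=
  congrArg (fun T : H →L[ℂ] H => T u) (E.isStarProjection s hs).isIdempotentElem

theorem inner_proj_self {s : Set ℝ} (hs : MeasurableSet s) (u : H) :
    ⟪E.proj s u, u⟫_ℂ = ((‖E.proj s u‖ ^ 2 : ℝ) : ℂ) := by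
  rw [← E.proj_proj hs, E.inner_proj_left hs, inner_self_eq_norm_sq_to_K, E.proj_proj hs]
  push_cast
  rfl

theorem norm_sq_proj_union {s t : Set ℝ} (hs : MeasurableSet s) (ht : MeasurableSet t)
    (hst : Disjoint s t) (u : H) :
    ‖E.proj (s ∪ t) u‖ ^ 2 = ‖E.proj s u‖ ^ 2 + ‖E.proj t u‖ ^ 2 := by
  have h := measure_union (μ := E.measure u) hst ht
  rw [E.measure_apply u _ (hs.union ht), E.measure_apply u _ hs, E.measure_apply u _ ht,
    ← ENNReal.ofReal_add (by positivity) (by positivity),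
    ENNReal.ofReal_eq_ofReal_iff (by positivity) (by positivity)] at h
  exact h

/-- Additivity of the scalar measures says that both sides have the same quadratic form, and over
`ℂ` the quadratic form determines the operator. -/
theorem proj_union {s t : Set ℝ} (hs : MeasurableSet s) (ht : MeasurableSet t)
    (hst : Disjoint s t) : E.proj (s ∪ t) = E.proj s + E.proj t := by
  have h : ((E.proj (s ∪ t) : H →L[ℂ] H) : H →ₗ[ℂ] H) = ((E.proj s + E.proj t : H →L[ℂ] H)) := by
    rw [← ext_inner_map]
    intro u
    simp only [ContinuousLinearMap.coe_coe, add_apply, inner_add_left]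
    rw [E.inner_proj_self (hs.union ht), E.inner_proj_self hs, E.inner_proj_self ht,
      E.norm_sq_proj_union hs ht hst]
    push_cast
    rfl
  exact ContinuousLinearMap.coe_injective h

/-- The sum of the projections `P` and `Q` is again idempotent, so `PQ + QP = 0`. Multiplying by `P`
on either side gives `PQ = QP`, hence `2PQ = 0`. -/
theorem proj_mul_of_disjoint {s t : Set ℝ} (hs : MeasurableSet s) (ht : MeasurableSet t)
    (hst : Disjoint s t) : E.proj s * E.proj t = 0 := by
  have hP : E.proj s * E.proj s = E.proj s := (E.isStarProjection s hs).isIdempotentElem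
  have hQ : E.proj t * E.proj t = E.proj t := (E.isStarProjection t ht).isIdempotentElem
  have h : (E.proj s + E.proj t) * (E.proj s + E.proj t) = E.proj s + E.proj t := by
    rw [← E.proj_union hs ht hst]
    exact (E.isStarProjection _ (hs.union ht)).isIdempotentElem
  set P := E.proj s
  set Q := E.proj t
  have h1 : P * Q + Q * P = 0 := by
    rw [add_mul, mul_add, mul_add, hP, hQ] at h
    have : P + P * Q + (Q * P + Q) = P + Q + (P * Q + Q * P) := by abel
    rw [this] at h
    simpa using h
  have h2 : P * Q + P * Q * P = 0 := by
    have := congrArg (fun X => P * X) h1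
    simpa [mul_add, ← mul_assoc, hP] using this
  have h3 : P * Q * P + Q * P = 0 := by
    have := congrArg (fun X => X * P) h1
    simpa [add_mul, mul_assoc, hP] using this
  have h4 : P * Q = Q * P := by
    have : P * Q + P * Q * P = P * Q * P + Q * P := by rw [h2, h3]
    rwa [add_comm, add_left_cancel_iff] at this
  rw [← h4, ← two_smul ℂ, smul_eq_zero] at h1
  exact h1.resolve_left two_ne_zero

theorem proj_inter {s t : Set ℝ} (hs : MeasurableSet s) (ht : MeasurableSet t) :
    E.proj (s ∩ t) = E.proj s * E.proj t := by
  have h1 := E.proj_union (hs.inter ht) (hs.diff ht) (disjoint_sdiff_inter).symm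
  have h2 := E.proj_union (hs.inter ht) (ht.diff hs)
    (by rw [inter_comm]; exact (disjoint_sdiff_inter).symm)
  rw [inter_union_sdiff] at h1
  rw [inter_comm, inter_union_sdiff, inter_comm] at h2
  rw [h1, h2, add_mul, mul_add, mul_add, E.proj_mul_of_disjoint (hs.inter ht) (ht.diff hs),
    E.proj_mul_of_disjoint (hs.diff ht) (hs.inter ht),
    E.proj_mul_of_disjoint (hs.diff ht) (ht.diff hs),
    (E.isStarProjection _ (hs.inter ht)).isIdempotentElem.eq]
  · simp
  · exact Set.disjoint_left.2 fun x hx hx' => hx.2 hx'.1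
  · exact Set.disjoint_left.2 fun x hx hx' => hx.2 hx'.2
  · exact Set.disjoint_left.2 fun x hx hx' => hx'.2 hx.1

theorem proj_inter_apply {s t : Set ℝ} (hs : MeasurableSet s) (ht : MeasurableSet t) (u : H) :
    E.proj (s ∩ t) u = E.proj s (E.proj t u) := by
  rw [E.proj_inter hs ht]; rfl

theorem proj_compl {s : Set ℝ} (hs : MeasurableSet s) : E.proj sᶜ = 1 - E.proj s := by
  have h := E.proj_union hs hs.compl disjoint_compl_right
  rw [union_compl_self, E.proj_univ] at h
  rw [h]; abel

/-- This turns form values at a spectrally truncated vector into integrals over `s`. -/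
theorem measure_proj {s : Set ℝ} (hs : MeasurableSet s) (u : H) :
    E.measure (E.proj s u) = (E.measure u).restrict s := by
  ext t ht
  rw [E.measure_apply _ _ ht, Measure.restrict_apply ht, E.measure_apply _ _ (ht.inter hs),
    E.proj_inter_apply ht hs]

theorem measure_add_of_proj {s : Set ℝ} (hs : MeasurableSet s) {u w : H}
    (hu : E.proj s u = u) (hw : E.proj s w = 0) :
    E.measure (u + w) = E.measure u + E.measure w := by
  ext t ht
  rw [Measure.add_apply, E.measure_apply _ _ ht, E.measure_apply _ _ ht, E.measure_apply _ _ ht,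
    ← ENNReal.ofReal_add (by positivity) (by positivity), map_add]
  congr 1
  have h : ⟪E.proj t u, E.proj t w⟫_ℂ = 0 := by
    rw [← hu, ← E.proj_inter_apply ht hs, inter_comm, E.proj_inter_apply hs ht,
      E.inner_proj_left hs, ← E.proj_inter_apply hs ht, inter_comm, E.proj_inter_apply ht hs, hw,
      map_zero, inner_zero_right]
  have := norm_add_sq_eq_norm_sq_add_norm_sq_of_inner_eq_zero (𝕜 := ℂ) _ _ h
  simpa [sq] using this

instance isFiniteMeasure_measure (u : H) : IsFiniteMeasure (E.measure u) :=
  ⟨by rw [E.measure_apply _ _ MeasurableSet.univ]; exact ENNReal.ofReal_lt_top⟩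

theorem tendsto_proj_Icc (u : H) :
    Tendsto (fun n : ℕ => E.proj (Icc (-(n : ℝ)) n) u) atTop (𝓝 u) := by
  have hanti : Antitone fun n : ℕ => (Icc (-(n : ℝ)) n)ᶜ := by
    intro a b hab
    have : (a : ℝ) ≤ b := by exact_mod_cast hab
    exact compl_subset_compl.2 (Icc_subset_Icc (by linarith) this)
  have hint : ⋂ n : ℕ, (Icc (-(n : ℝ)) n)ᶜ = ∅ := by
    rw [← compl_iUnion, compl_empty_iff, eq_univ_iff_forall]
    intro x
    obtain ⟨n, hn⟩ := exists_nat_ge |x|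
    exact mem_iUnion.2 ⟨n, abs_le.1 hn⟩
  have h := tendsto_measure_iInter_atTop (μ := E.measure u)
    (fun n : ℕ => (measurableSet_Icc (a := -(n : ℝ)) (b := n)).compl.nullMeasurableSet) hanti
    ⟨0, measure_ne_top _ _⟩
  rw [hint, measure_empty] at h
  have h2 : Tendsto (fun n : ℕ => ‖u - E.proj (Icc (-(n : ℝ)) n) u‖ ^ 2) atTop (𝓝 0) := by
    have h3 := (ENNReal.tendsto_toReal ENNReal.zero_ne_top).comp h
    refine h3.congr fun n => ?_
    simp only [Function.comp]
    rw [E.measure_apply _ _ measurableSet_Icc.compl, E.proj_compl measurableSet_Icc,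
      ENNReal.toReal_ofReal (by positivity)]
    rfl
  rw [tendsto_iff_norm_sub_tendsto_zero]
  have h4 := h2.sqrt
  rw [Real.sqrt_zero] at h4
  refine h4.congr fun n => ?_
  rw [Real.sqrt_sq (norm_nonneg _), norm_sub_rev]

variable {E} {A : H →ₗ.[ℂ] H}

theorem Represents.proj_mem_domain (hE : E.Represents A) {s : Set ℝ} (hs : MeasurableSet s) {R : ℝ}
    (hR : ∀ t ∈ s, |t| ≤ R) (u : H) : E.proj s u ∈ A.domain := by
  rw [hE.1, E.measure_proj hs]
  calc ∫⁻ t in s, ENNReal.ofReal (t ^ 2) ∂(E.measure u)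
      ≤ ∫⁻ _ in s, ENNReal.ofReal (R ^ 2) ∂(E.measure u) := by
        refine setLIntegral_mono' hs fun t ht => ENNReal.ofReal_le_ofReal ?_
        rw [← sq_abs]
        exact pow_le_pow_left₀ (abs_nonneg _) (hR t ht) 2
    _ < ∞ := by
        rw [setLIntegral_const]
        exact ENNReal.mul_lt_top ENNReal.ofReal_lt_top (measure_lt_top _ _)

theorem Represents.integrable_id (hE : E.Represents A) {u : H} (hu : u ∈ A.domain) :
    Integrable (fun t : ℝ => t) (E.measure u) := by
  have h : MemLp (fun t : ℝ => t) 2 (E.measure u) := by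
    refine ⟨aestronglyMeasurable_id, ?_⟩
    rw [eLpNorm_lt_top_iff_lintegral_rpow_enorm_lt_top (by norm_num) (by norm_num)]
    refine lt_of_le_of_lt (le_of_eq (lintegral_congr fun t => ?_)) ((hE.1 u).1 hu)
    rw [← ofReal_norm, ENNReal.ofReal_rpow_of_nonneg (norm_nonneg _) (by norm_num)]
    norm_num
  exact h.integrable (by norm_num)

/-- `Represents` fixes only diagonal values `⟪u, A u⟫`. The measures of `u` and `w` add, so
expanding the diagonal value at `u + w` leaves exactly the cross terms. -/
theorem Represents.inner_add_inner_eq_zero (hE : E.Represents A) {s : Set ℝ} (hs : MeasurableSet s) (u w : A.domain)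
    (hu : E.proj s u = u) (hw : E.proj s w = 0) :
    ⟪(u : H), A w⟫_ℂ + ⟪(w : H), A u⟫_ℂ = 0 := by
  have h := hE.2 (u + w)
  rw [Submodule.coe_add, E.measure_add_of_proj hs hu hw,
    integral_add_measure (hE.integrable_id u.2) (hE.integrable_id w.2), LinearPMap.map_add,
    inner_add_left, inner_add_right, inner_add_right, hE.2 u, hE.2 w] at h
  push_cast at h
  linear_combination h

/-- Replacing `w` by `i w` gives the vanishing of the difference of the two cross terms; with their
sum, each is zero. -/
theorem Represents.inner_eq_zero_of_mem (hE : E.Represents A) {s : Set ℝ} (hs : MeasurableSet s) (u w : A.domain)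
    (hu : E.proj s u = u) (hw : E.proj s w = 0) : ⟪(w : H), A u⟫_ℂ = 0 := by
  have h1 := hE.inner_add_inner_eq_zero hs u w hu hw
  have h2 := hE.inner_add_inner_eq_zero hs u (Complex.I • w) hu (by
    rw [Submodule.coe_smul, map_smul, hw, smul_zero])
  rw [LinearPMap.map_smul, Submodule.coe_smul, inner_smul_left, inner_smul_right,
    Complex.conj_I] at h2
  have h3 : Complex.I * (⟪(u : H), A w⟫_ℂ - ⟪(w : H), A u⟫_ℂ) = 0 := by linear_combination h2
  have h4 := (mul_eq_zero.1 h3).resolve_left Complex.I_ne_zero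
  linear_combination (1 / 2) * h1 - (1 / 2) * h4

/-- Here `w` need not lie in the domain; its spectral truncations `E([-n, n]) w` do, and they
converge to `w`. -/
theorem Represents.inner_eq_zero (hE : E.Represents A) {s : Set ℝ} (hs : MeasurableSet s) (u : A.domain) {w : H}
    (hu : E.proj s u = u) (hw : E.proj s w = 0) : ⟪w, A u⟫_ℂ = 0 := by
  have h1 : ∀ n : ℕ, ⟪E.proj (Icc (-(n : ℝ)) n) w, A u⟫_ℂ = 0 := fun n =>
    hE.inner_eq_zero_of_mem hs u
      ⟨_, hE.proj_mem_domain measurableSet_Icc (R := n) (fun t ht => abs_le.2 ht) w⟩ hu (by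
        change E.proj s (E.proj _ w) = 0
        rw [← E.proj_inter_apply hs measurableSet_Icc, inter_comm,
          E.proj_inter_apply measurableSet_Icc hs, hw, map_zero])
  have h2 := (E.tendsto_proj_Icc w).inner (𝕜 := ℂ) (tendsto_const_nhds (x := A u))
  exact (tendsto_nhds_unique h2 (by simp only [h1]; exact tendsto_const_nhds))

/-- `⟪u, A E(s) u⟫ = ∫ₛ t d⟪u, E(t) u⟫` for bounded `s`. -/
theorem Represents.inner_apply_proj (hE : E.Represents A) {s : Set ℝ} (hs : MeasurableSet s) {R : ℝ}
    (hR : ∀ t ∈ s, |t| ≤ R) (u : H) :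
    ⟪u, A ⟨E.proj s u, hE.proj_mem_domain hs hR u⟩⟫_ℂ =
      ((∫ t in s, t ∂(E.measure u) : ℝ) : ℂ) := by
  have h1 := hE.inner_eq_zero hs ⟨E.proj s u, hE.proj_mem_domain hs hR u⟩ (w := u - E.proj s u)
    (E.proj_proj hs u) (by rw [map_sub, E.proj_proj hs, sub_self])
  rw [inner_sub_left, sub_eq_zero] at h1
  rw [h1]
  have h2 := hE.2 ⟨E.proj s u, hE.proj_mem_domain hs hR u⟩
  rw [E.measure_proj hs] at h2
  exact h2

end SpectralMeasure

/-- A form bound on the modulus of an operator extends to its quadratic form on a spectral subspace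
of vectors of finite form: if `A` has the constant sign `σ` on `E(s)`, `c f ≤ |A|` and `B` is a
sesquilinear extension of `⟪u, A v⟫` that is bounded with respect to `f`, then `c f ≤ σ B` on the
range of `E(s)`. -/
theorem form_lower_bound {H : Type*} [NormedAddCommGroup H] [InnerProductSpace ℂ H]
    [CompleteSpace H] {E : SpectralMeasure H} {A : H →ₗ.[ℂ] H} (hE : E.Represents A)
    {f : H → ℝ≥0∞} {c : ℝ} (hc : 0 < c)
    (hf : ∀ u, ENNReal.ofReal c * f u ≤ ∫⁻ t, ENNReal.ofReal |t| ∂(E.measure u))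
    {B : H → H → ℂ} (hB : ∀ u (v : A.domain), f u < ∞ → f v < ∞ → ⟪u, A v⟫_ℂ = B u v)
    {C : ℝ} (hBC : ∀ u v, f u < ∞ → f v < ∞ →
      ‖B u v‖ ≤ C * Real.sqrt (f u).toReal * Real.sqrt (f v).toReal)
    (hBsub : ∀ u v w, f u < ∞ → f v < ∞ → f w < ∞ → B u (v - w) = B u v - B u w)
    {s : Set ℝ} (hs : MeasurableSet s) {σ : ℝ} (hσ : ∀ t ∈ s, σ * t = |t|)
    {u : H} (hfu : f u < ∞) (hu : E.proj s u = u) :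
    c * (f u).toReal ≤ σ * (B u u).re := by
  -- A vector with finite `f` is not known to lie in the form domain of `|A|`. Truncating the
  -- spectrum gives `v n` in the operator domain, where `B u (v n)` is a genuine matrix element of
  -- `A`.
  set S : ℕ → Set ℝ := fun n => s ∩ Icc (-(n : ℝ)) n with hS
  have hSm : ∀ n, MeasurableSet (S n) := fun n => hs.inter measurableSet_Icc
  have hSR : ∀ n, ∀ t ∈ S n, |t| ≤ n := fun n t ht => abs_le.2 ht.2
  set v : ℕ → H := fun n => E.proj (S n) u with hv
  have hvd : ∀ n, v n ∈ A.domain := fun n => hE.proj_mem_domain (hSm n) (hSR n) u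
  set μ := E.measure u with hμ
  have habs : ∀ n, ∫⁻ t in S n, ENNReal.ofReal |t| ∂μ < ∞ := fun n => by
    calc ∫⁻ t in S n, ENNReal.ofReal |t| ∂μ ≤ ∫⁻ _ in S n, ENNReal.ofReal n ∂μ :=
          setLIntegral_mono' (hSm n) fun t ht => ENNReal.ofReal_le_ofReal (hSR n t ht)
      _ < ∞ := by
          rw [setLIntegral_const]
          exact ENNReal.mul_lt_top ENNReal.ofReal_lt_top (measure_lt_top _ _)
  have hcpos : ENNReal.ofReal c ≠ 0 := by simpa using hc
  have hfin : ∀ w, ∫⁻ t, ENNReal.ofReal |t| ∂(E.measure w) < ∞ → f w < ∞ := fun w hw => by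
    by_contra h
    rw [not_lt, top_le_iff] at h
    have := hf w
    rw [h, ENNReal.mul_top hcpos, top_le_iff] at this
    exact hw.ne this
  have hfv' : ∀ n, ENNReal.ofReal c * f (v n) ≤ ∫⁻ t in S n, ENNReal.ofReal |t| ∂μ := fun n => by
    have := hf (v n)
    rwa [hv, E.measure_proj (hSm n)] at this
  have hfv : ∀ n, f (v n) < ∞ := fun n => hfin _ (by rw [hv, E.measure_proj (hSm n)]; exact habs n)
  set a : ℕ → ℝ := fun n => (∫⁻ t in S n, ENNReal.ofReal |t| ∂μ).toReal with ha
  have haB : ∀ n, a n = σ * (B u (v n)).re := fun n => by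
    have h1 := hE.inner_apply_proj (hSm n) (hSR n) u
    rw [← hB u ⟨v n, hvd n⟩ hfu (hfv n), h1, Complex.ofReal_re, ← integral_const_mul, ha,
      integral_eq_lintegral_of_nonneg_ae]
    · refine congrArg ENNReal.toReal (setLIntegral_congr_fun (hSm n) fun t ht => ?_)
      simp only [hσ t ht.1]
    · filter_upwards [ae_restrict_mem (hSm n)] with t ht
      rw [hσ t ht.1]; exact abs_nonneg t
    · exact (measurable_id.const_mul σ).aestronglyMeasurable
  have hcf : ∀ n, c * (f (v n)).toReal ≤ a n := fun n => by
    have := ENNReal.toReal_mono (habs n).ne (hfv' n)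
    rwa [ENNReal.toReal_mul, ENNReal.toReal_ofReal hc.le] at this
  have hC0 : 0 ≤ |σ| * |C| * Real.sqrt (f u).toReal := by positivity
  have hba : ∀ n, a n ≤ |σ| * |C| * Real.sqrt (f u).toReal * Real.sqrt (f (v n)).toReal := fun n => by
    rw [haB n]
    calc σ * (B u (v n)).re ≤ |σ| * |(B u (v n)).re| := by
          rw [← abs_mul]; exact le_abs_self _
      _ ≤ |σ| * (C * Real.sqrt (f u).toReal * Real.sqrt (f (v n)).toReal) := by
          gcongr
          exact (Complex.abs_re_le_norm _).trans (hBC u _ hfu (hfv n))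
      _ ≤ |σ| * (|C| * Real.sqrt (f u).toReal * Real.sqrt (f (v n)).toReal) := by
          gcongr
          exact le_abs_self C
      _ = _ := by ring
  set K := |σ| * |C| * Real.sqrt (f u).toReal with hK
  -- With `x = f(v n)^{1/2}` the two preceding bounds read `c x² ≤ a n ≤ K x`, so `x ≤ K / c`
  -- uniformly in `n`. By monotone convergence `u` then does have finite `|A|`-form.
  have hx : ∀ n, Real.sqrt (f (v n)).toReal ≤ K / c := fun n => by
    by_contra! h
    have h1 := (hcf n).trans (hba n)
    set x := Real.sqrt (f (v n)).toReal with hxdef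
    have hx2 : (f (v n)).toReal = x * x := (Real.mul_self_sqrt ENNReal.toReal_nonneg).symm
    have hx0 : 0 < x := lt_of_le_of_lt (by positivity) h
    rw [hx2] at h1
    rw [div_lt_iff₀ hc] at h
    nlinarith
  have haK : ∀ n, a n ≤ K * (K / c) := fun n =>
    (hba n).trans (mul_le_mul_of_nonneg_left (hx n) hC0)
  have hSmono : Monotone S := fun i j hij => by
    have : (i : ℝ) ≤ j := by exact_mod_cast hij
    exact inter_subset_inter_right _ (Icc_subset_Icc (by linarith) this)
  have hSU : ⋃ n, S n = s := by
    rw [hS, ← inter_iUnion, inter_eq_left]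
    intro x _
    obtain ⟨n, hn⟩ := exists_nat_ge |x|
    exact mem_iUnion.2 ⟨n, abs_le.1 hn⟩
  have hmeas : Measurable fun t : ℝ => ENNReal.ofReal |t| :=
    ENNReal.measurable_ofReal.comp (continuous_abs.measurable)
  have htend : Tendsto (fun n => ∫⁻ t in S n, ENNReal.ofReal |t| ∂μ) atTop
      (𝓝 (∫⁻ t in s, ENNReal.ofReal |t| ∂μ)) := by
    have h := tendsto_measure_iUnion_atTop (μ := μ.withDensity fun t => ENNReal.ofReal |t|) hSmono
    rw [hSU, withDensity_apply _ hs] at h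
    refine h.congr fun n => ?_
    simp only [Function.comp]
    rw [withDensity_apply _ (hSm n)]
  have hμs : μ.restrict s = μ := by rw [hμ, ← E.measure_proj hs, hu]
  have htot : ∫⁻ t in s, ENNReal.ofReal |t| ∂μ < ∞ := by
    refine lt_of_le_of_lt (le_of_tendsto' htend fun n => ?_) (ENNReal.ofReal_lt_top (r := K * (K / c)))
    rw [← ENNReal.ofReal_toReal (habs n).ne]
    exact ENNReal.ofReal_le_ofReal (haK n)
  -- The form bound is now used for the remainder `u - v n`, so that `v n` tends to `u` in the norm
  -- given by `f`, not only in `H`; this permits the limit in `B`.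
  have hfu' : ∀ n, ENNReal.ofReal c * f (u - v n) ≤ ∫⁻ t in s \ S n, ENNReal.ofReal |t| ∂μ :=
    fun n => by
    have h1 : u - v n = E.proj (S n)ᶜ u := by rw [E.proj_compl (hSm n)]; rfl
    have h2 := hf (u - v n)
    rw [h1, E.measure_proj (hSm n).compl] at h2
    rw [h1]
    refine h2.trans (le_of_eq ?_)
    rw [← hμ]
    conv_lhs => rw [← hμs]
    rw [Measure.restrict_restrict (hSm n).compl, sdiff_eq, inter_comm]
  have hdiff : ∀ n, ∫⁻ t in s \ S n, ENNReal.ofReal |t| ∂μ =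
      ∫⁻ t in s, ENNReal.ofReal |t| ∂μ - ∫⁻ t in S n, ENNReal.ofReal |t| ∂μ := fun n =>
    ENNReal.eq_sub_of_add_eq (habs n).ne
      (by
        rw [add_comm]
        have := lintegral_inter_add_sdiff (μ := μ) (fun t => ENNReal.ofReal |t|) s (hSm n)
        rwa [inter_eq_right.2 (inter_subset_left : S n ⊆ s)] at this)
  have hdt : Tendsto (fun n => ∫⁻ t in s \ S n, ENNReal.ofReal |t| ∂μ) atTop (𝓝 0) := by
    simp only [hdiff]
    have := ENNReal.Tendsto.sub (tendsto_const_nhds (x := ∫⁻ t in s, ENNReal.ofReal |t| ∂μ)) htend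
      (Or.inl htot.ne)
    rwa [tsub_self] at this
  have hfuv : ∀ n, f (u - v n) < ∞ := fun n => by
    by_contra h
    rw [not_lt, top_le_iff] at h
    have := hfu' n
    rw [h, ENNReal.mul_top hcpos, top_le_iff] at this
    exact (lt_of_le_of_lt (lintegral_mono_set sdiff_subset) htot).ne this
  have hft : Tendsto (fun n => Real.sqrt (f (u - v n)).toReal) atTop (𝓝 0) := by
    have h1 : Tendsto (fun n => (f (u - v n)).toReal) atTop (𝓝 0) := by
      have h2 := ((ENNReal.tendsto_toReal ENNReal.zero_ne_top).comp hdt).const_mul c⁻¹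
      rw [ENNReal.toReal_zero, mul_zero] at h2
      refine squeeze_zero (fun n => ENNReal.toReal_nonneg) (fun n => ?_) h2
      have := ENNReal.toReal_mono
        (lt_of_le_of_lt (lintegral_mono_set sdiff_subset) htot).ne (hfu' n)
      rw [ENNReal.toReal_mul, ENNReal.toReal_ofReal hc.le] at this
      simp only [Function.comp]
      rwa [le_inv_mul_iff₀ hc]
    have := h1.sqrt
    rwa [Real.sqrt_zero] at this
  have hBt : Tendsto (fun n => B u (v n)) atTop (𝓝 (B u u)) := by
    rw [tendsto_iff_norm_sub_tendsto_zero]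
    have h2 := hft.const_mul (C * Real.sqrt (f u).toReal)
    rw [mul_zero] at h2
    refine squeeze_zero (fun n => norm_nonneg _) (fun n => ?_) h2
    rw [norm_sub_rev, ← hBsub u u (v n) hfu hfu (hfv n)]
    exact hBC _ _ hfu (hfuv n)
  have hat : Tendsto a atTop (𝓝 (∫⁻ t in s, ENNReal.ofReal |t| ∂μ).toReal) :=
    (ENNReal.tendsto_toReal htot.ne).comp htend
  have hat' : Tendsto a atTop (𝓝 (σ * (B u u).re)) := by
    have := ((Complex.continuous_re.tendsto _).comp hBt).const_mul σ
    refine this.congr fun n => ?_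
    rw [haB n]; rfl
  rw [← tendsto_nhds_unique hat hat', hμs]
  have h := ENNReal.toReal_mono (by rw [hμs] at htot; exact htot.ne) (hf u)
  rwa [ENNReal.toReal_mul, ENNReal.toReal_ofReal hc.le] at h

/-! ### Gaussian integrals -/

/-- With `a = |x|²` this represents `|x|⁻²` as a superposition of Gaussians. -/
theorem lintegral_exp_neg_pi_mul {a : ℝ} (ha : 0 < a) :
    ∫⁻ t in Ioi (0 : ℝ), ENNReal.ofReal (Real.exp (-(Real.pi * t * a))) =
      ENNReal.ofReal (Real.pi * a)⁻¹ := by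
  have hpa : 0 < Real.pi * a := by positivity
  have h1 := Real.integral_rpow_mul_exp_neg_mul_Ioi (a := 1) one_pos hpa
  have h2 := integrableOn_rpow_mul_exp_neg_mul_rpow (p := 1) (s := 0) (by norm_num) one_pos hpa
  simp only [sub_self, Real.rpow_zero, one_mul, Real.rpow_one, Real.Gamma_one, mul_one,
    one_div] at h1 h2
  rw [← h1, ofReal_integral_eq_lintegral_ofReal]
  · exact lintegral_congr fun t => by congr 3; ring
  · exact h2.congr (ae_of_all _ fun t => by simp only [neg_mul])
  · exact ae_of_all _ fun t => (Real.exp_pos _).le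

/-- With `a = |x|²` this is the Gaussian representation of the Coulomb potential `|x|⁻¹`. -/
theorem lintegral_inv_sqrt_mul_exp {a : ℝ} (ha : 0 < a) :
    ∫⁻ t in Ioi (0 : ℝ), ENNReal.ofReal ((Real.sqrt t)⁻¹ * Real.exp (-(Real.pi * t * a))) =
      ENNReal.ofReal (Real.sqrt a)⁻¹ := by
  have hpa : 0 < Real.pi * a := by positivity
  have h1 := Real.integral_rpow_mul_exp_neg_mul_Ioi (a := 1 / 2) (by norm_num) hpa
  have h2 := integrableOn_rpow_mul_exp_neg_mul_rpow (p := 1) (s := -(1 / 2)) (by norm_num) one_pos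
    hpa
  have hr : ∀ t ∈ Ioi (0 : ℝ), t ^ (-(1 / 2) : ℝ) = (Real.sqrt t)⁻¹ := fun t ht => by
    rw [Real.rpow_neg (le_of_lt ht), ← Real.sqrt_eq_rpow]
  have hv : (1 / (Real.pi * a)) ^ (1 / 2 : ℝ) * Real.Gamma (1 / 2) = (Real.sqrt a)⁻¹ := by
    rw [Real.Gamma_one_half_eq, ← Real.sqrt_eq_rpow, one_div, Real.sqrt_inv,
      Real.sqrt_mul Real.pi_pos.le]
    have : Real.sqrt Real.pi ≠ 0 := (Real.sqrt_pos.2 Real.pi_pos).ne'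
    field_simp
  rw [hv] at h1
  rw [← h1, ofReal_integral_eq_lintegral_ofReal]
  · refine setLIntegral_congr_fun measurableSet_Ioi fun t ht => ?_
    rw [← hr t ht]
    congr 3
    · norm_num
    · ring_nf
  · refine h2.congr_fun (fun t ht => ?_) measurableSet_Ioi
    simp only [Real.rpow_one]
    congr 2
    · norm_num
    · ring
  · filter_upwards [ae_restrict_mem measurableSet_Ioi] with t ht
    exact mul_nonneg (Real.rpow_nonneg (le_of_lt ht) _) (Real.exp_pos _).le

/-- With `a = |ζ|²` this is the integral over widths of the Fourier transforms of the Gaussians that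
make up the Coulomb potential. -/
theorem lintegral_inv_sq_mul_exp_neg_div {a : ℝ} (ha : 0 < a) :
    ∫⁻ t in Ioi (0 : ℝ), ENNReal.ofReal ((t ^ 2)⁻¹ * Real.exp (-(Real.pi * a / t))) =
      ENNReal.ofReal (Real.pi * a)⁻¹ := by
  set b := Real.pi * a with hb
  have hb0 : 0 < b := by positivity
  -- An antiderivative is `b⁻¹ exp(-b/t)`; `expNegInvGlue` extends it continuously by `0` at `t =
  -- 0`.
  set G : ℝ → ℝ := fun t => b⁻¹ * expNegInvGlue (t / b) with hG
  have hcont : Continuous G :=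
    continuous_const.mul ((expNegInvGlue.contDiff (n := 0)).continuous.comp
      (continuous_id.div_const b))
  have heq : ∀ t : ℝ, 0 < t → G t = b⁻¹ * Real.exp (-(b / t)) := fun t ht => by
    simp only [hG, expNegInvGlue]
    rw [if_neg (not_le.2 (by positivity)), inv_div]
  have hder : ∀ t ∈ Ioi (0 : ℝ), HasDerivAt G ((t ^ 2)⁻¹ * Real.exp (-(b / t))) t := by
    intro t ht
    have ht0 : t ≠ 0 := (ne_of_gt ht)
    have h1 : HasDerivAt (fun t : ℝ => b⁻¹ * Real.exp (-(b / t))) ((t ^ 2)⁻¹ * Real.exp (-(b / t))) t := by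
      have h2 : HasDerivAt (fun t : ℝ => -(b / t)) (b / t ^ 2) t := by
        have := ((hasDerivAt_inv ht0).const_mul b).neg
        simp only [div_eq_mul_inv]
        convert! this using 1
        ring
      have := (h2.exp).const_mul b⁻¹
      convert! this using 1
      field_simp
    exact h1.congr_of_eventuallyEq ((eventually_gt_nhds ht).mono fun y hy => heq y hy)
  have hlim : Tendsto G atTop (𝓝 b⁻¹) := by
    have h1 : Tendsto (fun t : ℝ => b⁻¹ * Real.exp (-(b / t))) atTop (𝓝 (b⁻¹ * Real.exp (-0))) :=
      (((tendsto_const_nhds.div_atTop tendsto_id).neg).rexp).const_mul _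
    rw [neg_zero, Real.exp_zero, mul_one] at h1
    exact h1.congr' ((eventually_gt_atTop 0).mono fun y hy => (heq y hy).symm)
  have hpos : ∀ t ∈ Ioi (0 : ℝ), 0 ≤ (t ^ 2)⁻¹ * Real.exp (-(b / t)) := fun t _ => by positivity
  have h1 := integral_Ioi_of_hasDerivAt_of_nonneg hcont.continuousWithinAt hder hpos hlim
  have h2 := integrableOn_Ioi_deriv_of_nonneg hcont.continuousWithinAt hder hpos hlim
  have h0 : G 0 = 0 := by simp [hG]
  rw [h0, sub_zero] at h1
  rw [← h1, ofReal_integral_eq_lintegral_ofReal h2]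
  filter_upwards [ae_restrict_mem measurableSet_Ioi] with t ht using hpos t ht

/-- The antiderivative is `2 arctan √b`. This value supplies the third factor `π` in the convolution
constant `π³`. -/
theorem lintegral_inv_sqrt_mul_inv_one_add :
    ∫⁻ b in Ioi (0 : ℝ), ENNReal.ofReal ((Real.sqrt b)⁻¹ * (1 + b)⁻¹) =
      ENNReal.ofReal Real.pi := by
  have hcont : Continuous fun b : ℝ => 2 * Real.arctan (Real.sqrt b) :=
    continuous_const.mul (Real.continuous_arctan.comp Real.continuous_sqrt)
  have hder : ∀ b ∈ Ioi (0 : ℝ), HasDerivAt (fun b : ℝ => 2 * Real.arctan (Real.sqrt b))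
      ((Real.sqrt b)⁻¹ * (1 + b)⁻¹) b := by
    intro b hb
    have hb0 : 0 < b := hb
    have := ((Real.hasDerivAt_sqrt hb0.ne').arctan).const_mul 2
    convert! this using 1
    rw [Real.sq_sqrt hb0.le]
    have : Real.sqrt b ≠ 0 := (Real.sqrt_pos.2 hb0).ne'
    field_simp
  have hlim : Tendsto (fun b : ℝ => 2 * Real.arctan (Real.sqrt b)) atTop (𝓝 Real.pi) := by
    have h1 : Tendsto (fun b : ℝ => Real.arctan (Real.sqrt b)) atTop (𝓝 (Real.pi / 2)) :=
      (Real.tendsto_arctan_atTop.mono_right nhdsWithin_le_nhds).comp Real.tendsto_sqrt_atTop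
    have := h1.const_mul 2
    convert! this using 2
    ring
  have hpos : ∀ t ∈ Ioi (0 : ℝ), 0 ≤ (Real.sqrt t)⁻¹ * (1 + t)⁻¹ := fun t ht => by
    have : (0 : ℝ) < t := ht
    positivity
  have h1 := integral_Ioi_of_hasDerivAt_of_nonneg hcont.continuousWithinAt hder hpos hlim
  have h2 := integrableOn_Ioi_deriv_of_nonneg hcont.continuousWithinAt hder hpos hlim
  rw [Real.sqrt_zero, Real.arctan_zero, mul_zero, sub_zero] at h1
  rw [← h1, ofReal_integral_eq_lintegral_ofReal h2]
  filter_upwards [ae_restrict_mem measurableSet_Ioi] with t ht using hpos t ht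

theorem lintegral_gaussian {b : ℝ} (hb : 0 < b) (w : R3) :
    ∫⁻ z : R3, ENNReal.ofReal (Real.exp (-(Real.pi * b * ‖z - w‖ ^ 2))) =
      ENNReal.ofReal (b * Real.sqrt b)⁻¹ := by
  rw [lintegral_sub_right_eq_self
    (fun z : R3 => ENNReal.ofReal (Real.exp (-(Real.pi * b * ‖z‖ ^ 2)))) w]
  have hpb : 0 < Real.pi * b := by positivity
  have h1 := GaussianFourier.integral_rexp_neg_mul_sq_norm (V := R3) hpb
  have hval : (Real.pi / (Real.pi * b)) ^ ((Module.finrank ℝ R3 : ℝ) / 2) =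
      (b * Real.sqrt b)⁻¹ := by
    rw [finrank_euclideanSpace_fin]
    have e : Real.pi / (Real.pi * b) = b⁻¹ := by
      have := Real.pi_pos.ne'
      field_simp
    rw [e, show ((3 : ℕ) : ℝ) / 2 = 1 + 1 / 2 by norm_num, Real.rpow_add (by positivity),
      Real.rpow_one, ← Real.sqrt_eq_rpow, Real.sqrt_inv, mul_inv]
  rw [hval] at h1
  -- A non-integrable function would have Bochner integral `0`, whereas the computed value is
  -- positive.
  have h2 : Integrable fun v : R3 => Real.exp (-(Real.pi * b) * ‖v‖ ^ 2) := by
    by_contra h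
    rw [integral_undef h] at h1
    have : 0 < (b * Real.sqrt b)⁻¹ := by positivity
    exact this.ne h1
  rw [← h1, ofReal_integral_eq_lintegral_ofReal h2 (ae_of_all _ fun z => (Real.exp_pos _).le)]
  simp only [neg_mul]

/-- Completing the square about the weighted mean of `x` and `y` leaves one Gaussian in `z` and a
factor depending only on `x - y`. -/
theorem lintegral_gaussian_mul_gaussian {s t : ℝ} (hs : 0 < s) (ht : 0 < t) (x y : R3) :
    ∫⁻ z : R3, ENNReal.ofReal (Real.exp (-(Real.pi * s * ‖x - z‖ ^ 2))) *
        ENNReal.ofReal (Real.exp (-(Real.pi * t * ‖y - z‖ ^ 2))) =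
      ENNReal.ofReal (((s + t) * Real.sqrt (s + t))⁻¹ *
        Real.exp (-(Real.pi * (s * t / (s + t)) * ‖x - y‖ ^ 2))) := by
  have hst : 0 < s + t := by positivity
  set w : R3 := (s + t)⁻¹ • (s • x + t • y) with hw
  have key : ∀ z : R3, s * ‖x - z‖ ^ 2 + t * ‖y - z‖ ^ 2 =
      (s + t) * ‖z - w‖ ^ 2 + s * t / (s + t) * ‖x - y‖ ^ 2 := by
    intro z
    simp only [EuclideanSpace.real_norm_sq_eq, hw, PiLp.sub_apply, PiLp.smul_apply,
      PiLp.add_apply, smul_eq_mul, Fin.sum_univ_three]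
    field_simp
    ring
  have h1 : ∀ z : R3, ENNReal.ofReal (Real.exp (-(Real.pi * s * ‖x - z‖ ^ 2))) *
        ENNReal.ofReal (Real.exp (-(Real.pi * t * ‖y - z‖ ^ 2))) =
      ENNReal.ofReal (Real.exp (-(Real.pi * (s * t / (s + t)) * ‖x - y‖ ^ 2))) *
        ENNReal.ofReal (Real.exp (-(Real.pi * (s + t) * ‖z - w‖ ^ 2))) := by
    intro z
    rw [← ENNReal.ofReal_mul (Real.exp_pos _).le, ← ENNReal.ofReal_mul (Real.exp_pos _).le,
      ← Real.exp_add, ← Real.exp_add]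
    congr 2
    linear_combination (-Real.pi) * key z
  simp only [h1]
  rw [lintegral_const_mul' _ _ ENNReal.ofReal_ne_top, lintegral_gaussian hst,
    ← ENNReal.ofReal_mul (Real.exp_pos _).le, mul_comm]

theorem setLIntegral_Ioi_comp_mul {s : ℝ} (hs : 0 < s) (g : ℝ → ℝ≥0∞) :
    ∫⁻ t in Ioi (0 : ℝ), g t = ENNReal.ofReal s * ∫⁻ b in Ioi (0 : ℝ), g (s * b) := by
  conv_lhs => rw [← Real.smul_map_volume_mul_left hs.ne', abs_of_pos hs]
  rw [Measure.restrict_smul, lintegral_smul_measure, smul_eq_mul]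
  congr 1
  have he : MeasurableEmbedding fun b : ℝ => s * b := measurableEmbedding_mulLeft₀ hs.ne'
  rw [he.restrict_map, he.lintegral_map]
  congr 2
  ext b
  simp [hs]

/-- The convolution of two copies of `|x|⁻²` on `ℝ³` is `π³ |x|⁻¹`. -/
theorem lintegral_inv_sq_mul_inv_sq {x y : R3} (hxy : x ≠ y) :
    ∫⁻ z : R3, ENNReal.ofReal (‖x - z‖ ^ 2)⁻¹ * ENNReal.ofReal (‖y - z‖ ^ 2)⁻¹ =
      ENNReal.ofReal (Real.pi ^ 3) * ENNReal.ofReal ‖x - y‖⁻¹ := by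
  set r := ‖x - y‖ with hr
  have hr0 : 0 < r := norm_pos_iff.2 (sub_ne_zero.2 hxy)
  have hsq : ∀ x z : R3, z ≠ x → ENNReal.ofReal (‖x - z‖ ^ 2)⁻¹ = ENNReal.ofReal Real.pi *
      ∫⁻ t in Ioi (0 : ℝ), ENNReal.ofReal (Real.exp (-(Real.pi * t * ‖x - z‖ ^ 2))) := by
    intro x z hz
    have : 0 < ‖x - z‖ := norm_pos_iff.2 (sub_ne_zero.2 hz.symm)
    rw [lintegral_exp_neg_pi_mul (by positivity), ← ENNReal.ofReal_mul Real.pi_pos.le]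
    congr 1
    have := Real.pi_pos.ne'
    field_simp
  have hmeas : ∀ x : R3, Measurable fun p : R3 × ℝ =>
      ENNReal.ofReal (Real.exp (-(Real.pi * p.2 * ‖x - p.1‖ ^ 2))) := fun x =>
    ENNReal.measurable_ofReal.comp (Continuous.measurable (by fun_prop))
  calc ∫⁻ z : R3, ENNReal.ofReal (‖x - z‖ ^ 2)⁻¹ * ENNReal.ofReal (‖y - z‖ ^ 2)⁻¹
      = ∫⁻ z : R3, ENNReal.ofReal (Real.pi ^ 2) * ∫⁻ s in Ioi (0 : ℝ), ∫⁻ t in Ioi (0 : ℝ),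
          ENNReal.ofReal (Real.exp (-(Real.pi * s * ‖x - z‖ ^ 2))) *
          ENNReal.ofReal (Real.exp (-(Real.pi * t * ‖y - z‖ ^ 2))) := by
        refine lintegral_congr_ae ?_
        filter_upwards [Measure.ae_ne volume x, Measure.ae_ne volume y] with z hzx hzy
        rw [hsq x z hzx, hsq y z hzy, mul_mul_mul_comm, ← ENNReal.ofReal_mul Real.pi_pos.le,
          ← sq]
        congr 1
        rw [lintegral_lintegral_mul]
        · exact ((hmeas x).comp (measurable_prodMk_left (x := z))).aemeasurable
        · exact ((hmeas y).comp (measurable_prodMk_left (x := z))).aemeasurable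
    _ = ENNReal.ofReal (Real.pi ^ 2) * ∫⁻ s in Ioi (0 : ℝ), ∫⁻ t in Ioi (0 : ℝ), ∫⁻ z : R3,
          ENNReal.ofReal (Real.exp (-(Real.pi * s * ‖x - z‖ ^ 2))) *
          ENNReal.ofReal (Real.exp (-(Real.pi * t * ‖y - z‖ ^ 2))) := by
        rw [lintegral_const_mul' _ _ ENNReal.ofReal_ne_top]
        congr 1
        rw [lintegral_lintegral_swap]
        · refine lintegral_congr fun s => ?_
          rw [lintegral_lintegral_swap]
          refine Measurable.aemeasurable (Measurable.fun_mul ?_ ?_)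
          · exact (hmeas x).comp (f := fun p : R3 × ℝ => (p.1, s)) (by fun_prop)
          · exact (hmeas y)
        · refine Measurable.aemeasurable ?_
          refine Measurable.lintegral_prod_right'
            (f := fun p : (R3 × ℝ) × ℝ =>
              ENNReal.ofReal (Real.exp (-(Real.pi * p.1.2 * ‖x - p.1.1‖ ^ 2))) *
              ENNReal.ofReal (Real.exp (-(Real.pi * p.2 * ‖y - p.1.1‖ ^ 2)))) ?_
          refine Measurable.fun_mul ?_ ?_
          · exact (hmeas x).comp measurable_fst
          · exact (hmeas y).comp (f := fun p : (R3 × ℝ) × ℝ => (p.1.1, p.2)) (by fun_prop)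
    _ = ENNReal.ofReal (Real.pi ^ 2) * ∫⁻ s in Ioi (0 : ℝ), ∫⁻ b in Ioi (0 : ℝ),
          ENNReal.ofReal (((1 + b) * Real.sqrt (1 + b))⁻¹) * ENNReal.ofReal ((Real.sqrt s)⁻¹ *
            Real.exp (-(Real.pi * s * (b / (1 + b) * r ^ 2)))) := by
        congr 1
        refine setLIntegral_congr_fun measurableSet_Ioi fun s hs => ?_
        have hs0 : 0 < s := hs
        -- The substitution `t = s b` makes the exponent linear in `s`, so that the integrals over
        -- `s` and `b` can be done one after the other.
        rw [setLIntegral_Ioi_comp_mul hs0, ← lintegral_const_mul' _ _ ENNReal.ofReal_ne_top]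
        refine setLIntegral_congr_fun measurableSet_Ioi fun b hb => ?_
        have hb0 : 0 < b := hb
        rw [lintegral_gaussian_mul_gaussian hs0 (by positivity), ← ENNReal.ofReal_mul hs0.le,
          ← ENNReal.ofReal_mul (by positivity)]
        congr 1
        have e1 : s + s * b = s * (1 + b) := by ring
        have e2 : Real.pi * (s * (s * b) / (s * (1 + b))) * r ^ 2 =
            Real.pi * s * (b / (1 + b) * r ^ 2) := by
          field_simp
        rw [e1, e2, Real.sqrt_mul hs0.le]
        have e3 : Real.sqrt s ≠ 0 := (Real.sqrt_pos.2 hs0).ne'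
        have e4 : Real.sqrt (1 + b) ≠ 0 := (Real.sqrt_pos.2 (by positivity)).ne'
        field_simp
    _ = ENNReal.ofReal (Real.pi ^ 2) * ∫⁻ b in Ioi (0 : ℝ), ∫⁻ s in Ioi (0 : ℝ),
          ENNReal.ofReal (((1 + b) * Real.sqrt (1 + b))⁻¹) * ENNReal.ofReal ((Real.sqrt s)⁻¹ *
            Real.exp (-(Real.pi * s * (b / (1 + b) * r ^ 2)))) := by
        rw [lintegral_lintegral_swap]
        refine Measurable.aemeasurable ?_
        fun_prop
    _ = ENNReal.ofReal (Real.pi ^ 2) * ∫⁻ b in Ioi (0 : ℝ),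
          ENNReal.ofReal r⁻¹ * ENNReal.ofReal ((Real.sqrt b)⁻¹ * (1 + b)⁻¹) := by
        congr 1
        refine setLIntegral_congr_fun measurableSet_Ioi fun b hb => ?_
        have hb0 : 0 < b := hb
        rw [lintegral_const_mul' _ _ ENNReal.ofReal_ne_top,
          lintegral_inv_sqrt_mul_exp (by positivity), ← ENNReal.ofReal_mul (by positivity),
          ← ENNReal.ofReal_mul (by positivity)]
        congr 1
        rw [Real.sqrt_mul (by positivity), Real.sqrt_sq hr0.le, Real.sqrt_div hb0.le]
        have e3 : Real.sqrt b ≠ 0 := (Real.sqrt_pos.2 hb0).ne'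
        have e4 : Real.sqrt (1 + b) ≠ 0 := (Real.sqrt_pos.2 (by positivity)).ne'
        field_simp
    _ = ENNReal.ofReal (Real.pi ^ 3) * ENNReal.ofReal r⁻¹ := by
        rw [lintegral_const_mul' _ _ ENNReal.ofReal_ne_top, lintegral_inv_sqrt_mul_inv_one_add,
          mul_comm (ENNReal.ofReal r⁻¹), ← mul_assoc, ← ENNReal.ofReal_mul (by positivity)]
        congr 2

/-! ### Bounded multiplication operators and the Fourier transform -/

theorem exists_mulOperator {M : R3 → Spinor →L[ℂ] Spinor} (hM : AEStronglyMeasurable M volume)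
    {C : ℝ} (hC : ∀ x, ‖M x‖ ≤ C) :
    ∃ T : Hil →L[ℂ] Hil, ∀ u : Hil, T u =ᵐ[volume] fun x => M x (u x) := by
  have hmem : ∀ u : Hil, MemLp (fun x => M x (u x)) 2 volume := fun u =>
    (Lp.memLp u).of_le_mul (c := C)
      (isBoundedBilinearMap_apply.continuous.comp_aestronglyMeasurable
        (hM.prodMk (Lp.aestronglyMeasurable u)))
      (ae_of_all _ fun x => (M x).le_of_opNorm_le (hC x) _)
  let L : Hil →ₗ[ℂ] Hil :=
    { toFun := fun u => (hmem u).toLp _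
      map_add' := fun u v => by
        rw [← MemLp.toLp_add]
        refine MemLp.toLp_congr _ _ ?_
        filter_upwards [Lp.coeFn_add u v] with x hx
        rw [hx, Pi.add_apply, map_add]
        rfl
      map_smul' := fun c u => by
        rw [RingHom.id_apply, ← MemLp.toLp_const_smul]
        refine MemLp.toLp_congr _ _ ?_
        filter_upwards [Lp.coeFn_smul c u] with x hx
        rw [hx, Pi.smul_apply, map_smul]
        rfl }
  refine ⟨L.mkContinuous C fun u => ?_, fun u => MemLp.coeFn_toLp (hmem u)⟩
  refine Lp.norm_le_mul_norm_of_ae_le_mul ?_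
  filter_upwards [MemLp.coeFn_toLp (hmem u)] with x hx
  change ‖(hmem u).toLp _ x‖ ≤ _
  rw [hx]
  exact (M x).le_of_opNorm_le (hC x) _

theorem exists_scalarMulOperator {g : R3 → ℂ} (hg : AEStronglyMeasurable g volume)
    {C : ℝ} (hC : ∀ x, ‖g x‖ ≤ C) :
    ∃ T : Hil →L[ℂ] Hil, ∀ u : Hil, T u =ᵐ[volume] fun x => g x • u x := by
  have hC0 : 0 ≤ C := (norm_nonneg _).trans (hC 0)
  obtain ⟨T, hT⟩ := exists_mulOperator (M := fun x => g x • ContinuousLinearMap.id ℂ Spinor)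
    (hg.smul_const _) (C := C) (fun x => ContinuousLinearMap.opNorm_le_bound _ hC0 fun v => by
      simp only [smul_apply, ContinuousLinearMap.id_apply, norm_smul]
      gcongr
      exact hC x)
  exact ⟨T, hT⟩

/-- The translation `v ↦ v(· - ζ)` on `𝔥`. -/
noncomputable def translate (ζ : R3) : Hil →ₗᵢ[ℂ] Hil :=
  Lp.compMeasurePreservingₗᵢ ℂ (fun x => x - ζ) (measurePreserving_sub_right volume ζ)

theorem translate_ae (ζ : R3) (v : Hil) : translate ζ v =ᵐ[volume] fun x => v (x - ζ) :=
  Lp.coeFn_compMeasurePreserving v (measurePreserving_sub_right volume ζ)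

theorem translate_toLp (ζ : R3) (f : SchwartzMap R3 Spinor) :
    translate ζ (f.toLp 2) = (f.compSubConstCLM ℂ ζ).toLp 2 := by
  refine Lp.ext ?_
  have h := (measurePreserving_sub_right volume ζ).quasiMeasurePreserving.ae (f.coeFn_toLp 2 volume)
  filter_upwards [translate_ae ζ (f.toLp 2), (f.compSubConstCLM ℂ ζ).coeFn_toLp 2 volume, h]
    with x h1 h2 h3
  rw [h1, h2, h3]
  rfl

theorem fourierL2_symm_toLp (f : SchwartzMap R3 Spinor) :
    fourierL2.symm (f.toLp 2) = (𝓕⁻ f).toLp 2 := SchwartzMap.toLp_fourierInv_eq f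

theorem schwartz_fourierInv_translate (ζ y : R3) (f : SchwartzMap R3 Spinor) :
    (𝓕⁻ (f.compSubConstCLM ℂ ζ)) y = ((Real.fourierChar ⟪ζ, y⟫_ℝ : Circle) : ℂ) • (𝓕⁻ f) y := by
  have h1 : ∀ g : SchwartzMap R3 Spinor, (𝓕⁻ g) y =
      ∫ v, ((Real.fourierChar ⟪v, y⟫_ℝ : Circle) : ℂ) • g v := fun g => by
    rw [SchwartzMap.fourierInv_coe, Real.fourierInv_eq]
    rfl
  rw [h1, h1, ← integral_smul]
  rw [← integral_add_right_eq_self _ ζ]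
  refine integral_congr_ae (ae_of_all _ fun v => ?_)
  simp only [SchwartzMap.compSubConstCLM_apply, add_sub_cancel_right, smul_smul]
  rw [inner_add_left, AddChar.map_add_eq_mul, Circle.coe_mul, mul_comm]

theorem continuous_fourierChar_coe :
    Continuous fun r : ℝ => ((Real.fourierChar r : Circle) : ℂ) := by
  simp only [Real.fourierChar_apply]
  fun_prop

theorem norm_fourierChar_coe (r : ℝ) : ‖((Real.fourierChar r : Circle) : ℂ)‖ = 1 :=
  Circle.norm_coe _

/-- The identity is explicit on Schwartz functions. Both sides are continuous in `v`, the right side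
because multiplication by a character is realized as the bounded operator `T`, so density suffices.
-/
theorem fourierL2_symm_translate (ζ : R3) (v : Hil) :
    fourierL2.symm (translate ζ v) =ᵐ[volume]
      fun y => ((Real.fourierChar ⟪ζ, y⟫_ℝ : Circle) : ℂ) • fourierL2.symm v y := by
  obtain ⟨T, hT⟩ := exists_scalarMulOperator
    (g := fun y => ((Real.fourierChar ⟪ζ, y⟫_ℝ : Circle) : ℂ))
    (continuous_fourierChar_coe.comp (by fun_prop)).aestronglyMeasurable (C := 1)
    (fun y => (norm_fourierChar_coe _).le)
  suffices h : fourierL2.symm (translate ζ v) = T (fourierL2.symm v) by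
    rw [h]; exact hT _
  refine DenseRange.induction_on (p := fun v => fourierL2.symm (translate ζ v) =
      T (fourierL2.symm v)) (SchwartzMap.denseRange_toLpCLM (p := 2) ENNReal.ofNat_ne_top) v ?_ ?_
  · exact isClosed_eq (fourierL2.symm.continuous.comp (translate ζ).continuous)
      (T.continuous.comp fourierL2.symm.continuous)
  · intro f
    change fourierL2.symm (translate ζ (f.toLp 2)) = T (fourierL2.symm (f.toLp 2))
    rw [translate_toLp, fourierL2_symm_toLp, fourierL2_symm_toLp]
    refine Lp.ext ?_
    filter_upwards [hT ((𝓕⁻ f).toLp 2), (𝓕⁻ f).coeFn_toLp 2 volume,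
      (𝓕⁻ (f.compSubConstCLM ℂ ζ)).coeFn_toLp 2 volume] with y h1 h2 h3
    rw [h1, h2, h3, schwartz_fourierInv_translate]

/-- By Plancherel the left integral is the autocorrelation of the Fourier transform: multiplying by
a character in position space translates in momentum space. -/
theorem enorm_integral_fourierChar_norm_sq_le (u : Hil) (ζ : R3) :
    ‖∫ y, ((Real.fourierChar ⟪ζ, y⟫_ℝ : Circle) : ℂ) * ((‖u y‖ ^ 2 : ℝ) : ℂ)‖ₑ ≤
      ∫⁻ ξ, ‖fourierL2 u ξ‖ₑ * ‖fourierL2 u (ξ - ζ)‖ₑ := by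
  set v := fourierL2 u with hv
  have hu : fourierL2.symm v = u := fourierL2.symm_apply_apply u
  have h1 : ⟪u, fourierL2.symm (translate ζ v)⟫_ℂ = ⟪v, translate ζ v⟫_ℂ := by
    rw [hv, ← fourierL2.inner_map_map, fourierL2.apply_symm_apply]
  rw [L2.inner_def, L2.inner_def] at h1
  have h2 : ∫ y, ((Real.fourierChar ⟪ζ, y⟫_ℝ : Circle) : ℂ) * ((‖u y‖ ^ 2 : ℝ) : ℂ) =
      ∫ ξ, ⟪v ξ, v (ξ - ζ)⟫_ℂ := by
    have h3 : ∫ ξ, ⟪v ξ, translate ζ v ξ⟫_ℂ = ∫ ξ, ⟪v ξ, v (ξ - ζ)⟫_ℂ := by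
      refine integral_congr_ae ?_
      filter_upwards [translate_ae ζ v] with ξ hξ
      rw [hξ]
    rw [← h3, ← h1]
    refine integral_congr_ae ?_
    filter_upwards [fourierL2_symm_translate ζ v] with y hy
    rw [hy, hu, inner_smul_right, inner_self_eq_norm_sq_to_K]
    push_cast
    rfl
  rw [h2]
  refine (enorm_integral_le_lintegral_enorm _).trans (lintegral_mono fun ξ => ?_)
  rw [← ofReal_norm, ← ofReal_norm, ← ofReal_norm, ← ENNReal.ofReal_mul (norm_nonneg _)]
  exact ENNReal.ofReal_le_ofReal (norm_inner_le_norm _ _)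

theorem integral_gaussian_fourierChar {t : ℝ} (ht : 0 < t) (w : R3) :
    ∫ ζ : R3, (((t * Real.sqrt t)⁻¹ * Real.exp (-(Real.pi * ‖ζ‖ ^ 2 / t)) : ℝ) : ℂ) *
      ((Real.fourierChar ⟪ζ, w⟫_ℝ : Circle) : ℂ) =
      (Real.exp (-(Real.pi * t * ‖w‖ ^ 2)) : ℂ) := by
  have hb : 0 < ((Real.pi / t : ℝ) : ℂ).re := by
    rw [Complex.ofReal_re]; positivity
  have h := GaussianFourier.integral_cexp_neg_mul_sq_norm_add (V := R3) hb
    (2 * Real.pi * Complex.I) w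
  have hpi : (Real.pi : ℂ) ≠ 0 := by exact_mod_cast Real.pi_pos.ne'
  have htc : (t : ℂ) ≠ 0 := by exact_mod_cast ht.ne'
  have e1 : ((Real.pi : ℂ) / ((Real.pi / t : ℝ) : ℂ)) ^ ((Module.finrank ℝ R3 : ℂ) / 2) =
      ((t * Real.sqrt t : ℝ) : ℂ) := by
    have : (Real.pi : ℂ) / ((Real.pi / t : ℝ) : ℂ) = (t : ℂ) := by
      push_cast
      field_simp
    rw [this, finrank_euclideanSpace_fin, show ((3 : ℕ) : ℂ) / 2 = ((3 / 2 : ℝ) : ℂ) by norm_num,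
      ← Complex.ofReal_cpow ht.le, show (3 / 2 : ℝ) = 1 + 1 / 2 by norm_num, Real.rpow_add ht,
      Real.rpow_one, ← Real.sqrt_eq_rpow]
  have e2 : Complex.exp ((2 * Real.pi * Complex.I) ^ 2 * (‖w‖ : ℂ) ^ 2 /
      (4 * ((Real.pi / t : ℝ) : ℂ))) = (Real.exp (-(Real.pi * t * ‖w‖ ^ 2)) : ℂ) := by
    rw [Complex.ofReal_exp]
    congr 1
    push_cast
    field_simp
    rw [Complex.I_sq]
    ring
  rw [e1, e2] at h
  have e3 : ∀ ζ : R3, (((t * Real.sqrt t)⁻¹ * Real.exp (-(Real.pi * ‖ζ‖ ^ 2 / t)) : ℝ) : ℂ) *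
      ((Real.fourierChar ⟪ζ, w⟫_ℝ : Circle) : ℂ) = (((t * Real.sqrt t)⁻¹ : ℝ) : ℂ) *
      Complex.exp (-((Real.pi / t : ℝ) : ℂ) * (‖ζ‖ : ℂ) ^ 2 +
        2 * Real.pi * Complex.I * (⟪w, ζ⟫_ℝ : ℂ)) := by
    intro ζ
    rw [Real.fourierChar_apply, Complex.exp_add, Complex.ofReal_mul, Complex.ofReal_exp,
      real_inner_comm, mul_assoc]
    congr 2
    · congr 1
      push_cast
      ring
    · congr 1
      push_cast
      ring
  simp only [e3]
  rw [integral_const_mul, h, ← mul_assoc, ← Complex.ofReal_mul, inv_mul_cancel₀, Complex.ofReal_one,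
    one_mul]
  have : 0 < t * Real.sqrt t := by positivity
  exact this.ne'

theorem integrable_norm_sq (u : Hil) : Integrable fun y => ‖u y‖ ^ 2 :=
  (memLp_two_iff_integrable_sq_norm (Lp.aestronglyMeasurable u)).1 (Lp.memLp u)

theorem integrable_gaussian {t : ℝ} (ht : 0 < t) :
    Integrable fun ζ : R3 => (t * Real.sqrt t)⁻¹ * Real.exp (-(Real.pi * ‖ζ‖ ^ 2 / t)) := by
  have h := integral_gaussian_fourierChar ht 0
  by_contra hn
  have h2 : ∫ ζ : R3, (((t * Real.sqrt t)⁻¹ * Real.exp (-(Real.pi * ‖ζ‖ ^ 2 / t)) : ℝ) : ℂ) = 0 := by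
    rw [integral_undef]
    exact fun hc => hn hc.re
  simp only [inner_zero_right, AddChar.map_zero_eq_one, Circle.coe_one, mul_one, h2] at h
  simp at h

/-- The Gaussian is written as a Fourier integral and the order of integration exchanged. The centre
`x` enters only through a phase, so the bound is uniform in `x`. -/
theorem lintegral_norm_sq_mul_gaussian_le (u : Hil) (x : R3) {t : ℝ} (ht : 0 < t) :
    ∫⁻ y, ENNReal.ofReal (‖u y‖ ^ 2) * ENNReal.ofReal (Real.exp (-(Real.pi * t * ‖y - x‖ ^ 2))) ≤
      ∫⁻ ζ, ENNReal.ofReal ((t * Real.sqrt t)⁻¹ * Real.exp (-(Real.pi * ‖ζ‖ ^ 2 / t))) *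
        ∫⁻ ξ, ‖fourierL2 u ξ‖ₑ * ‖fourierL2 u (ξ - ζ)‖ₑ := by
  set G : R3 → ℝ := fun ζ => (t * Real.sqrt t)⁻¹ * Real.exp (-(Real.pi * ‖ζ‖ ^ 2 / t)) with hG
  have hGint : Integrable G := integrable_gaussian ht
  have hG0 : ∀ ζ, 0 ≤ G ζ := fun ζ => by positivity
  set e : R3 → R3 → ℂ := fun ζ y => ((Real.fourierChar ⟪ζ, y⟫_ℝ : Circle) : ℂ) with he
  have hecont : Continuous fun p : R3 × R3 => e p.1 p.2 :=
    continuous_fourierChar_coe.comp (by fun_prop)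
  have hLint : Integrable fun y => ‖u y‖ ^ 2 * Real.exp (-(Real.pi * t * ‖y - x‖ ^ 2)) := by
    refine (integrable_norm_sq u).mul_bdd (c := 1)
      (Continuous.aestronglyMeasurable (by fun_prop)) (ae_of_all _ fun y => ?_)
    rw [Real.norm_eq_abs, abs_of_pos (Real.exp_pos _), Real.exp_le_one_iff]
    have : 0 ≤ Real.pi * t * ‖y - x‖ ^ 2 := by positivity
    linarith
  have hFint : Integrable (Function.uncurry fun y ζ : R3 =>
      ((‖u y‖ ^ 2 : ℝ) : ℂ) * ((G ζ : ℂ) * e ζ (y - x))) (volume.prod volume) := by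
    have h1 : Integrable (fun p : R3 × R3 => ((‖u p.1‖ ^ 2 : ℝ) : ℂ) * (G p.2 : ℂ))
        (volume.prod volume) := (integrable_norm_sq u).ofReal.mul_prod hGint.ofReal
    have h2 := h1.mul_bdd (c := 1) (g := fun p : R3 × R3 => e p.2 (p.1 - x))
      (Continuous.aestronglyMeasurable (hecont.comp (f := fun p : R3 × R3 => (p.2, p.1 - x))
        (by fun_prop))) (ae_of_all _ fun p => (norm_fourierChar_coe _).le)
    refine h2.congr (ae_of_all _ fun p => ?_)
    simp only [Function.uncurry, mul_assoc]
  have key : ((∫ y, ‖u y‖ ^ 2 * Real.exp (-(Real.pi * t * ‖y - x‖ ^ 2)) : ℝ) : ℂ) =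
      ∫ ζ, ((G ζ : ℂ) * e ζ (-x)) * ∫ y, e ζ y * ((‖u y‖ ^ 2 : ℝ) : ℂ) := by
    rw [← integral_complex_ofReal]
    calc ∫ y, ((‖u y‖ ^ 2 * Real.exp (-(Real.pi * t * ‖y - x‖ ^ 2)) : ℝ) : ℂ)
        = ∫ y, ∫ ζ, ((‖u y‖ ^ 2 : ℝ) : ℂ) * ((G ζ : ℂ) * e ζ (y - x)) := by
          refine integral_congr_ae (ae_of_all _ fun y => ?_)
          simp only
          rw [integral_const_mul, integral_gaussian_fourierChar ht (y - x), Complex.ofReal_mul]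
      _ = ∫ ζ, ∫ y, ((‖u y‖ ^ 2 : ℝ) : ℂ) * ((G ζ : ℂ) * e ζ (y - x)) :=
          integral_integral_swap hFint
      _ = _ := by
          refine integral_congr_ae (ae_of_all _ fun ζ => ?_)
          simp only
          rw [← integral_const_mul]
          refine integral_congr_ae (ae_of_all _ fun y => ?_)
          simp only [he]
          rw [sub_eq_add_neg, inner_add_right, AddChar.map_add_eq_mul, Circle.coe_mul]
          ring
  have h0 : ∫⁻ y, ENNReal.ofReal (‖u y‖ ^ 2) *
      ENNReal.ofReal (Real.exp (-(Real.pi * t * ‖y - x‖ ^ 2))) =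
      ‖((∫ y, ‖u y‖ ^ 2 * Real.exp (-(Real.pi * t * ‖y - x‖ ^ 2)) : ℝ) : ℂ)‖ₑ := by
    rw [← ofReal_norm, Complex.norm_real, Real.norm_of_nonneg (integral_nonneg fun y => by
      positivity), ofReal_integral_eq_lintegral_ofReal hLint (ae_of_all _ fun y => by positivity)]
    exact lintegral_congr fun y => (ENNReal.ofReal_mul (by positivity)).symm
  rw [h0, key]
  refine (enorm_integral_le_lintegral_enorm _).trans (lintegral_mono fun ζ => ?_)
  rw [enorm_mul, enorm_mul]
  have h1 : ‖(G ζ : ℂ)‖ₑ = ENNReal.ofReal (G ζ) := by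
    rw [← ofReal_norm, Complex.norm_real, Real.norm_of_nonneg (hG0 ζ)]
  have h2 : ‖e ζ (-x)‖ₑ = 1 := by
    rw [← ofReal_norm, norm_fourierChar_coe, ENNReal.ofReal_one]
  rw [h1, h2, mul_one]
  gcongr
  exact enorm_integral_fourierChar_norm_sq_le u ζ

/-- Kato's inequality on the Fourier side, before the Schur test. -/
theorem lintegral_norm_sq_div_le (u : Hil) (x : R3) :
    ∫⁻ y, ENNReal.ofReal (‖u y‖ ^ 2) * ENNReal.ofReal ‖y - x‖⁻¹ ≤
      ∫⁻ ζ, ENNReal.ofReal (Real.pi * ‖ζ‖ ^ 2)⁻¹ *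
        ∫⁻ ξ, ‖fourierL2 u ξ‖ₑ * ‖fourierL2 u (ξ - ζ)‖ₑ := by
  have hum : AEMeasurable (fun y => ENNReal.ofReal (‖u y‖ ^ 2)) volume :=
    (integrable_norm_sq u).aestronglyMeasurable.aemeasurable.ennreal_ofReal
  have hvm : Measurable (fun y => ‖fourierL2 u y‖ₑ) :=
    (Lp.stronglyMeasurable (fourierL2 u)).measurable.enorm
  -- The Coulomb weight is split into Gaussians of parameter `t`, each is moved to the Fourier side,
  -- and the `t`-integral there produces the kernel `1/(π|ζ|²)`.
  calc ∫⁻ y, ENNReal.ofReal (‖u y‖ ^ 2) * ENNReal.ofReal ‖y - x‖⁻¹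
      = ∫⁻ y, ∫⁻ t in Ioi (0 : ℝ), ENNReal.ofReal (Real.sqrt t)⁻¹ * (ENNReal.ofReal (‖u y‖ ^ 2) *
          ENNReal.ofReal (Real.exp (-(Real.pi * t * ‖y - x‖ ^ 2)))) := by
        refine lintegral_congr_ae ?_
        filter_upwards [Measure.ae_ne volume x] with y hy
        have hr : 0 < ‖y - x‖ := norm_pos_iff.2 (sub_ne_zero.2 hy)
        rw [← Real.sqrt_sq hr.le, ← lintegral_inv_sqrt_mul_exp (a := ‖y - x‖ ^ 2) (by positivity),
          Real.sqrt_sq hr.le, ← lintegral_const_mul' _ _ ENNReal.ofReal_ne_top]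
        refine setLIntegral_congr_fun measurableSet_Ioi fun t ht => ?_
        rw [ENNReal.ofReal_mul (by positivity), mul_left_comm]
    _ = ∫⁻ t in Ioi (0 : ℝ), ∫⁻ y, ENNReal.ofReal (Real.sqrt t)⁻¹ * (ENNReal.ofReal (‖u y‖ ^ 2) *
          ENNReal.ofReal (Real.exp (-(Real.pi * t * ‖y - x‖ ^ 2)))) := by
        rw [lintegral_lintegral_swap]
        refine AEMeasurable.fun_mul ?_ (AEMeasurable.fun_mul ?_ ?_)
        · exact Measurable.aemeasurable (by fun_prop)
        · exact hum.comp_fst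
        · exact Measurable.aemeasurable (by fun_prop)
    _ ≤ ∫⁻ t in Ioi (0 : ℝ), ∫⁻ ζ, ENNReal.ofReal ((t ^ 2)⁻¹ *
          Real.exp (-(Real.pi * ‖ζ‖ ^ 2 / t))) *
          ∫⁻ ξ, ‖fourierL2 u ξ‖ₑ * ‖fourierL2 u (ξ - ζ)‖ₑ := by
        refine setLIntegral_mono' measurableSet_Ioi fun t ht => ?_
        have ht0 : 0 < t := ht
        rw [lintegral_const_mul' _ _ ENNReal.ofReal_ne_top]
        refine (mul_le_mul_right (lintegral_norm_sq_mul_gaussian_le u x ht0) _).trans ?_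
        rw [← lintegral_const_mul' _ _ ENNReal.ofReal_ne_top]
        refine lintegral_mono fun ζ => ?_
        rw [← mul_assoc, ← ENNReal.ofReal_mul (by positivity)]
        refine le_of_eq ?_
        congr 2
        have : Real.sqrt t ≠ 0 := (Real.sqrt_pos.2 ht0).ne'
        have h2 : Real.sqrt t ^ 2 = t := Real.sq_sqrt ht0.le
        field_simp
        rw [h2]
    _ = ∫⁻ ζ, ∫⁻ t in Ioi (0 : ℝ), ENNReal.ofReal ((t ^ 2)⁻¹ *
          Real.exp (-(Real.pi * ‖ζ‖ ^ 2 / t))) *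
          ∫⁻ ξ, ‖fourierL2 u ξ‖ₑ * ‖fourierL2 u (ξ - ζ)‖ₑ := by
        rw [lintegral_lintegral_swap]
        refine Measurable.aemeasurable (Measurable.fun_mul ?_ ?_)
        · fun_prop
        · refine Measurable.lintegral_prod_right' (f := fun p : (ℝ × R3) × R3 =>
            ‖fourierL2 u p.2‖ₑ * ‖fourierL2 u (p.2 - p.1.2)‖ₑ) ?_
          exact (hvm.comp measurable_snd).mul
            (hvm.comp (measurable_snd.sub measurable_fst.snd))
    _ = _ := by
        refine lintegral_congr_ae ?_
        filter_upwards [Measure.ae_ne volume 0] with ζ hζ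
        have hr : 0 < ‖ζ‖ := norm_pos_iff.2 hζ
        rw [lintegral_mul_const _ (by fun_prop), lintegral_inv_sq_mul_exp_neg_div (by positivity)]

/-! ### Kato's inequality -/

theorem measurable_norm_coe (u : Hil) : Measurable fun x => ‖u x‖ :=
  (Lp.stronglyMeasurable u).measurable.norm

theorem continuous_freeEnergy (m : ℝ) : Continuous (freeEnergy m) := by
  unfold freeEnergy; fun_prop

theorem freeEnergy_nonneg (m : ℝ) (ξ : R3) : 0 ≤ freeEnergy m ξ := Real.sqrt_nonneg _

theorem two_pi_mul_norm_le_freeEnergy (m : ℝ) (ξ : R3) : 2 * Real.pi * ‖ξ‖ ≤ freeEnergy m ξ :=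
  Real.le_sqrt_of_sq_le (by nlinarith [sq_nonneg m])

theorem abs_le_freeEnergy (m : ℝ) (ξ : R3) : |m| ≤ freeEnergy m ξ :=
  Real.le_sqrt_of_sq_le (by rw [sq_abs]; nlinarith [sq_nonneg (2 * Real.pi * ‖ξ‖)])

/-- **Kato's inequality** `∫ |u(y)|² / |y - x| dy ≤ (π / 2) ⟪u, |D₀| u⟫`. -/
theorem kato (m : ℝ) (u : Hil) (x : R3) :
    ∫⁻ y, ENNReal.ofReal (‖u y‖ ^ 2) * ENNReal.ofReal ‖y - x‖⁻¹ ≤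
      ENNReal.ofReal (Real.pi / 2) * freeAbsForm m u := by
  refine (lintegral_norm_sq_div_le u x).trans ?_
  set v := fourierL2 u with hv
  have hvm : Measurable fun ξ => ‖v ξ‖ := measurable_norm_coe v
  set A : R3 → ℝ≥0∞ := fun ξ => ENNReal.ofReal (2⁻¹ * (‖v ξ‖ ^ 2 * ‖ξ‖ ^ 2)) with hA
  have hAm : Measurable A := by fun_prop
  set W : R3 → ℝ≥0∞ := fun ζ => ENNReal.ofReal (Real.pi * ‖ζ‖ ^ 2)⁻¹ with hW
  have hWm : Measurable W := by fun_prop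
  -- Schur test: the weight `|ξ|/|ξ-ζ|` in `2xy ≤ x² + y²` is chosen so that the remaining integral
  -- over `ζ` is the convolution of two copies of `|·|⁻²`, known exactly.
  have hschur : ∀ᵐ ζ : R3, ∀ᵐ ξ : R3, ‖v ξ‖ₑ * ‖v (ξ - ζ)‖ₑ ≤
      A ξ * ENNReal.ofReal (‖ξ - ζ‖ ^ 2)⁻¹ + A (ξ - ζ) * ENNReal.ofReal (‖ξ‖ ^ 2)⁻¹ := by
    refine ae_of_all _ fun ζ => ?_
    filter_upwards [Measure.ae_ne volume 0, Measure.ae_ne volume ζ] with ξ h0 h1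
    have h0' : 0 < ‖ξ‖ := norm_pos_iff.2 h0
    have h1' : 0 < ‖ξ - ζ‖ := norm_pos_iff.2 (sub_ne_zero.2 h1)
    rw [← ofReal_norm, ← ofReal_norm, ← ENNReal.ofReal_mul (norm_nonneg _),
      ← ENNReal.ofReal_mul (by positivity), ← ENNReal.ofReal_mul (by positivity),
      ← ENNReal.ofReal_add (by positivity) (by positivity)]
    refine ENNReal.ofReal_le_ofReal ?_
    have h2 := sq_nonneg (‖v ξ‖ * ‖ξ‖ * ‖ξ - ζ‖⁻¹ - ‖v (ξ - ζ)‖ * ‖ξ - ζ‖ * ‖ξ‖⁻¹)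
    have h3 : ‖v ξ‖ * ‖v (ξ - ζ)‖ = (‖v ξ‖ * ‖ξ‖ * ‖ξ - ζ‖⁻¹) * (‖v (ξ - ζ)‖ * ‖ξ - ζ‖ * ‖ξ‖⁻¹) := by
      field_simp
    rw [h3, ← inv_pow, ← inv_pow]
    linarith
  -- The two signs of `σ` cover the two terms of the Schur test; the second acquires `σ = -1` after
  -- translating `ξ` by `ζ`.
  have hJ : ∀ ξ : R3, ξ ≠ 0 → ∀ σ : ℝ, σ = 1 ∨ σ = -1 →
      ∫⁻ ζ, W ζ * ENNReal.ofReal (‖ξ - σ • ζ‖ ^ 2)⁻¹ =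
      ENNReal.ofReal (Real.pi ^ 2) * ENNReal.ofReal ‖ξ‖⁻¹ := by
    intro ξ hξ σ hσ
    have h1 := lintegral_inv_sq_mul_inv_sq (x := σ • ξ) (y := 0) (by
      rcases hσ with rfl | rfl <;> simpa using hξ)
    have h2 : ∀ ζ : R3, W ζ * ENNReal.ofReal (‖ξ - σ • ζ‖ ^ 2)⁻¹ = ENNReal.ofReal Real.pi⁻¹ *
        (ENNReal.ofReal (‖σ • ξ - ζ‖ ^ 2)⁻¹ * ENNReal.ofReal (‖0 - ζ‖ ^ 2)⁻¹) := by
      intro ζ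
      have : ‖ξ - σ • ζ‖ = ‖σ • ξ - ζ‖ := by
        rcases hσ with rfl | rfl
        · simp
        · rw [← norm_neg]
          congr 1
          simp only [neg_smul, one_smul]
          abel
      rw [this, zero_sub, norm_neg, hW]
      simp only
      rw [mul_inv, ENNReal.ofReal_mul (by positivity), mul_assoc,
        mul_comm (ENNReal.ofReal (‖ζ‖ ^ 2)⁻¹)]
    simp only [h2]
    rw [lintegral_const_mul' _ _ ENNReal.ofReal_ne_top, h1, sub_zero, ← mul_assoc,
      ← ENNReal.ofReal_mul (by positivity), norm_smul]
    congr 2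
    · have := Real.pi_pos.ne'
      field_simp
    · rcases hσ with rfl | rfl <;> simp
  -- The sharp constant arises here: `π² |ξ| = (π/2)(2π|ξ|)`, and `2π|ξ|` is at most the free
  -- energy.
  have hA2 : ∀ ξ : R3, A ξ * (ENNReal.ofReal (Real.pi ^ 2) * ENNReal.ofReal ‖ξ‖⁻¹) ≤
      ENNReal.ofReal (Real.pi / 2) * (ENNReal.ofReal 2⁻¹ *
        ENNReal.ofReal (freeEnergy m ξ * ‖v ξ‖ ^ 2)) := by
    intro ξ
    rw [← ENNReal.ofReal_mul (by positivity), ← ENNReal.ofReal_mul (by positivity),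
      ← ENNReal.ofReal_mul (by positivity), ← ENNReal.ofReal_mul (by positivity)]
    refine ENNReal.ofReal_le_ofReal ?_
    have h1 : ‖ξ‖ ^ 2 * ‖ξ‖⁻¹ ≤ ‖ξ‖ := by
      rcases eq_or_ne ‖ξ‖ 0 with h | h
      · simp [h]
      · field_simp; exact le_rfl
    have h2 := two_pi_mul_norm_le_freeEnergy m ξ
    calc 2⁻¹ * (‖v ξ‖ ^ 2 * ‖ξ‖ ^ 2) * (Real.pi ^ 2 * ‖ξ‖⁻¹)
        = 2⁻¹ * ‖v ξ‖ ^ 2 * Real.pi ^ 2 * (‖ξ‖ ^ 2 * ‖ξ‖⁻¹) := by ring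
      _ ≤ 2⁻¹ * ‖v ξ‖ ^ 2 * Real.pi ^ 2 * ‖ξ‖ := by gcongr
      _ = Real.pi / 2 * (2⁻¹ * ((2 * Real.pi * ‖ξ‖) * ‖v ξ‖ ^ 2)) := by ring
      _ ≤ _ := by gcongr
  have hterm1 : ∫⁻ ζ, W ζ * ∫⁻ ξ, A ξ * ENNReal.ofReal (‖ξ - ζ‖ ^ 2)⁻¹ =
      ∫⁻ ξ, A ξ * ∫⁻ ζ, W ζ * ENNReal.ofReal (‖ξ - (1 : ℝ) • ζ‖ ^ 2)⁻¹ := by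
    have h1 : ∀ ζ, W ζ * ∫⁻ ξ, A ξ * ENNReal.ofReal (‖ξ - ζ‖ ^ 2)⁻¹ =
        ∫⁻ ξ, A ξ * (W ζ * ENNReal.ofReal (‖ξ - (1 : ℝ) • ζ‖ ^ 2)⁻¹) := fun ζ => by
      rw [← lintegral_const_mul' _ _ ENNReal.ofReal_ne_top]
      exact lintegral_congr fun ξ => by rw [one_smul, mul_left_comm]
    simp only [h1]
    rw [lintegral_lintegral_swap (Measurable.aemeasurable (by fun_prop))]
    exact lintegral_congr fun ξ => lintegral_const_mul' _ _ ENNReal.ofReal_ne_top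
  have hterm2 : ∫⁻ ζ, W ζ * ∫⁻ ξ, A (ξ - ζ) * ENNReal.ofReal (‖ξ‖ ^ 2)⁻¹ =
      ∫⁻ ξ, A ξ * ∫⁻ ζ, W ζ * ENNReal.ofReal (‖ξ - (-1 : ℝ) • ζ‖ ^ 2)⁻¹ := by
    have h1 : ∀ ζ, W ζ * ∫⁻ ξ, A (ξ - ζ) * ENNReal.ofReal (‖ξ‖ ^ 2)⁻¹ =
        ∫⁻ ξ, A ξ * (W ζ * ENNReal.ofReal (‖ξ - (-1 : ℝ) • ζ‖ ^ 2)⁻¹) := fun ζ => by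
      rw [← lintegral_add_right_eq_self _ ζ, ← lintegral_const_mul' _ _ ENNReal.ofReal_ne_top]
      exact lintegral_congr fun ξ => by
        rw [neg_smul, one_smul, sub_neg_eq_add, add_sub_cancel_right, mul_left_comm]
    simp only [h1]
    rw [lintegral_lintegral_swap (Measurable.aemeasurable (by fun_prop))]
    exact lintegral_congr fun ξ => lintegral_const_mul' _ _ ENNReal.ofReal_ne_top
  have hbound : ∀ σ : ℝ, σ = 1 ∨ σ = -1 →
      ∫⁻ ξ, A ξ * ∫⁻ ζ, W ζ * ENNReal.ofReal (‖ξ - σ • ζ‖ ^ 2)⁻¹ ≤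
        ENNReal.ofReal (Real.pi / 2) * (ENNReal.ofReal 2⁻¹ * freeAbsForm m u) := by
    intro σ hσ
    unfold freeAbsForm
    rw [← lintegral_const_mul' _ _ ENNReal.ofReal_ne_top,
      ← lintegral_const_mul' _ _ ENNReal.ofReal_ne_top]
    refine lintegral_mono_ae ?_
    filter_upwards [Measure.ae_ne volume 0] with ξ hξ
    rw [hJ ξ hξ σ hσ]
    exact hA2 ξ
  calc ∫⁻ ζ, W ζ * ∫⁻ ξ, ‖v ξ‖ₑ * ‖v (ξ - ζ)‖ₑ
      ≤ ∫⁻ ζ, (W ζ * ∫⁻ ξ, A ξ * ENNReal.ofReal (‖ξ - ζ‖ ^ 2)⁻¹) +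
          W ζ * ∫⁻ ξ, A (ξ - ζ) * ENNReal.ofReal (‖ξ‖ ^ 2)⁻¹ := by
        refine lintegral_mono_ae ?_
        filter_upwards [hschur] with ζ hζ
        rw [← mul_add, ← lintegral_add_left (by fun_prop)]
        exact mul_le_mul_right (lintegral_mono_ae hζ) _
    _ = (∫⁻ ζ, W ζ * ∫⁻ ξ, A ξ * ENNReal.ofReal (‖ξ - ζ‖ ^ 2)⁻¹) +
          ∫⁻ ζ, W ζ * ∫⁻ ξ, A (ξ - ζ) * ENNReal.ofReal (‖ξ‖ ^ 2)⁻¹ := by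
        rw [lintegral_add_left]
        refine hWm.mul (Measurable.lintegral_prod_right' (f := fun p : R3 × R3 =>
          A p.2 * ENNReal.ofReal (‖p.2 - p.1‖ ^ 2)⁻¹) (by fun_prop))
    _ ≤ ENNReal.ofReal (Real.pi / 2) * (ENNReal.ofReal 2⁻¹ * freeAbsForm m u) +
          ENNReal.ofReal (Real.pi / 2) * (ENNReal.ofReal 2⁻¹ * freeAbsForm m u) := by
        rw [hterm1, hterm2]
        exact add_le_add (hbound 1 (Or.inl rfl)) (hbound (-1) (Or.inr rfl))
    _ = ENNReal.ofReal (Real.pi / 2) * freeAbsForm m u := by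
        rw [← mul_add, ← add_mul, ← ENNReal.ofReal_add (by norm_num) (by norm_num)]
        norm_num

/-- This is the mass gap `|D₀| ≥ |m|`. With `m > 0` it makes finite `F`-norm imply trace class. -/
theorem freeAbsForm_ge (m : ℝ) (u : Hil) :
    ENNReal.ofReal |m| * ENNReal.ofReal (‖u‖ ^ 2) ≤ freeAbsForm m u := by
  have h : ENNReal.ofReal (‖u‖ ^ 2) = ∫⁻ ξ, ENNReal.ofReal (‖fourierL2 u ξ‖ ^ 2) := by
    rw [← ofReal_integral_eq_lintegral_ofReal (integrable_norm_sq _)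
      (ae_of_all _ fun _ => by positivity), ← fourierL2.norm_map u]
    congr 1
    have := L2.inner_def (𝕜 := ℂ) (fourierL2 u) (fourierL2 u)
    simp only [inner_self_eq_norm_sq_to_K] at this
    have h2 : ((‖fourierL2 u‖ ^ 2 : ℝ) : ℂ) = ((∫ ξ, ‖fourierL2 u ξ‖ ^ 2 : ℝ) : ℂ) := by
      rw [← integral_complex_ofReal]
      push_cast
      exact this
    exact_mod_cast h2
  rw [h, freeAbsForm, ← lintegral_const_mul' _ _ ENNReal.ofReal_ne_top]
  refine lintegral_mono fun ξ => ?_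
  rw [← ENNReal.ofReal_mul (abs_nonneg m)]
  refine ENNReal.ofReal_le_ofReal ?_
  gcongr
  exact abs_le_freeEnergy m ξ

/-! ### Positivity of the Coulomb kernel -/

/-- Writing the kernel `|x-y|⁻¹` as a convolution of two copies of `|·|⁻²` exhibits the Coulomb form
as an `L²` product of potentials. The convolution formula fails only on the diagonal, which is a
null set. -/
theorem lintegral_coulomb_eq {f g : R3 → ℝ≥0∞} (hf : AEMeasurable f volume)
    (hg : AEMeasurable g volume) :
    ∫⁻ p : R3 × R3, f p.1 * g p.2 * ENNReal.ofReal ‖p.1 - p.2‖⁻¹ =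
      ENNReal.ofReal (Real.pi ^ 3)⁻¹ * ∫⁻ z, (∫⁻ x, f x * ENNReal.ofReal (‖x - z‖ ^ 2)⁻¹) *
        ∫⁻ y, g y * ENNReal.ofReal (‖y - z‖ ^ 2)⁻¹ := by
  have hmF : AEMeasurable (fun p : R3 × R3 => f p.1 * g p.2) (volume.prod volume) :=
    hf.comp_fst.mul hg.comp_snd
  have hw : ∀ z : R3, Measurable fun x : R3 => ENNReal.ofReal (‖x - z‖ ^ 2)⁻¹ := fun z => by
    fun_prop
  have hdiag : ∀ᵐ p : R3 × R3 ∂(volume.prod volume), p.1 ≠ p.2 := by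
    refine (Measure.ae_prod_iff_ae_ae (p := fun p : R3 × R3 => p.1 ≠ p.2) ?_).2 ?_
    · exact (measurableSet_eq_fun measurable_fst measurable_snd).compl
    · exact ae_of_all _ fun x => (Measure.ae_ne volume x).mono fun y hy => hy.symm
  calc ∫⁻ p : R3 × R3, f p.1 * g p.2 * ENNReal.ofReal ‖p.1 - p.2‖⁻¹
      = ∫⁻ p : R3 × R3, ∫⁻ z, ENNReal.ofReal (Real.pi ^ 3)⁻¹ * (f p.1 * g p.2 *
          (ENNReal.ofReal (‖p.1 - z‖ ^ 2)⁻¹ * ENNReal.ofReal (‖p.2 - z‖ ^ 2)⁻¹))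
          ∂volume ∂(volume.prod volume) := by
        refine lintegral_congr_ae ?_
        filter_upwards [hdiag] with p hp
        rw [lintegral_const_mul' _ _ ENNReal.ofReal_ne_top,
          lintegral_const_mul _ (by fun_prop), lintegral_inv_sq_mul_inv_sq hp, mul_left_comm,
          ← mul_assoc (ENNReal.ofReal (Real.pi ^ 3)⁻¹), ← ENNReal.ofReal_mul (by positivity),
          inv_mul_cancel₀ (by positivity), ENNReal.ofReal_one, one_mul]
    _ = ∫⁻ z, ∫⁻ p : R3 × R3, ENNReal.ofReal (Real.pi ^ 3)⁻¹ * (f p.1 * g p.2 *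
          (ENNReal.ofReal (‖p.1 - z‖ ^ 2)⁻¹ * ENNReal.ofReal (‖p.2 - z‖ ^ 2)⁻¹))
          ∂(volume.prod volume) ∂volume := by
        rw [lintegral_lintegral_swap]
        refine AEMeasurable.const_mul (AEMeasurable.fun_mul ?_ ?_) _
        · exact hmF.comp_fst
        · exact Measurable.aemeasurable (by fun_prop)
    _ = _ := by
        rw [← lintegral_const_mul' _ _ ENNReal.ofReal_ne_top]
        refine lintegral_congr fun z => ?_
        rw [lintegral_const_mul' _ _ ENNReal.ofReal_ne_top]
        congr 1
        rw [← lintegral_prod_mul (hf.fun_mul (hw z).aemeasurable)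
          (hg.fun_mul (hw z).aemeasurable)]
        exact lintegral_congr fun p => by ring

/-- After factorization of the kernel this is `2ab ≤ a² + b²` at each `z`. Working with nonnegative
extended functions avoids integrability questions. -/
theorem lintegral_coulomb_add_le {f g : R3 → ℝ≥0∞} (hf : AEMeasurable f volume)
    (hg : AEMeasurable g volume) :
    (∫⁻ p : R3 × R3, f p.1 * g p.2 * ENNReal.ofReal ‖p.1 - p.2‖⁻¹) +
      ∫⁻ p : R3 × R3, g p.1 * f p.2 * ENNReal.ofReal ‖p.1 - p.2‖⁻¹ ≤
    (∫⁻ p : R3 × R3, f p.1 * f p.2 * ENNReal.ofReal ‖p.1 - p.2‖⁻¹) +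
      ∫⁻ p : R3 × R3, g p.1 * g p.2 * ENNReal.ofReal ‖p.1 - p.2‖⁻¹ := by
  have hm : ∀ {h : R3 → ℝ≥0∞}, AEMeasurable h volume →
      AEMeasurable (fun z : R3 => ∫⁻ x, h x * ENNReal.ofReal (‖x - z‖ ^ 2)⁻¹) volume :=
    fun {h} hh => AEMeasurable.lintegral_prod_right'
      (f := fun p : R3 × R3 => h p.2 * ENNReal.ofReal (‖p.2 - p.1‖ ^ 2)⁻¹)
      (hh.comp_snd.fun_mul (Measurable.aemeasurable (by fun_prop)))
  rw [lintegral_coulomb_eq hf hg, lintegral_coulomb_eq hg hf, lintegral_coulomb_eq hf hf,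
    lintegral_coulomb_eq hg hg, ← mul_add, ← mul_add,
    ← lintegral_add_left' ((hm hf).fun_mul (hm hg)), ← lintegral_add_left' ((hm hf).fun_mul (hm hf))]
  refine mul_le_mul_right (lintegral_mono fun z => ?_) _
  generalize (∫⁻ x, f x * ENNReal.ofReal (‖x - z‖ ^ 2)⁻¹) = a
  generalize (∫⁻ x, g x * ENNReal.ofReal (‖x - z‖ ^ 2)⁻¹) = b
  rcases eq_or_ne a ∞ with ha | ha
  · simp [ha]
  rcases eq_or_ne b ∞ with hb | hb
  · simp [hb]
  lift a to NNReal using ha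
  lift b to NNReal using hb
  rw [← ENNReal.coe_mul, ← ENNReal.coe_mul, ← ENNReal.coe_mul, ← ENNReal.coe_mul,
    ← ENNReal.coe_add, ← ENNReal.coe_add, ENNReal.coe_le_coe, ← NNReal.coe_le_coe]
  push_cast
  nlinarith [sq_nonneg ((a : ℝ) - b)]

/-- With `h = P - N` split into positive and negative parts, the claim is that the `PP` and `NN`
energies dominate the cross energies. -/
theorem integral_coulomb_nonneg {h : R3 → ℝ} (hh : AEStronglyMeasurable h volume)
    (hint : Integrable fun p : R3 × R3 => h p.1 * h p.2 * ‖p.1 - p.2‖⁻¹) :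
    0 ≤ ∫ p : R3 × R3, h p.1 * h p.2 * ‖p.1 - p.2‖⁻¹ := by
  set P : R3 → ℝ≥0∞ := fun x => ENNReal.ofReal (h x)
  set N : R3 → ℝ≥0∞ := fun x => ENNReal.ofReal (-h x)
  have hP : AEMeasurable P volume := hh.aemeasurable.ennreal_ofReal
  have hN : AEMeasurable N volume := hh.aemeasurable.neg.ennreal_ofReal
  have hw : ∀ p : R3 × R3, 0 ≤ ‖p.1 - p.2‖⁻¹ := fun p => by positivity
  have hm : ∀ {f g : R3 → ℝ≥0∞}, AEMeasurable f volume → AEMeasurable g volume →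
      AEMeasurable (fun p : R3 × R3 => f p.1 * g p.2 * ENNReal.ofReal ‖p.1 - p.2‖⁻¹) volume :=
    fun hf hg => (hf.comp_fst.fun_mul hg.comp_snd).fun_mul (Measurable.aemeasurable (by fun_prop))
  have hsgn : ∀ a b : ℝ, ENNReal.ofReal (a * b) = ENNReal.ofReal a * ENNReal.ofReal b +
      ENNReal.ofReal (-a) * ENNReal.ofReal (-b) := by
    intro a b
    rcases le_total 0 a with ha | ha
    · rw [ENNReal.ofReal_of_nonpos (p := -a) (by linarith), zero_mul, add_zero, ENNReal.ofReal_mul ha]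
    · rw [ENNReal.ofReal_of_nonpos ha, zero_mul, zero_add, ← ENNReal.ofReal_mul (by linarith),
        neg_mul_neg]
  have h1 : ∫⁻ p : R3 × R3, ENNReal.ofReal (h p.1 * h p.2 * ‖p.1 - p.2‖⁻¹) =
      (∫⁻ p : R3 × R3, P p.1 * P p.2 * ENNReal.ofReal ‖p.1 - p.2‖⁻¹) +
      ∫⁻ p : R3 × R3, N p.1 * N p.2 * ENNReal.ofReal ‖p.1 - p.2‖⁻¹ := by
    rw [← lintegral_add_left' (hm hP hP)]
    refine lintegral_congr fun p => ?_
    rw [ENNReal.ofReal_mul' (hw p), hsgn, add_mul]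
  have h2 : ∫⁻ p : R3 × R3, ENNReal.ofReal (-(h p.1 * h p.2 * ‖p.1 - p.2‖⁻¹)) =
      (∫⁻ p : R3 × R3, P p.1 * N p.2 * ENNReal.ofReal ‖p.1 - p.2‖⁻¹) +
      ∫⁻ p : R3 × R3, N p.1 * P p.2 * ENNReal.ofReal ‖p.1 - p.2‖⁻¹ := by
    rw [← lintegral_add_left' (hm hP hN)]
    refine lintegral_congr fun p => ?_
    rw [← neg_mul, ← mul_neg, ENNReal.ofReal_mul' (hw p), hsgn, neg_neg, add_mul]
  rw [integral_eq_lintegral_pos_part_sub_lintegral_neg_part hint, sub_nonneg, h1, h2]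
  refine ENNReal.toReal_mono ?_ (lintegral_coulomb_add_le hP hN)
  rw [← h1]
  exact (lt_of_le_of_lt (lintegral_mono fun p => Real.ofReal_le_enorm _) hint.2).ne

theorem integral_coulomb_conj_nonneg {g : R3 → ℂ} (hg : AEStronglyMeasurable g volume)
    (hint : Integrable fun p : R3 × R3 => g p.1 * star (g p.2) * ((‖p.1 - p.2‖⁻¹ : ℝ) : ℂ)) :
    0 ≤ (∫ p : R3 × R3, g p.1 * star (g p.2) * ((‖p.1 - p.2‖⁻¹ : ℝ) : ℂ)).re := by
  have hgen : ∀ r : ℂ → ℝ, Continuous r → (∀ z, |r z| ≤ ‖z‖) →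
      Integrable fun p : R3 × R3 => r (g p.1) * r (g p.2) * ‖p.1 - p.2‖⁻¹ := by
    intro r hr hrb
    have hrg : AEStronglyMeasurable (fun x => r (g x)) volume := hr.comp_aestronglyMeasurable hg
    refine hint.mono (((hrg.comp_fst).mul (hrg.comp_snd)).mul
      (Measurable.aestronglyMeasurable (by fun_prop))) (ae_of_all _ fun p => ?_)
    rw [norm_mul, norm_mul, norm_mul, norm_mul, Complex.norm_real, norm_star, Real.norm_eq_abs,
      Real.norm_eq_abs]
    gcongr
    · exact hrb _
    · exact hrb _
  have hre := hgen Complex.re Complex.continuous_re Complex.abs_re_le_norm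
  have him := hgen Complex.im Complex.continuous_im Complex.abs_im_le_norm
  have h : (∫ p : R3 × R3, g p.1 * star (g p.2) * ((‖p.1 - p.2‖⁻¹ : ℝ) : ℂ)).re =
      (∫ p : R3 × R3, (g p.1).re * (g p.2).re * ‖p.1 - p.2‖⁻¹) +
      ∫ p : R3 × R3, (g p.1).im * (g p.2).im * ‖p.1 - p.2‖⁻¹ := by
    rw [← integral_add hre him]
    change RCLike.re (∫ p : R3 × R3, g p.1 * star (g p.2) * ((‖p.1 - p.2‖⁻¹ : ℝ) : ℂ)) = _
    rw [← integral_re hint]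
    refine integral_congr_ae (ae_of_all _ fun p => ?_)
    simp only [RCLike.re_to_complex, Complex.mul_re, Complex.ofReal_re, Complex.ofReal_im, Complex.star_def,
      Complex.conj_re, Complex.conj_im]
    ring
  rw [h]
  exact add_nonneg
    (integral_coulomb_nonneg (Complex.continuous_re.comp_aestronglyMeasurable hg) hre)
    (integral_coulomb_nonneg (Complex.continuous_im.comp_aestronglyMeasurable hg) him)

/-! ### Direct and exchange energy of two orbitals -/

/-- The direct Coulomb energy of two orbitals. -/
noncomputable def directTerm (u v : Hil) : ℝ :=
  1 / 2 * ∫ p : R3 × R3, ‖u p.1‖ ^ 2 * ‖v p.2‖ ^ 2 * ‖p.1 - p.2‖⁻¹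

/-- The exchange energy of two orbitals. -/
noncomputable def exchangeTerm (u v : Hil) : ℝ :=
  1 / 2 * (∫ p : R3 × R3, ⟪u p.1, v p.1⟫_ℂ * ⟪v p.2, u p.2⟫_ℂ * ((‖p.1 - p.2‖⁻¹ : ℝ) : ℂ)).re

/-- The interaction energy (direct minus exchange) of two orbitals. -/
noncomputable def pairTerm (u v : Hil) : ℝ := directTerm u v - exchangeTerm u v

theorem lintegral_norm_sq (u : Hil) : ∫⁻ x, ENNReal.ofReal (‖u x‖ ^ 2) = ENNReal.ofReal (‖u‖ ^ 2) := by
  rw [← ofReal_integral_eq_lintegral_ofReal (integrable_norm_sq _)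
    (ae_of_all _ fun _ => by positivity)]
  congr 1
  have := L2.inner_def (𝕜 := ℂ) u u
  simp only [inner_self_eq_norm_sq_to_K] at this
  have h2 : ((‖u‖ ^ 2 : ℝ) : ℂ) = ((∫ ξ, ‖u ξ‖ ^ 2 : ℝ) : ℂ) := by
    rw [← integral_complex_ofReal]
    push_cast
    exact this
  exact_mod_cast h2.symm

theorem measurable_coulombWeight : Measurable fun p : R3 × R3 => ‖p.1 - p.2‖⁻¹ := by fun_prop

theorem lintegral_direct_le (m : ℝ) (u v : Hil) :
    ∫⁻ p : R3 × R3, ENNReal.ofReal (‖u p.1‖ ^ 2 * ‖v p.2‖ ^ 2 * ‖p.1 - p.2‖⁻¹) ≤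
      ENNReal.ofReal (Real.pi / 2) * freeAbsForm m v * ENNReal.ofReal (‖u‖ ^ 2) := by
  have hu := measurable_norm_coe u
  have hv := measurable_norm_coe v
  change ∫⁻ p : R3 × R3, _ ∂(volume.prod volume) ≤ _
  rw [lintegral_prod _ (Measurable.aemeasurable (by fun_prop)), ← lintegral_norm_sq u,
    ← lintegral_const_mul _ (by fun_prop)]
  refine lintegral_mono fun x => ?_
  rw [mul_comm]
  refine le_trans (le_of_eq ?_) (mul_le_mul_right (kato m v x) _)
  rw [← lintegral_const_mul' _ _ ENNReal.ofReal_ne_top]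
  refine lintegral_congr fun y => ?_
  rw [ENNReal.ofReal_mul (by positivity), ENNReal.ofReal_mul (by positivity), mul_assoc,
    norm_sub_rev]

theorem integrable_direct {m : ℝ} (u : Hil) {v : Hil} (hv : freeAbsForm m v < ∞) :
    Integrable fun p : R3 × R3 => ‖u p.1‖ ^ 2 * ‖v p.2‖ ^ 2 * ‖p.1 - p.2‖⁻¹ := by
  have hum := measurable_norm_coe u
  have hvm := measurable_norm_coe v
  refine ⟨Measurable.aestronglyMeasurable (by fun_prop), ?_⟩
  rw [hasFiniteIntegral_iff_ofReal (ae_of_all _ fun p => by positivity)]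
  exact lt_of_le_of_lt (lintegral_direct_le m u v) (ENNReal.mul_lt_top
    (ENNReal.mul_lt_top ENNReal.ofReal_lt_top hv) ENNReal.ofReal_lt_top)

theorem integrable_direct_swap {m : ℝ} {u : Hil} (v : Hil) (hu : freeAbsForm m u < ∞) :
    Integrable fun p : R3 × R3 => ‖u p.1‖ ^ 2 * ‖v p.2‖ ^ 2 * ‖p.1 - p.2‖⁻¹ := by
  refine (integrable_direct v hu).swap.congr (ae_of_all _ fun p => ?_)
  simp only [Function.comp, Prod.fst_swap, Prod.snd_swap]
  rw [norm_sub_rev]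
  ring

theorem directTerm_comm (u v : Hil) : directTerm u v = directTerm v u := by
  unfold directTerm
  congr 1
  change ∫ p : R3 × R3, _ ∂(volume.prod volume) = _
  rw [← integral_prod_swap]
  refine integral_congr_ae (ae_of_all _ fun p => ?_)
  simp only [Prod.fst_swap, Prod.snd_swap]
  rw [norm_sub_rev]
  ring

theorem directTerm_nonneg (u v : Hil) : 0 ≤ directTerm u v :=
  mul_nonneg (by norm_num) (integral_nonneg fun p => by positivity)

theorem directTerm_le {m : ℝ} (u : Hil) {v : Hil} (hv : freeAbsForm m v < ∞) :
    directTerm u v ≤ Real.pi / 4 * (‖u‖ ^ 2 * (freeAbsForm m v).toReal) := by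
  unfold directTerm
  rw [integral_eq_lintegral_of_nonneg_ae (ae_of_all _ fun p => by positivity)
    (integrable_direct u hv).aestronglyMeasurable]
  have h := ENNReal.toReal_mono (ENNReal.mul_lt_top
    (ENNReal.mul_lt_top ENNReal.ofReal_lt_top hv) ENNReal.ofReal_lt_top).ne
    (lintegral_direct_le m u v)
  rw [ENNReal.toReal_mul, ENNReal.toReal_mul, ENNReal.toReal_ofReal (by positivity),
    ENNReal.toReal_ofReal (by positivity)] at h
  linarith

/-- A crude bound, not used for sharp constants. The pairing of `a` with `c` and of `b` with `d`
yields products of densities at the two points, whose Coulomb integrals Kato's inequality controls.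
-/
theorem norm_exchange_le (a b c d : Spinor) {w : ℝ} (hw : 0 ≤ w) :
    ‖⟪a, b⟫_ℂ * ⟪c, d⟫_ℂ * (w : ℂ)‖ ≤
      ‖a‖ ^ 2 * ‖c‖ ^ 2 * w + ‖b‖ ^ 2 * ‖d‖ ^ 2 * w := by
  rw [norm_mul, norm_mul, Complex.norm_real, Real.norm_of_nonneg hw, ← add_mul]
  gcongr
  calc ‖⟪a, b⟫_ℂ‖ * ‖⟪c, d⟫_ℂ‖ ≤ (‖a‖ * ‖b‖) * (‖c‖ * ‖d‖) := by
        gcongr <;> exact norm_inner_le_norm _ _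
    _ ≤ _ := by
        nlinarith [sq_nonneg (‖a‖ * ‖c‖ - ‖b‖ * ‖d‖), sq_nonneg (‖a‖ * ‖c‖), sq_nonneg (‖b‖ * ‖d‖)]

theorem stronglyMeasurable_inner (u v : Hil) : StronglyMeasurable fun x => ⟪u x, v x⟫_ℂ :=
  (Lp.stronglyMeasurable u).inner (Lp.stronglyMeasurable v)

theorem measurable_exchange (a b c d : Hil) : AEStronglyMeasurable
    (fun p : R3 × R3 => ⟪a p.1, b p.1⟫_ℂ * ⟪c p.2, d p.2⟫_ℂ * ((‖p.1 - p.2‖⁻¹ : ℝ) : ℂ)) volume :=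
  (((stronglyMeasurable_inner a b).comp_measurable measurable_fst).mul
    ((stronglyMeasurable_inner c d).comp_measurable measurable_snd)).aestronglyMeasurable.mul
    (Complex.measurable_ofReal.comp measurable_coulombWeight).aestronglyMeasurable

theorem integrable_exchange {m : ℝ} (u : Hil) {v : Hil} (hv : freeAbsForm m v < ∞) :
    Integrable fun p : R3 × R3 =>
      ⟪u p.1, v p.1⟫_ℂ * ⟪v p.2, u p.2⟫_ℂ * ((‖p.1 - p.2‖⁻¹ : ℝ) : ℂ) := by
  refine ((integrable_direct u hv).add (integrable_direct_swap u hv)).mono'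
    (measurable_exchange u v v u) (ae_of_all _ fun p => ?_)
  exact norm_exchange_le _ _ _ _ (by positivity)

/-- The exchange term is the Coulomb self-energy of the complex density `⟪u(x), v(x)⟫`. -/
theorem exchangeTerm_nonneg {m : ℝ} (u : Hil) {v : Hil} (hv : freeAbsForm m v < ∞) :
    0 ≤ exchangeTerm u v := by
  have hs : ∀ x, star ⟪u x, v x⟫_ℂ = ⟪v x, u x⟫_ℂ := fun x => inner_conj_symm _ _
  have h := integral_coulomb_conj_nonneg (g := fun x => ⟪u x, v x⟫_ℂ)
    (stronglyMeasurable_inner u v).aestronglyMeasurable (by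
      simp only [hs]; exact integrable_exchange u hv)
  simp only [hs] at h
  exact mul_nonneg (by norm_num) h

/-- The pointwise squared norm of the unnormalized Slater determinant is expanded into its direct
and exchange parts. -/
theorem sum_norm_sq_antisymm (a b c d : Spinor) :
    ∑ s, ∑ t, ‖a s * d t - c s * b t‖ ^ 2 =
      ‖a‖ ^ 2 * ‖d‖ ^ 2 + ‖c‖ ^ 2 * ‖b‖ ^ 2 - 2 * (⟪a, c⟫_ℂ * ⟪d, b⟫_ℂ).re := by
  have h1 : ∀ z w : ℂ, ‖z - w‖ ^ 2 = ‖z‖ ^ 2 + ‖w‖ ^ 2 - 2 * (star z * w).re := by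
    intro z w
    have := norm_sub_sq (𝕜 := ℂ) z w
    rw [this, RCLike.inner_apply, RCLike.re_to_complex, mul_comm w]
    change _ = ‖z‖ ^ 2 + ‖w‖ ^ 2 - 2 * ((starRingEnd ℂ) z * w).re
    ring
  have h2 : ⟪a, c⟫_ℂ * ⟪d, b⟫_ℂ = ∑ s, ∑ t, star (a s * d t) * (c s * b t) := by
    rw [PiLp.inner_apply, PiLp.inner_apply, Finset.sum_mul_sum]
    refine Finset.sum_congr rfl fun s _ => Finset.sum_congr rfl fun t _ => ?_
    rw [RCLike.inner_apply, RCLike.inner_apply, star_mul']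
    simp only [Complex.star_def]
    ring
  rw [h2, EuclideanSpace.norm_sq_eq a, EuclideanSpace.norm_sq_eq b, EuclideanSpace.norm_sq_eq c,
    EuclideanSpace.norm_sq_eq d, Finset.sum_mul_sum, Finset.sum_mul_sum, Complex.re_sum,
    Finset.mul_sum, ← Finset.sum_add_distrib, ← Finset.sum_sub_distrib]
  refine Finset.sum_congr rfl fun s _ => ?_
  rw [Complex.re_sum, Finset.mul_sum, ← Finset.sum_add_distrib, ← Finset.sum_sub_distrib]
  refine Finset.sum_congr rfl fun t _ => ?_
  rw [h1, norm_mul, norm_mul]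
  ring

/-- Direct minus exchange is the integral of `|x-y|⁻¹` against the squared Slater determinant, which
makes its sign visible. -/
theorem pairTerm_eq {m : ℝ} (u : Hil) {v : Hil} (hv : freeAbsForm m v < ∞) :
    pairTerm u v = 1 / 4 * ∫ p : R3 × R3,
      (∑ s, ∑ t, ‖u p.1 s * v p.2 t - v p.1 s * u p.2 t‖ ^ 2) * ‖p.1 - p.2‖⁻¹ := by
  have h1 : ∀ p : R3 × R3,
      (∑ s, ∑ t, ‖u p.1 s * v p.2 t - v p.1 s * u p.2 t‖ ^ 2) * ‖p.1 - p.2‖⁻¹ =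
      ‖u p.1‖ ^ 2 * ‖v p.2‖ ^ 2 * ‖p.1 - p.2‖⁻¹ + ‖v p.1‖ ^ 2 * ‖u p.2‖ ^ 2 * ‖p.1 - p.2‖⁻¹ -
      2 * (⟪u p.1, v p.1⟫_ℂ * ⟪v p.2, u p.2⟫_ℂ * ((‖p.1 - p.2‖⁻¹ : ℝ) : ℂ)).re := by
    intro p
    rw [sum_norm_sq_antisymm, Complex.re_mul_ofReal]
    ring
  simp only [h1]
  rw [integral_sub, integral_add, integral_const_mul]
  · have h2 : ∫ p : R3 × R3,
        (⟪u p.1, v p.1⟫_ℂ * ⟪v p.2, u p.2⟫_ℂ * ((‖p.1 - p.2‖⁻¹ : ℝ) : ℂ)).re =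
        (∫ p : R3 × R3,
        (⟪u p.1, v p.1⟫_ℂ * ⟪v p.2, u p.2⟫_ℂ * ((‖p.1 - p.2‖⁻¹ : ℝ) : ℂ))).re :=
      integral_re (integrable_exchange u hv)
    have h3 := directTerm_comm u v
    unfold pairTerm exchangeTerm
    unfold directTerm at h3 ⊢
    rw [h2]
    linarith
  · exact integrable_direct u hv
  · exact integrable_direct_swap u hv
  · exact (integrable_direct u hv).add (integrable_direct_swap u hv)
  · exact (integrable_exchange u hv).re.const_mul 2

theorem pairTerm_nonneg {m : ℝ} (u : Hil) {v : Hil} (hv : freeAbsForm m v < ∞) :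
    0 ≤ pairTerm u v := by
  rw [pairTerm_eq u hv]
  exact mul_nonneg (by norm_num) (integral_nonneg fun p => by positivity)

theorem pairTerm_le_directTerm {m : ℝ} (u : Hil) {v : Hil} (hv : freeAbsForm m v < ∞) :
    pairTerm u v ≤ directTerm u v :=
  sub_le_self _ (exchangeTerm_nonneg u hv)

theorem exchangeTerm_comm (u v : Hil) : exchangeTerm u v = exchangeTerm v u := by
  unfold exchangeTerm
  congr 2
  change ∫ p : R3 × R3, _ ∂(volume.prod volume) = _
  rw [← integral_prod_swap]
  refine integral_congr_ae (ae_of_all _ fun p => ?_)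
  simp only [Prod.fst_swap, Prod.snd_swap]
  rw [norm_sub_rev]
  ring

theorem pairTerm_comm (u v : Hil) : pairTerm u v = pairTerm v u := by
  rw [pairTerm, pairTerm, directTerm_comm, exchangeTerm_comm]

/-- There is no self-interaction. Consequently transferring charge between two modes has only a
cross term at second order. -/
theorem pairTerm_self (u : Hil) : pairTerm u u = 0 := by
  unfold pairTerm exchangeTerm directTerm
  rw [sub_eq_zero]
  congr 1
  have h : ∀ p : R3 × R3, ⟪u p.1, u p.1⟫_ℂ * ⟪u p.2, u p.2⟫_ℂ * ((‖p.1 - p.2‖⁻¹ : ℝ) : ℂ) =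
      ((‖u p.1‖ ^ 2 * ‖u p.2‖ ^ 2 * ‖p.1 - p.2‖⁻¹ : ℝ) : ℂ) := by
    intro p
    rw [inner_self_eq_norm_sq_to_K, inner_self_eq_norm_sq_to_K]
    push_cast
    rfl
  simp only [h]
  rw [integral_complex_ofReal, Complex.ofReal_re]

theorem ae_fst_ne_snd : ∀ᵐ p : R3 × R3, p.1 ≠ p.2 := by
  refine (Measure.ae_prod_iff_ae_ae (μ := (volume : Measure R3)) (ν := (volume : Measure R3))
    (p := fun p : R3 × R3 => p.1 ≠ p.2) ?_).2 ?_
  · exact (measurableSet_eq_fun measurable_fst measurable_snd).compl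
  · exact ae_of_all _ fun x => (Measure.ae_ne volume x).mono fun y hy => hy.symm

theorem integral_norm_sq (u : Hil) : ∫ x, ‖u x‖ ^ 2 = ‖u‖ ^ 2 := by
  rw [integral_eq_lintegral_of_nonneg_ae (ae_of_all _ fun x => by positivity)
    (integrable_norm_sq u).aestronglyMeasurable, lintegral_norm_sq,
    ENNReal.toReal_ofReal (by positivity)]

/-- If the energy vanished, the Slater determinant would vanish almost everywhere; but for
orthonormal orbitals its squared `L²` norm is `2`. -/
theorem pairTerm_pos {m : ℝ} {u v : Hil} (hv : freeAbsForm m v < ∞) (hu1 : ‖u‖ = 1)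
    (hv1 : ‖v‖ = 1) (huv : ⟪u, v⟫_ℂ = 0) : 0 < pairTerm u v := by
  refine lt_of_le_of_ne (pairTerm_nonneg u hv) fun h0 => ?_
  set T : R3 × R3 → ℝ := fun p => ∑ s, ∑ t, ‖u p.1 s * v p.2 t - v p.1 s * u p.2 t‖ ^ 2 with hT
  have hTeq : ∀ p, T p = ‖u p.1‖ ^ 2 * ‖v p.2‖ ^ 2 + ‖v p.1‖ ^ 2 * ‖u p.2‖ ^ 2 -
      2 * (⟪u p.1, v p.1⟫_ℂ * ⟪v p.2, u p.2⟫_ℂ).re := fun p => sum_norm_sq_antisymm _ _ _ _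
  have hT0 : ∀ p, 0 ≤ T p := fun p => by positivity
  rw [pairTerm_eq u hv] at h0
  have hint : Integrable fun p : R3 × R3 => T p * ‖p.1 - p.2‖⁻¹ := by
    have h1 := (((integrable_direct u hv).add (integrable_direct_swap u hv)).sub
      ((integrable_exchange u hv).re.const_mul 2))
    refine h1.congr (ae_of_all _ fun p => ?_)
    simp only [hTeq, Pi.add_apply, Pi.sub_apply, RCLike.re_to_complex, Complex.re_mul_ofReal]
    ring
  have h1 : ∫ p : R3 × R3, T p * ‖p.1 - p.2‖⁻¹ = 0 := by linarith
  rw [integral_eq_zero_iff_of_nonneg (fun p => by have := hT0 p; positivity) hint] at h1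
  have h2 : T =ᵐ[volume] 0 := by
    filter_upwards [h1, ae_fst_ne_snd] with p hp hne
    have : ‖p.1 - p.2‖⁻¹ ≠ 0 := inv_ne_zero (norm_ne_zero_iff.2 (sub_ne_zero.2 hne))
    exact (mul_eq_zero.1 hp).resolve_right this
  have h3 : ∫ p, T p = 0 := by
    rw [integral_congr_ae h2]; simp
  have hi1 : Integrable (fun p : R3 × R3 => ‖u p.1‖ ^ 2 * ‖v p.2‖ ^ 2) volume :=
    (integrable_norm_sq u).mul_prod (integrable_norm_sq v)
  have hi2 : Integrable (fun p : R3 × R3 => ‖v p.1‖ ^ 2 * ‖u p.2‖ ^ 2) volume :=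
    (integrable_norm_sq v).mul_prod (integrable_norm_sq u)
  have hi3 : Integrable (fun p : R3 × R3 => ⟪u p.1, v p.1⟫_ℂ * ⟪v p.2, u p.2⟫_ℂ) volume :=
    (L2.integrable_inner u v).mul_prod (L2.integrable_inner v u)
  have h4 : ∫ p : R3 × R3, (⟪u p.1, v p.1⟫_ℂ * ⟪v p.2, u p.2⟫_ℂ).re = 0 := by
    have h5 : ∫ p : R3 × R3, (⟪u p.1, v p.1⟫_ℂ * ⟪v p.2, u p.2⟫_ℂ) = 0 := by
      change ∫ p : R3 × R3, _ ∂(volume.prod volume) = _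
      rw [integral_prod_mul (fun x => ⟪u x, v x⟫_ℂ) (fun x => ⟪v x, u x⟫_ℂ), ← L2.inner_def, huv,
        zero_mul]
    have h6 := integral_re hi3
    rw [h5] at h6
    simpa using h6
  have h7 : ∫ p : R3 × R3, ‖u p.1‖ ^ 2 * ‖v p.2‖ ^ 2 = 1 := by
    change ∫ p : R3 × R3, _ ∂(volume.prod volume) = _
    rw [integral_prod_mul (fun x => ‖u x‖ ^ 2) (fun x => ‖v x‖ ^ 2), integral_norm_sq,
      integral_norm_sq, hu1, hv1]
    norm_num
  have h8 : ∫ p : R3 × R3, ‖v p.1‖ ^ 2 * ‖u p.2‖ ^ 2 = 1 := by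
    change ∫ p : R3 × R3, _ ∂(volume.prod volume) = _
    rw [integral_prod_mul (fun x => ‖v x‖ ^ 2) (fun x => ‖u x‖ ^ 2), integral_norm_sq,
      integral_norm_sq, hu1, hv1]
    norm_num
  simp only [hTeq] at h3
  have hi12 : Integrable (fun p : R3 × R3 => ‖u p.1‖ ^ 2 * ‖v p.2‖ ^ 2 +
      ‖v p.1‖ ^ 2 * ‖u p.2‖ ^ 2) volume := hi1.add hi2
  have hi4 : Integrable (fun p : R3 × R3 => 2 * (⟪u p.1, v p.1⟫_ℂ * ⟪v p.2, u p.2⟫_ℂ).re) volume :=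
    hi3.re.const_mul 2
  rw [integral_sub hi12 hi4, integral_add hi1 hi2, h7, h8, integral_const_mul, h4] at h3
  norm_num at h3

/-! ### Finite quadratic forms in the occupation numbers -/

/-- The sum is the Coulomb self-energy of the density `∑ lₙ |ξₙ|²`, nonnegative whatever the signs
of the `lₙ`. -/
theorem sum_directTerm_nonneg {m : ℝ} (S : Finset ℕ) (l : ℕ → ℝ) {ξ : ℕ → Hil}
    (hξ : ∀ n ∈ S, freeAbsForm m (ξ n) < ∞) :
    0 ≤ ∑ n ∈ S, ∑ k ∈ S, l n * l k * directTerm (ξ n) (ξ k) := by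
  set h : R3 → ℝ := fun x => ∑ n ∈ S, l n * ‖ξ n x‖ ^ 2 with hh
  have hpt : ∀ p : R3 × R3, h p.1 * h p.2 * ‖p.1 - p.2‖⁻¹ =
      ∑ n ∈ S, ∑ k ∈ S, l n * l k * (‖ξ n p.1‖ ^ 2 * ‖ξ k p.2‖ ^ 2 * ‖p.1 - p.2‖⁻¹) := by
    intro p
    rw [hh, Finset.sum_mul_sum, Finset.sum_mul]
    refine Finset.sum_congr rfl fun n _ => ?_
    rw [Finset.sum_mul]
    exact Finset.sum_congr rfl fun k _ => by ring
  have hint : ∀ n ∈ S, ∀ k ∈ S, Integrable fun p : R3 × R3 =>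
      l n * l k * (‖ξ n p.1‖ ^ 2 * ‖ξ k p.2‖ ^ 2 * ‖p.1 - p.2‖⁻¹) :=
    fun n _ k hk => (integrable_direct (ξ n) (hξ k hk)).const_mul _
  have hpos := integral_coulomb_nonneg (h := h)
    (Measurable.aestronglyMeasurable (Finset.measurable_fun_sum _ fun n _ => by
      have := measurable_norm_coe (ξ n)
      fun_prop))
    (by
      simp only [hpt]
      exact integrable_finsetSum _ fun n hn => integrable_finsetSum _ fun k hk => hint n hn k hk)
  simp only [hpt] at hpos
  rw [integral_finsetSum _ fun n hn => integrable_finsetSum _ fun k hk => hint n hn k hk] at hpos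
  have h2 : ∑ n ∈ S, ∑ k ∈ S, l n * l k * directTerm (ξ n) (ξ k) = 1 / 2 * ∑ n ∈ S, ∫ p : R3 × R3,
      ∑ k ∈ S, l n * l k * (‖ξ n p.1‖ ^ 2 * ‖ξ k p.2‖ ^ 2 * ‖p.1 - p.2‖⁻¹) := by
    rw [Finset.mul_sum]
    refine Finset.sum_congr rfl fun n hn => ?_
    rw [integral_finsetSum _ fun k hk => hint n hn k hk, Finset.mul_sum]
    refine Finset.sum_congr rfl fun k hk => ?_
    rw [integral_const_mul, directTerm]
    ring
  rw [h2]
  positivity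

theorem sum_exchange_pointwise (S : Finset ℕ) (l : ℕ → ℝ) (a b : ℕ → Spinor) :
    ∑ n ∈ S, ∑ k ∈ S, ((l n * l k : ℝ) : ℂ) * (⟪a n, a k⟫_ℂ * ⟪b k, b n⟫_ℂ) =
      ∑ s, ((‖∑ n ∈ S, ((l n : ℂ) * star (a n s)) • b n‖ ^ 2 : ℝ) : ℂ) := by
  have h1 : ∀ s, ((‖∑ n ∈ S, ((l n : ℂ) * star (a n s)) • b n‖ ^ 2 : ℝ) : ℂ) =
      ∑ n ∈ S, ∑ k ∈ S, ((l n * l k : ℝ) : ℂ) * (star (a n s) * a k s * ⟪b k, b n⟫_ℂ) := by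
    intro s
    have h2 := inner_self_eq_norm_sq_to_K (𝕜 := ℂ) (∑ n ∈ S, ((l n : ℂ) * star (a n s)) • b n)
    push_cast
    refine h2.symm.trans ?_
    rw [inner_sum]
    refine Finset.sum_congr rfl fun n _ => ?_
    rw [sum_inner]
    refine Finset.sum_congr rfl fun k _ => ?_
    rw [inner_smul_left, inner_smul_right, map_mul, Complex.conj_ofReal, Complex.star_def,
      Complex.conj_conj]
    push_cast
    ring
  simp only [h1]
  refine Eq.symm (Finset.sum_comm.trans ?_)
  refine Finset.sum_congr rfl fun n _ => ?_
  refine Finset.sum_comm.trans ?_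
  refine Finset.sum_congr rfl fun k _ => ?_
  rw [← Finset.mul_sum, ← Finset.sum_mul, PiLp.inner_apply]
  congr 2
  refine Finset.sum_congr rfl fun s _ => ?_
  rw [RCLike.inner_apply, Complex.star_def, mul_comm]

/-- Integration in `x` against the orthonormal `ξₙ` removes all off-diagonal terms of the double
sum. -/
theorem lintegral_sum_orthonormal (S : Finset ℕ) (l : ℕ → ℝ) {ξ : ℕ → Hil}
    (hξ : Orthonormal ℂ ξ) (c : ℕ → Spinor) :
    ∫⁻ x, ENNReal.ofReal (∑ s, ‖∑ n ∈ S, ((l n : ℂ) * star (ξ n x s)) • c n‖ ^ 2) =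
      ENNReal.ofReal (∑ n ∈ S, l n ^ 2 * ‖c n‖ ^ 2) := by
  set F : R3 → ℝ := fun x => ∑ s, ‖∑ n ∈ S, ((l n : ℂ) * star (ξ n x s)) • c n‖ ^ 2 with hF
  have hFc : ∀ x, (F x : ℂ) = ∑ n ∈ S, ∑ k ∈ S, ((l n * l k : ℝ) : ℂ) *
      (⟪ξ n x, ξ k x⟫_ℂ * ⟪c k, c n⟫_ℂ) := by
    intro x
    rw [sum_exchange_pointwise S l (fun n => ξ n x) c, hF]
    push_cast
    rfl
  have hint : ∀ n k, Integrable fun x => ((l n * l k : ℝ) : ℂ) *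
      (⟪ξ n x, ξ k x⟫_ℂ * ⟪c k, c n⟫_ℂ) := fun n k =>
    ((L2.integrable_inner (ξ n) (ξ k)).mul_const _).const_mul _
  have hFint : Integrable fun x => (F x : ℂ) := by
    simp only [hFc]
    exact integrable_finsetSum _ fun n _ => integrable_finsetSum _ fun k _ => hint n k
  have hval : ((∫ x, F x : ℝ) : ℂ) = ((∑ n ∈ S, l n ^ 2 * ‖c n‖ ^ 2 : ℝ) : ℂ) := by
    rw [← integral_complex_ofReal]
    simp only [hFc]
    rw [integral_finsetSum _ fun n _ => integrable_finsetSum _ fun k _ => hint n k]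
    push_cast
    refine Finset.sum_congr rfl fun n hn => ?_
    rw [integral_finsetSum _ fun k _ => by simpa using hint n k]
    rw [Finset.sum_eq_single_of_mem n hn]
    · rw [integral_const_mul, integral_mul_const, ← L2.inner_def, inner_self_eq_norm_sq_to_K,
        hξ.1 n, inner_self_eq_norm_sq_to_K]
      simp only [Complex.coe_algebraMap]
      push_cast
      ring
    · intro k _ hk
      rw [integral_const_mul, integral_mul_const, ← L2.inner_def, hξ.2 hk.symm]
      ring
  have hval' : ∫ x, F x = ∑ n ∈ S, l n ^ 2 * ‖c n‖ ^ 2 := by exact_mod_cast hval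
  rw [← hval', ofReal_integral_eq_lintegral_ofReal _ (ae_of_all _ fun x => by positivity)]
  simpa using hFint.re

theorem coeFn_sum_smul (S : Finset ℕ) (a : ℕ → ℂ) (ξ : ℕ → Hil) :
    (∑ n ∈ S, a n • ξ n : Hil) =ᵐ[volume] fun x => ∑ n ∈ S, a n • ξ n x := by
  classical
  induction S using Finset.induction_on with
  | empty =>
    simp only [Finset.sum_empty]
    exact Lp.coeFn_zero _ _ _
  | insert i S hi ih =>
    simp only [Finset.sum_insert hi]
    filter_upwards [Lp.coeFn_add (a i • ξ i) (∑ n ∈ S, a n • ξ n), Lp.coeFn_smul (a i) (ξ i), ih]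
      with x h1 h2 h3
    rw [h1, Pi.add_apply, h2, h3, Pi.smul_apply]

theorem measurable_coe_apply (u : Hil) (s : Fin 4) : Measurable fun x => u x s :=
  (measurable_pi_apply s).comp
    ((WithLp.measurable_ofLp 2 (Fin 4 → ℂ)).comp (Lp.stronglyMeasurable u).measurable)

/-- The squared Hilbert-Schmidt norm of the matrix `∑ₙ lₙ ηₙ(y) ξₙ(x)*`. -/
noncomputable def kernelSq (S : Finset ℕ) (l : ℕ → ℝ) (ξ η : ℕ → Hil) (x y : R3) : ℝ :=
  ∑ s, ‖∑ n ∈ S, ((l n : ℂ) * star (ξ n x s)) • η n y‖ ^ 2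

theorem kernelSq_nonneg (S : Finset ℕ) (l : ℕ → ℝ) (ξ η : ℕ → Hil) (x y : R3) :
    0 ≤ kernelSq S l ξ η x y := Finset.sum_nonneg fun s _ => by positivity

theorem measurable_kernelSq (S : Finset ℕ) (l : ℕ → ℝ) (ξ η : ℕ → Hil) :
    Measurable fun p : R3 × R3 => kernelSq S l ξ η p.1 p.2 := by
  refine Finset.measurable_fun_sum _ fun s _ => Measurable.pow_const (Measurable.norm
    (Finset.measurable_fun_sum _ fun n _ => Measurable.fun_smul (Measurable.const_mul ?_ _)
      ((Lp.stronglyMeasurable (η n)).measurable.comp measurable_snd))) _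
  exact (Complex.continuous_conj.measurable.comp (measurable_coe_apply (ξ n) s)).comp
    measurable_fst

theorem kernelSq_mul_eq (S : Finset ℕ) (l : ℕ → ℝ) (ξ : ℕ → Hil) (x y : R3) (w : ℝ) :
    ((kernelSq S l ξ ξ x y * w : ℝ) : ℂ) = ∑ n ∈ S, ∑ k ∈ S,
      ((l n * l k : ℝ) : ℂ) * (⟪ξ n x, ξ k x⟫_ℂ * ⟪ξ k y, ξ n y⟫_ℂ * (w : ℂ)) := by
  have h := sum_exchange_pointwise S l (fun n => ξ n x) (fun n => ξ n y)
  rw [Complex.ofReal_mul, kernelSq, Complex.ofReal_sum, ← h, Finset.sum_mul]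
  refine Finset.sum_congr rfl fun n _ => ?_
  rw [Finset.sum_mul]
  exact Finset.sum_congr rfl fun k _ => by ring

/-- For fixed `x` and spin `s`, Kato's inequality is applied in the second variable to the single
vector `∑ lₙ conj(ξₙ(x,s)) ξₙ`. -/
theorem kato_kernelSq (m : ℝ) (S : Finset ℕ) (l : ℕ → ℝ) (ξ : ℕ → Hil) (x : R3) :
    ∫⁻ y, ENNReal.ofReal (kernelSq S l ξ ξ x y * ‖x - y‖⁻¹) ≤
      ENNReal.ofReal (Real.pi / 2) * ∫⁻ η, ENNReal.ofReal (freeEnergy m η) *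
        ENNReal.ofReal (kernelSq S l ξ (fun n => fourierL2 (ξ n)) x η) := by
  have hm : ∀ (η : ℕ → Hil) s, Measurable fun y =>
      ‖∑ n ∈ S, ((l n : ℂ) * star (ξ n x s)) • η n y‖ := fun η s => Measurable.norm
    (Finset.measurable_fun_sum _ fun n _ => Measurable.fun_smul measurable_const
      (Lp.stronglyMeasurable (η n)).measurable)
  have hE : Measurable fun η : R3 => freeEnergy m η := (continuous_freeEnergy m).measurable
  have h1 : ∀ y, ENNReal.ofReal (kernelSq S l ξ ξ x y * ‖x - y‖⁻¹) =
      ∑ s, ENNReal.ofReal (‖∑ n ∈ S, ((l n : ℂ) * star (ξ n x s)) • ξ n y‖ ^ 2) *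
        ENNReal.ofReal ‖y - x‖⁻¹ := by
    intro y
    rw [ENNReal.ofReal_mul (kernelSq_nonneg S l ξ ξ x y), norm_sub_rev, kernelSq,
      ENNReal.ofReal_sum_of_nonneg fun s _ => by positivity, Finset.sum_mul]
  have h2 : ∀ η, ENNReal.ofReal (freeEnergy m η) *
      ENNReal.ofReal (kernelSq S l ξ (fun n => fourierL2 (ξ n)) x η) =
      ∑ s, ENNReal.ofReal (freeEnergy m η *
        ‖∑ n ∈ S, ((l n : ℂ) * star (ξ n x s)) • fourierL2 (ξ n) η‖ ^ 2) := by
    intro η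
    rw [kernelSq, ENNReal.ofReal_sum_of_nonneg fun s _ => by positivity, Finset.mul_sum]
    exact Finset.sum_congr rfl fun s _ => (ENNReal.ofReal_mul (freeEnergy_nonneg m η)).symm
  rw [lintegral_congr h1, lintegral_congr h2,
    lintegral_finsetSum _ fun s _ => by have := hm ξ s; fun_prop,
    lintegral_finsetSum _ fun s _ => by have := hm (fun n => fourierL2 (ξ n)) s; fun_prop,
    Finset.mul_sum]
  refine Finset.sum_le_sum fun s _ => ?_
  have h3 := kato m (∑ n ∈ S, ((l n : ℂ) * star (ξ n x s)) • ξ n) x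
  unfold freeAbsForm at h3
  rw [map_sum] at h3
  simp only [map_smul] at h3
  refine le_trans (le_of_eq (lintegral_congr_ae ?_))
    (h3.trans (le_of_eq (congrArg _ (lintegral_congr_ae ?_))))
  · filter_upwards [coeFn_sum_smul S (fun n => (l n : ℂ) * star (ξ n x s)) ξ] with y hy
    rw [hy]
  · filter_upwards [coeFn_sum_smul S (fun n => (l n : ℂ) * star (ξ n x s))
      fun n => fourierL2 (ξ n)] with y hy
    rw [hy]

/-- The remaining integral in `x` is done by orthonormality. The weights on the right are `lₙ²`,
with no factor of the total charge; this is what the regime of large trace needs. -/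
theorem lintegral_kernelSq_le (m : ℝ) (S : Finset ℕ) (l : ℕ → ℝ) {ξ : ℕ → Hil}
    (hO : Orthonormal ℂ ξ) :
    ∫⁻ p : R3 × R3, ENNReal.ofReal (kernelSq S l ξ ξ p.1 p.2 * ‖p.1 - p.2‖⁻¹) ≤
      ENNReal.ofReal (Real.pi / 2) * ∑ n ∈ S, ENNReal.ofReal (l n ^ 2) * freeAbsForm m (ξ n) := by
  have hE : Measurable fun η : R3 => freeEnergy m η := (continuous_freeEnergy m).measurable
  have hGm := measurable_kernelSq S l ξ ξ
  have hGm' := measurable_kernelSq S l ξ fun n => fourierL2 (ξ n)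
  change ∫⁻ p : R3 × R3, _ ∂(volume.prod volume) ≤ _
  rw [lintegral_prod _ (Measurable.aemeasurable (by fun_prop))]
  refine (lintegral_mono fun x => kato_kernelSq m S l ξ x).trans (le_of_eq ?_)
  rw [lintegral_const_mul' _ _ ENNReal.ofReal_ne_top, lintegral_lintegral_swap
    ((hE.comp measurable_snd).ennreal_ofReal.mul hGm'.ennreal_ofReal).aemeasurable]
  congr 1
  have h1 : ∀ η, ∫⁻ x, ENNReal.ofReal (freeEnergy m η) *
      ENNReal.ofReal (kernelSq S l ξ (fun n => fourierL2 (ξ n)) x η) =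
      ∑ n ∈ S, ENNReal.ofReal (l n ^ 2) *
        ENNReal.ofReal (freeEnergy m η * ‖fourierL2 (ξ n) η‖ ^ 2) := by
    intro η
    unfold kernelSq
    rw [lintegral_const_mul' _ _ ENNReal.ofReal_ne_top,
      lintegral_sum_orthonormal S l hO fun n => fourierL2 (ξ n) η,
      ENNReal.ofReal_sum_of_nonneg fun n _ => by positivity, Finset.mul_sum]
    refine Finset.sum_congr rfl fun n _ => ?_
    rw [← ENNReal.ofReal_mul (freeEnergy_nonneg m η), ← ENNReal.ofReal_mul (by positivity)]
    congr 1
    ring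
  rw [lintegral_congr h1, lintegral_finsetSum _ fun n _ => by
    have := measurable_norm_coe (fourierL2 (ξ n)); fun_prop]
  exact Finset.sum_congr rfl fun n _ => lintegral_const_mul' _ _ ENNReal.ofReal_ne_top

theorem sum_exchangeTerm_eq {m : ℝ} (S : Finset ℕ) (l : ℕ → ℝ) {ξ : ℕ → Hil}
    (hξ : ∀ n ∈ S, freeAbsForm m (ξ n) < ∞) :
    ∑ n ∈ S, ∑ k ∈ S, l n * l k * exchangeTerm (ξ n) (ξ k) =
      1 / 2 * ∫ p : R3 × R3, kernelSq S l ξ ξ p.1 p.2 * ‖p.1 - p.2‖⁻¹ := by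
  have hint : ∀ n ∈ S, ∀ k ∈ S, Integrable fun p : R3 × R3 =>
      ((l n * l k : ℝ) : ℂ) * (⟪ξ n p.1, ξ k p.1⟫_ℂ * ⟪ξ k p.2, ξ n p.2⟫_ℂ *
        ((‖p.1 - p.2‖⁻¹ : ℝ) : ℂ)) :=
    fun n _ k hk => (integrable_exchange (ξ n) (hξ k hk)).const_mul _
  have h1 : ((∫ p : R3 × R3, kernelSq S l ξ ξ p.1 p.2 * ‖p.1 - p.2‖⁻¹ : ℝ) : ℂ) =
      ∑ n ∈ S, ∑ k ∈ S,
      ((l n * l k : ℝ) : ℂ) * ∫ p : R3 × R3, ⟪ξ n p.1, ξ k p.1⟫_ℂ * ⟪ξ k p.2, ξ n p.2⟫_ℂ *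
      ((‖p.1 - p.2‖⁻¹ : ℝ) : ℂ) := by
    rw [← integral_complex_ofReal, integral_congr_ae
      (ae_of_all _ fun p : R3 × R3 => kernelSq_mul_eq S l ξ p.1 p.2 ‖p.1 - p.2‖⁻¹)]
    rw [integral_finsetSum _ fun n hn => integrable_finsetSum _ fun k hk => hint n hn k hk]
    refine Finset.sum_congr rfl fun n hn => ?_
    rw [integral_finsetSum _ fun k hk => hint n hn k hk]
    exact Finset.sum_congr rfl fun k _ => integral_const_mul _ _
  have h2 := congrArg Complex.re h1
  rw [Complex.ofReal_re, Complex.re_sum] at h2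
  rw [h2, Finset.mul_sum]
  refine Finset.sum_congr rfl fun n _ => ?_
  rw [Complex.re_sum, Finset.mul_sum]
  refine Finset.sum_congr rfl fun k _ => ?_
  rw [Complex.re_ofReal_mul, exchangeTerm]
  ring

theorem sum_exchangeTerm_le {m : ℝ} (S : Finset ℕ) (l : ℕ → ℝ) {ξ : ℕ → Hil}
    (hO : Orthonormal ℂ ξ) (hξ : ∀ n ∈ S, freeAbsForm m (ξ n) < ∞) :
    ∑ n ∈ S, ∑ k ∈ S, l n * l k * exchangeTerm (ξ n) (ξ k) ≤
      Real.pi / 4 * ∑ n ∈ S, l n ^ 2 * (freeAbsForm m (ξ n)).toReal := by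
  have hfin : ENNReal.ofReal (Real.pi / 2) *
      ∑ n ∈ S, ENNReal.ofReal (l n ^ 2) * freeAbsForm m (ξ n) ≠ ∞ :=
    (ENNReal.mul_lt_top ENNReal.ofReal_lt_top (ENNReal.sum_lt_top.2 fun n hn =>
      ENNReal.mul_lt_top ENNReal.ofReal_lt_top (hξ n hn))).ne
  have h := ENNReal.toReal_mono hfin (lintegral_kernelSq_le m S l hO)
  rw [ENNReal.toReal_mul, ENNReal.toReal_ofReal (by positivity), ENNReal.toReal_sum fun n hn =>
    (ENNReal.mul_lt_top ENNReal.ofReal_lt_top (hξ n hn)).ne] at h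
  simp only [ENNReal.toReal_mul] at h
  have h2 : ∀ n, (ENNReal.ofReal (l n ^ 2)).toReal = l n ^ 2 := fun n =>
    ENNReal.toReal_ofReal (by positivity)
  simp only [h2] at h
  rw [sum_exchangeTerm_eq S l hξ, integral_eq_lintegral_of_nonneg_ae
    (ae_of_all _ fun p => mul_nonneg (kernelSq_nonneg S l ξ ξ _ _) (by positivity))
    ((measurable_kernelSq S l ξ ξ).fun_mul measurable_coulombWeight).aestronglyMeasurable]
  linarith

/-! ### Hilbert-Schmidt operators and eigenbases -/

section Hilbert

variable {H : Type*} [NormedAddCommGroup H] [InnerProductSpace ℂ H]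

theorem hasSum_norm_inner_sq {ι : Type*} (b : HilbertBasis ι ℂ H) (x : H) :
    HasSum (fun i => ‖⟪b i, x⟫_ℂ‖ ^ 2) (‖x‖ ^ 2) := by
  have h := b.hasSum_inner_mul_inner x x
  rw [inner_self_eq_norm_sq_to_K] at h
  rw [← Complex.hasSum_ofReal]
  push_cast
  refine h.congr_fun fun i => ?_
  rw [← inner_conj_symm x (b i), Complex.conj_mul']

theorem tsum_ofReal_norm_inner_sq {ι : Type*} (b : HilbertBasis ι ℂ H) (x : H) :
    ∑' i, ENNReal.ofReal (‖⟪b i, x⟫_ℂ‖ ^ 2) = ENNReal.ofReal (‖x‖ ^ 2) := by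
  rw [← ENNReal.ofReal_tsum_of_nonneg (fun i => by positivity) (hasSum_norm_inner_sq b x).summable,
    (hasSum_norm_inner_sq b x).tsum_eq]

theorem inner_eq_zero_of_basis {K : Submodule ℂ H} {ι : Type*} (b : HilbertBasis ι ℂ K) {x : H}
    (hx : ∀ i, ⟪x, (b i : H)⟫_ℂ = 0) {z : H} (hz : z ∈ K) : ⟪x, z⟫_ℂ = 0 := by
  have h1 := (b.hasSum_repr ⟨z, hz⟩).mapL ((innerSL ℂ x).comp K.subtypeL)
  have h2 : ∀ i, ((innerSL ℂ x).comp K.subtypeL) (b.repr ⟨z, hz⟩ i • b i) = 0 := by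
    intro i
    rw [map_smul]
    exact smul_eq_zero_of_right _ (hx i)
  exact (h1.congr_fun fun i => (h2 i).symm).unique hasSum_zero

variable [CompleteSpace H]

/-- Both sides are the double sum of `|⟪b j, T (e i)⟫|²`, by Parseval's identity in one basis or in
the other. -/
theorem tsum_norm_sq_adjoint {ι κ : Type*} (e : HilbertBasis ι ℂ H) (b : HilbertBasis κ ℂ H)
    (T : H →L[ℂ] H) : ∑' i, ENNReal.ofReal (‖T (e i)‖ ^ 2) =
      ∑' j, ENNReal.ofReal (‖ContinuousLinearMap.adjoint T (b j)‖ ^ 2) := by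
  simp only [← tsum_ofReal_norm_inner_sq b (T _), ← tsum_ofReal_norm_inner_sq e (_ : H)]
  rw [ENNReal.tsum_comm]
  refine tsum_congr fun j => tsum_congr fun i => ?_
  rw [ContinuousLinearMap.adjoint_inner_right, norm_inner_symm]

/-- The Hilbert-Schmidt norm does not depend on the basis. -/
theorem tsum_norm_sq_eq {ι κ : Type*} (e : HilbertBasis ι ℂ H) (b : HilbertBasis κ ℂ H)
    (T : H →L[ℂ] H) : ∑' i, ENNReal.ofReal (‖T (e i)‖ ^ 2) =
      ∑' j, ENNReal.ofReal (‖T (b j)‖ ^ 2) :=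
  (tsum_norm_sq_adjoint e b T).trans (tsum_norm_sq_adjoint b b T).symm

/-- `T` is the norm limit of its finite-rank truncations `P_S T`: by symmetry the error is bounded
by the tail of the Hilbert-Schmidt sum. -/
theorem isCompactOperator_of_tsum_norm_sq {ι : Type*} (e : HilbertBasis ι ℂ H) {T : H →L[ℂ] H}
    (hT : T.IsSymmetric) (h : ∑' i, ENNReal.ofReal (‖T (e i)‖ ^ 2) < ∞) :
    IsCompactOperator T := by
  classical
  set P : Finset ι → H →L[ℂ] H := fun S => ∑ i ∈ S, (innerSL ℂ (e i)).smulRight (e i) with hP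
  have hPapply : ∀ S y, P S y = ∑ i ∈ S, ⟪e i, y⟫_ℂ • e i := by
    intro S y
    simp [hP, sum_apply]
  have hPinner : ∀ S y i, ⟪e i, y - P S y⟫_ℂ = if i ∈ S then 0 else ⟪e i, y⟫_ℂ := by
    intro S y i
    rw [inner_sub_right, hPapply, inner_sum]
    simp only [inner_smul_right, orthonormal_iff_ite.1 e.orthonormal, mul_ite, mul_one, mul_zero,
      Finset.sum_ite_eq]
    split_ifs <;> simp
  have hs : Summable fun i => ‖T (e i)‖ ^ 2 := by
    have := ENNReal.summable_toReal h.ne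
    refine this.congr fun i => ?_
    rw [ENNReal.toReal_ofReal (by positivity)]
  have hbound : ∀ S : Finset ι, ‖T - (P S).comp T‖ ≤
      √(∑' i : {i // i ∉ S}, ‖T (e i)‖ ^ 2) := by
    intro S
    refine ContinuousLinearMap.opNorm_le_bound _ (Real.sqrt_nonneg _) fun w => ?_
    rw [← Real.sqrt_sq (norm_nonneg w), ← Real.sqrt_mul (tsum_nonneg fun i => by positivity)]
    refine Real.le_sqrt_of_sq_le ?_
    have h1 := hasSum_norm_inner_sq e (T w - P S (T w))
    rw [sub_apply, ContinuousLinearMap.comp_apply, ← h1.tsum_eq]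
    have h2 : ∑' i : {i // i ∉ S}, ‖T (e i)‖ ^ 2 =
        ∑' i, Set.indicator {i | i ∉ S} (fun i => ‖T (e i)‖ ^ 2) i :=
      tsum_subtype {i | i ∉ S} fun i => ‖T (e i)‖ ^ 2
    rw [h2, ← tsum_mul_right]
    refine h1.summable.tsum_le_tsum (fun i => ?_) ((hs.indicator _).mul_right _)
    rw [hPinner]
    by_cases hi : i ∈ S
    · simp [hi]
    · simp only [hi, if_false, Set.indicator, Set.mem_ofPred_eq, not_false_eq_true, if_true]
      rw [← mul_pow, ← show ⟪T (e i), w⟫_ℂ = ⟪e i, T w⟫_ℂ from hT (e i) w]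
      exact pow_le_pow_left₀ (norm_nonneg _) (norm_inner_le_norm _ _) 2
  refine isCompactOperator_of_tendsto (l := (atTop : Filter (Finset ι)))
    (F := fun S => (P S).comp T) ?_ (Eventually.of_forall fun S => ?_)
  · rw [tendsto_iff_norm_sub_tendsto_zero]
    have h0 := (Real.continuous_sqrt.tendsto 0).comp
      (tendsto_tsum_compl_atTop_zero (fun i => ‖T (e i)‖ ^ 2))
    rw [Real.sqrt_zero] at h0
    refine squeeze_zero (fun S => norm_nonneg _) (fun S => ?_) h0
    rw [norm_sub_rev]
    exact hbound S
  · have : IsCompactOperator (P S) := by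
      rw [hP]
      refine Finset.sum_induction _ (fun A : H →L[ℂ] H => IsCompactOperator A)
        (fun A B hA hB => hA.add hB) isCompactOperator_zero fun i _ => ?_
      exact (isCompactOperator_of_locallyCompactSpace_dom (innerSL ℂ (e i))).clm_comp
        (ContinuousLinearMap.toSpanSingleton ℂ (e i))
    exact this.comp_clm T

theorem completeSpace_eigenspace (T : H →L[ℂ] H) (μ : ℂ) :
    CompleteSpace (Module.End.eigenspace (T : H →ₗ[ℂ] H) μ) := by
  have h : IsClosed (Module.End.eigenspace (T : H →ₗ[ℂ] H) μ : Set H) := by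
    have : (Module.End.eigenspace (T : H →ₗ[ℂ] H) μ : Set H) = {x | T x = μ • x} := by
      ext x
      exact Module.End.mem_eigenspace_iff
    rw [this]
    exact isClosed_eq T.continuous (continuous_const_smul μ)
  exact h.completeSpace_coe

/-- The spectral theorem for compact operators makes the eigenspaces orthogonal with dense span;
Hilbert bases of the eigenspaces, the kernel included, are joined. -/
theorem exists_hilbertBasis_eigenvectors.{u} {H : Type u} [NormedAddCommGroup H]
    [InnerProductSpace ℂ H] [CompleteSpace H] {T : H →L[ℂ] H} (hT : IsCompactOperator T)
    (hT' : T.IsSymmetric) : ∃ (ι : Type u) (b : HilbertBasis ι ℂ H) (l : ι → ℝ),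
      ∀ i, T (b i) = (l i : ℂ) • b i := by
  have hc := completeSpace_eigenspace T
  have hex : ∀ μ : ℂ, ∃ (w : Set (Module.End.eigenspace (T : H →ₗ[ℂ] H) μ))
      (_ : HilbertBasis w ℂ (Module.End.eigenspace (T : H →ₗ[ℂ] H) μ)), True := fun μ => by
    obtain ⟨w, b, _⟩ := exists_hilbertBasis ℂ (Module.End.eigenspace (T : H →ₗ[ℂ] H) μ)
    exact ⟨w, b, trivial⟩
  choose w b _ using hex
  have hfam := LinearMap.IsSymmetric.orthogonalFamily_eigenspaces hT'
  have hO : Orthonormal ℂ fun p : Σ μ, w μ => (b p.1 p.2 : H) :=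
    hfam.orthonormal_sigma_orthonormal fun μ => (b μ).orthonormal
  have hbot : (Submodule.span ℂ (range fun p : Σ μ, w μ => (b p.1 p.2 : H)))ᗮ = ⊥ := by
    rw [eq_bot_iff, ← ContinuousLinearMap.orthogonalComplement_iSup_eigenspaces_eq_bot hT hT']
    intro x hx
    rw [Submodule.mem_orthogonal'] at hx
    rw [Submodule.iSup_eq_span, Submodule.mem_orthogonal']
    intro z hz
    refine Submodule.span_induction (p := fun z _ => ⟪x, z⟫_ℂ = 0) ?_ (inner_zero_right _)
      (fun y z _ _ hy hz => by rw [inner_add_right, hy, hz, add_zero])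
      (fun c y _ hy => by rw [inner_smul_right, hy, mul_zero]) hz
    intro z hz
    obtain ⟨μ, hμ⟩ := mem_iUnion.1 hz
    exact inner_eq_zero_of_basis (b μ)
      (fun i => hx _ (Submodule.subset_span ⟨⟨μ, i⟩, rfl⟩)) hμ
  refine ⟨_, HilbertBasis.mkOfOrthogonalEqBot hO hbot, fun p => p.1.re, fun p => ?_⟩
  rw [HilbertBasis.coe_mkOfOrthogonalEqBot]
  have hne : (b p.1 p.2 : H) ≠ 0 := hO.ne_zero p
  have hre : ((p.1.re : ℝ) : ℂ) = p.1 := by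
    rw [← Complex.conj_eq_iff_re]
    exact LinearMap.IsSymmetric.conj_eigenvalue_eq_self hT'
      (Module.End.hasEigenvalue_of_hasEigenvector ⟨(b p.1 p.2).2, hne⟩)
  rw [hre]
  exact Module.End.mem_eigenspace_iff.1 (b p.1 p.2).2

theorem exists_hilbertBasis_nat [TopologicalSpace.SeparableSpace H]
    (hinf : ¬ FiniteDimensional ℂ H) {ι : Type*} (b : HilbertBasis ι ℂ H) :
    ∃ (σ : ℕ ≃ ι) (b' : HilbertBasis ℕ ℂ H), ∀ n, b' n = b (σ n) := by
  have hcount : Countable ι := by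
    refine Pairwise.countable_of_isOpen_disjoint (s := fun i => Metric.ball (b i) (1 / 2)) ?_
      (fun i => Metric.isOpen_ball) fun i => ⟨b i, Metric.mem_ball_self (by norm_num)⟩
    intro i j hij
    refine Metric.ball_disjoint_ball ?_
    rw [dist_eq_norm]
    -- Distinct basis vectors are at distance `√2`, so balls of radius `1/2` are disjoint and
    -- separability bounds their number.
    have h1 : ‖b i - b j‖ ^ 2 = 2 := by
      rw [norm_sub_sq (𝕜 := ℂ), b.orthonormal.2 hij, b.orthonormal.1, b.orthonormal.1]
      norm_num
    nlinarith [norm_nonneg (b i - b j)]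
  have hinfι : Infinite ι := by
    by_contra hfin
    rw [not_infinite_iff_finite] at hfin
    have := Fintype.ofFinite ι
    exact hinf b.toOrthonormalBasis.toBasis.finiteDimensional_of_finite
  obtain ⟨hd⟩ := nonempty_denumerable ι
  have σ := (Denumerable.eqv ι).symm
  refine ⟨σ, HilbertBasis.mkOfOrthogonalEqBot (b.orthonormal.comp σ σ.injective) ?_, fun n => ?_⟩
  · rw [σ.surjective.range_comp]
    have := b.dense_span
    rwa [Submodule.topologicalClosure_eq_top_iff] at this
  · rw [HilbertBasis.coe_mkOfOrthogonalEqBot]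
    rfl

end Hilbert

/-! ### Traces and eigensystems -/

section Hilbert

variable {H : Type*} [NormedAddCommGroup H] [InnerProductSpace ℂ H]

theorem hasSum_of_eigenbasis (ξ : HilbertBasis ℕ ℂ H) {T : H →L[ℂ] H} {l : ℕ → ℝ}
    (hT : ∀ n, T (ξ n) = (l n : ℂ) • ξ n) (v : H) :
    HasSum (fun n => ((l n : ℂ) * ⟪ξ n, v⟫_ℂ) • ξ n) (T v) := by
  refine ((ξ.hasSum_repr v).mapL T).congr_fun fun n => ?_
  rw [map_smul, hT, smul_smul, ξ.repr_apply_apply, mul_comm]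

theorem isSymmetric_of_eigenbasis (ξ : HilbertBasis ℕ ℂ H) {T : H →L[ℂ] H} {l : ℕ → ℝ}
    (hT : ∀ n, T (ξ n) = (l n : ℂ) • ξ n) : T.IsSymmetric := by
  intro u v
  have h1 := (hasSum_of_eigenbasis ξ hT v).mapL (innerSL ℂ u)
  have h2 := (hasSum_of_eigenbasis ξ hT u).mapL (innerSL ℂ v)
  have h3 : ⟪T u, v⟫_ℂ = (starRingEnd ℂ) ⟪v, T u⟫_ℂ := (inner_conj_symm _ _).symm
  have h4 := (Complex.hasSum_conj'.2 h2)
  change ⟪T u, v⟫_ℂ = ⟪u, T v⟫_ℂ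
  rw [h3]
  refine h4.unique (h1.congr_fun fun n => ?_)
  simp only [innerSL_apply_apply, inner_smul_right, map_mul, Complex.conj_ofReal, inner_conj_symm]
  ring

theorem hasSum_inner_of_eigenbasis (ξ : HilbertBasis ℕ ℂ H) {T : H →L[ℂ] H} {l : ℕ → ℝ}
    (hT : ∀ n, T (ξ n) = (l n : ℂ) • ξ n) (v : H) :
    HasSum (fun n => l n * ‖⟪ξ n, v⟫_ℂ‖ ^ 2) (⟪v, T v⟫_ℂ).re := by
  have h1 := Complex.hasSum_re ((hasSum_of_eigenbasis ξ hT v).mapL (innerSL ℂ v))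
  refine h1.congr_fun fun n => ?_
  simp only [innerSL_apply_apply, inner_smul_right]
  rw [mul_assoc, ← inner_conj_symm v, Complex.mul_conj', Complex.re_ofReal_mul,
    ← Complex.ofReal_pow, Complex.ofReal_re]

variable [CompleteSpace H]

/-- The trace of `M T` does not depend on the basis. -/
theorem hasSum_trace {ι : Type*} (e : HilbertBasis ι ℂ H) (ξ : HilbertBasis ℕ ℂ H)
    {T : H →L[ℂ] H} {l : ℕ → ℝ} (hT : ∀ n, T (ξ n) = (l n : ℂ) • ξ n) (hl : Summable l)
    (M : H →L[ℂ] H) :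
    HasSum (fun i => ⟪e i, M (T (e i))⟫_ℂ) (∑' n, (l n : ℂ) * ⟪ξ n, M (ξ n)⟫_ℂ) := by
  set F : ℕ × ι → ℂ := fun p => (l p.1 : ℂ) * (⟪ξ p.1, e p.2⟫_ℂ * ⟪e p.2, M (ξ p.1)⟫_ℂ) with hF
  have h1 : ∀ n, HasSum (fun i => F (n, i)) ((l n : ℂ) * ⟪ξ n, M (ξ n)⟫_ℂ) := fun n =>
    (e.hasSum_inner_mul_inner _ _).mul_left _
  have h2 : ∀ i, HasSum (fun n => F (n, i)) ⟪e i, M (T (e i))⟫_ℂ := by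
    intro i
    refine ((hasSum_of_eigenbasis ξ hT (e i)).mapL ((innerSL ℂ (e i)).comp M)).congr_fun fun n => ?_
    simp only [ContinuousLinearMap.comp_apply, map_smul, innerSL_apply_apply, smul_eq_mul, hF]
    ring
  have hbd : ∀ p : ℕ × ι, ‖F p‖ ≤
      |l p.1| * (1 / 2 * (‖⟪e p.2, ξ p.1⟫_ℂ‖ ^ 2 + ‖⟪e p.2, M (ξ p.1)⟫_ℂ‖ ^ 2)) := by
    intro p
    rw [hF]
    simp only [norm_mul, Complex.norm_real, Real.norm_eq_abs]
    refine mul_le_mul_of_nonneg_left ?_ (abs_nonneg _)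
    rw [norm_inner_symm (ξ p.1)]
    nlinarith [sq_nonneg (‖⟪e p.2, ξ p.1⟫_ℂ‖ - ‖⟪e p.2, M (ξ p.1)⟫_ℂ‖)]
  have h3 : ∀ n, HasSum (fun i => |l n| * (1 / 2 * (‖⟪e i, ξ n⟫_ℂ‖ ^ 2 + ‖⟪e i, M (ξ n)⟫_ℂ‖ ^ 2)))
      (|l n| * (1 / 2 * (‖ξ n‖ ^ 2 + ‖M (ξ n)‖ ^ 2))) := fun n =>
    (((hasSum_norm_inner_sq e _).add (hasSum_norm_inner_sq e _)).mul_left _).mul_left _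
  have hsF : Summable F := by
    refine Summable.of_norm_bounded ?_ hbd
    rw [summable_prod_of_nonneg fun p => by positivity]
    refine ⟨fun n => (h3 n).summable, ?_⟩
    simp only [(h3 _).tsum_eq]
    refine Summable.of_nonneg_of_le (fun n => by positivity) (fun n => ?_)
      (hl.abs.mul_right (1 / 2 * (1 + ‖M‖ ^ 2)))
    have h4 : ‖M (ξ n)‖ ≤ ‖M‖ := by
      have := M.le_opNorm (ξ n)
      rwa [ξ.orthonormal.1, mul_one] at this
    rw [ξ.orthonormal.1, one_pow]
    gcongr
  have h5 := hsF.hasSum.prod_fiberwise h1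
  rw [h5.tsum_eq]
  have h6 : HasSum (fun p : ι × ℕ => F p.swap) (∑' p, F p) :=
    (Equiv.prodComm ι ℕ).hasSum_iff.2 hsF.hasSum
  exact h6.prod_fiberwise h2

theorem opTrace_of_eigenbasis (ξ : HilbertBasis ℕ ℂ H) {T : H →L[ℂ] H} {l : ℕ → ℝ}
    (hT : ∀ n, T (ξ n) = (l n : ℂ) • ξ n) (hl : Summable l) :
    opTrace T = ((∑' n, l n : ℝ) : ℂ) := by
  have h := hasSum_trace (stdBasis H) ξ hT hl 1
  rw [opTrace]
  simp only [one_apply_eq_self] at h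
  rw [h.tsum_eq, Complex.ofReal_tsum]
  refine tsum_congr fun n => ?_
  rw [inner_self_eq_norm_sq_to_K, ξ.orthonormal.1]
  norm_num

/-- Traces computed in two eigenbases agree. -/
theorem tsum_inner_eigenbasis_eq (ξ η : HilbertBasis ℕ ℂ H) {T : H →L[ℂ] H} {l k : ℕ → ℝ}
    (hξ : ∀ n, T (ξ n) = (l n : ℂ) • ξ n) (hη : ∀ n, T (η n) = (k n : ℂ) • η n)
    (hl : Summable l) (M : H →L[ℂ] H) :
    ∑' n, (k n : ℂ) * ⟪η n, M (η n)⟫_ℂ = ∑' n, (l n : ℂ) * ⟪ξ n, M (ξ n)⟫_ℂ := by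
  rw [← (hasSum_trace η ξ hξ hl M).tsum_eq]
  refine tsum_congr fun n => ?_
  rw [hη, map_smul, inner_smul_right]

open ContinuousLinearMap in
-- The defect `w = Bx - μx` satisfies `Bw = -μw`, which contradicts `B ≥ 0` unless `w = 0` when `μ >
-- 0`. For `μ = 0`, `‖Bx‖² = ⟪x, B²x⟫ = 0`.
theorem sqrt_apply_eq {B : H →L[ℂ] H} (hB : 0 ≤ B) {μ : ℝ} (hμ : 0 ≤ μ) {x : H}
    (hx : B (B x) = ((μ ^ 2 : ℝ) : ℂ) • x) : B x = (μ : ℂ) • x := by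
  have hpos := (ContinuousLinearMap.nonneg_iff_isPositive B).1 hB
  have hsym : ∀ u v, ⟪B u, v⟫_ℂ = ⟪u, B v⟫_ℂ := hpos.isSymmetric
  set w := B x - (μ : ℂ) • x with hw
  have hBw : B w = -(μ : ℂ) • w := by
    rw [hw, map_sub, map_smul, hx]
    push_cast
    module
  have h1 : 0 ≤ (⟪w, B w⟫_ℂ).re := by
    have := hpos.re_inner_nonneg_right w
    simpa using this
  rw [hBw, inner_smul_right, inner_self_eq_norm_sq_to_K] at h1
  have h2 : (-(μ : ℂ) * ((‖w‖ : ℝ) : ℂ) ^ 2).re = -μ * ‖w‖ ^ 2 := by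
    rw [← Complex.ofReal_pow, ← Complex.ofReal_neg, ← Complex.ofReal_mul, Complex.ofReal_re]
  have h1' : 0 ≤ -μ * ‖w‖ ^ 2 := by rw [← h2]; exact h1
  have hw0 : w = 0 := by
    rcases hμ.eq_or_lt with h0 | h0
    · have h3 : ⟪B x, B x⟫_ℂ = 0 := by
        rw [hsym, hx, ← h0]
        simp
      rw [hw, inner_self_eq_zero.1 h3, ← h0]
      simp
    · have : ‖w‖ ^ 2 = 0 := le_antisymm (by nlinarith) (by positivity)
      exact norm_eq_zero.1 (pow_eq_zero_iff two_ne_zero |>.1 this)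
  exact sub_eq_zero.1 hw0

theorem sqrtAbs_nonneg (T : H →L[ℂ] H) : 0 ≤ sqrtAbs T := CFC.sqrt_nonneg _

theorem sqrtAbs_sqrtAbs (T : H →L[ℂ] H) (x : H) :
    sqrtAbs T (sqrtAbs T x) = CFC.abs T x :=
  congrArg (fun A : H →L[ℂ] H => A x) (CFC.sqrt_mul_sqrt_self (CFC.abs T) (CFC.abs_nonneg T))

theorem abs_abs_apply (T : H →L[ℂ] H) (x : H) :
    CFC.abs T (CFC.abs T x) = ContinuousLinearMap.adjoint T (T x) :=
  congrArg (fun A : H →L[ℂ] H => A x) (CFC.abs_mul_abs T)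

theorem adjoint_eq_of_isSymmetric {T : H →L[ℂ] H} (hT : T.IsSymmetric) :
    ContinuousLinearMap.adjoint T = T :=
  (ContinuousLinearMap.isSelfAdjoint_iff_isSymmetric.2 hT).adjoint_eq

theorem sqrtAbs_eigenvector {T : H →L[ℂ] H} (hT : T.IsSymmetric) {l : ℝ} {x : H}
    (hx : T x = (l : ℂ) • x) : sqrtAbs T x = (√|l| : ℂ) • x := by
  refine sqrt_apply_eq (sqrtAbs_nonneg T) (Real.sqrt_nonneg _) ?_
  rw [Real.sq_sqrt (abs_nonneg l), sqrtAbs_sqrtAbs]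
  refine sqrt_apply_eq (CFC.abs_nonneg T) (abs_nonneg l) ?_
  rw [abs_abs_apply, adjoint_eq_of_isSymmetric hT, hx, map_smul, hx, smul_smul, sq_abs]
  push_cast
  ring_nf

theorem norm_abs_apply (T : H →L[ℂ] H) (x : H) : ‖CFC.abs T x‖ = ‖T x‖ := by
  have hpos := (ContinuousLinearMap.nonneg_iff_isPositive _).1 (CFC.abs_nonneg T)
  have h1 : ⟪CFC.abs T x, CFC.abs T x⟫_ℂ = ⟪T x, T x⟫_ℂ := by
    rw [show ⟪CFC.abs T x, CFC.abs T x⟫_ℂ = ⟪x, CFC.abs T (CFC.abs T x)⟫_ℂ from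
      hpos.isSymmetric _ _, abs_abs_apply, ContinuousLinearMap.adjoint_inner_right]
  rw [inner_self_eq_norm_sq_to_K, inner_self_eq_norm_sq_to_K] at h1
  have h2 : ‖CFC.abs T x‖ ^ 2 = ‖T x‖ ^ 2 := by exact_mod_cast h1
  exact (pow_left_inj₀ (norm_nonneg _) (norm_nonneg _) two_ne_zero).1 h2

/-- `‖T x‖ = ‖|T| x‖ ≤ ‖|T|^{1/2}‖ ‖|T|^{1/2} x‖`, so `T` is Hilbert-Schmidt if `|T|^{1/2}` is. -/
theorem tsum_norm_sq_lt_top_of_sqrtAbs {ι : Type*} {e : HilbertBasis ι ℂ H} {T : H →L[ℂ] H}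
    (h : ∑' i, ENNReal.ofReal (‖sqrtAbs T (e i)‖ ^ 2) < ∞) :
    ∑' i, ENNReal.ofReal (‖T (e i)‖ ^ 2) < ∞ := by
  refine lt_of_le_of_lt (ENNReal.tsum_le_tsum fun i => ?_)
    ((ENNReal.tsum_mul_left (a := ENNReal.ofReal (‖sqrtAbs T‖ ^ 2))).trans_lt
      (ENNReal.mul_lt_top ENNReal.ofReal_lt_top h))
  rw [← ENNReal.ofReal_mul (by positivity), ← norm_abs_apply, ← sqrtAbs_sqrtAbs, ← mul_pow]
  gcongr
  exact (sqrtAbs T).le_opNorm _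

end Hilbert

/-! ### The one-particle space -/

/-- Needed because `IsEigensystem` asks for a basis indexed by `ℕ`. Indicators of disjoint spherical
shells give infinitely many independent vectors. -/
theorem infiniteDimensional_Hil : ¬ FiniteDimensional ℂ Hil := by
  intro hfin
  set s : ℕ → Set R3 := fun n => Metric.ball 0 (n + 1) \ Metric.ball 0 n with hs
  have hms : ∀ n, MeasurableSet (s n) := fun n => measurableSet_ball.diff measurableSet_ball
  have hfinite : ∀ n, volume (s n) ≠ ∞ := fun n =>
    ((measure_mono sdiff_subset).trans_lt measure_ball_lt_top).ne
  have hpos : ∀ n, volume (s n) ≠ 0 := by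
    intro n
    set x : R3 := EuclideanSpace.single 0 ((n : ℝ) + 1 / 2) with hx
    have hxn : ‖x‖ = n + 1 / 2 := by
      rw [hx, PiLp.norm_single, Real.norm_of_nonneg (by positivity)]
    refine (lt_of_lt_of_le (Metric.measure_ball_pos volume x (show (0 : ℝ) < 1 / 2 by norm_num))
      (measure_mono fun y hy => ?_)).ne'
    rw [Metric.mem_ball, dist_eq_norm] at hy
    have h1 := norm_sub_norm_le x y
    have h2 := norm_sub_norm_le y x
    rw [norm_sub_rev] at h1
    constructor
    · rw [mem_ball_zero_iff]; linarith
    · rw [mem_ball_zero_iff]; linarith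
  have hdisj : ∀ i j, i ≠ j → s i ∩ s j = ∅ := by
    have : ∀ i j, i < j → s i ∩ s j = ∅ := by
      intro i j hij
      ext y
      simp only [hs, mem_inter_iff, Set.mem_sdiff, mem_ball_zero_iff, mem_empty_iff_false, iff_false]
      rintro ⟨⟨h1, _⟩, _, h2⟩
      have : (i : ℝ) + 1 ≤ j := by exact_mod_cast hij
      exact h2 (lt_of_lt_of_le h1 this)
    intro i j hij
    rcases lt_or_gt_of_ne hij with h | h
    · exact this i j h
    · rw [inter_comm]; exact this j i h
  set c : Spinor := EuclideanSpace.single 0 1 with hc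
  set v : ℕ → Hil := fun n => indicatorConstLp 2 (hms n) (hfinite n) c with hv
  have hin : ∀ i j, ⟪v i, v j⟫_ℂ = ((volume (s i ∩ s j)).toReal : ℂ) := by
    intro i j
    rw [hv]
    simp only
    rw [L2.inner_indicatorConstLp_indicatorConstLp (hms i) (hms j) (hμs := hfinite i)
      (hμt := hfinite j)]
    simp [hc, Measure.real]
  have hli : LinearIndependent ℂ v := by
    refine linearIndependent_of_ne_zero_of_inner_eq_zero (𝕜 := ℂ) (fun i h0 => ?_)
      fun i j hij => ?_
    · have h1 := hin i i
      rw [h0, inner_zero_left, inter_self] at h1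
      have h2 : (volume (s i)).toReal = 0 := by exact_mod_cast h1.symm
      rcases (ENNReal.toReal_eq_zero_iff _).1 h2 with h3 | h3
      · exact hpos i h3
      · exact hfinite i h3
    · change ⟪v i, v j⟫_ℂ = 0
      rw [hin, hdisj i j hij]
      simp
  exact not_finite_iff_infinite.2 (inferInstance : Infinite ℕ) hli.finite

theorem separableSpace_Hil : TopologicalSpace.SeparableSpace Hil := by
  have : Fact ((2 : ℝ≥0∞) ≠ ∞) := ⟨by norm_num⟩
  infer_instance

theorem freeAbsForm_smul (m : ℝ) (c : ℂ) (u : Hil) :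
    freeAbsForm m (c • u) = ENNReal.ofReal (‖c‖ ^ 2) * freeAbsForm m u := by
  unfold freeAbsForm
  rw [← lintegral_const_mul' _ _ ENNReal.ofReal_ne_top, map_smul]
  refine lintegral_congr_ae ?_
  filter_upwards [Lp.coeFn_smul c (fourierL2 u)] with x hx
  rw [hx, Pi.smul_apply, norm_smul, ← ENNReal.ofReal_mul (by positivity)]
  congr 1
  ring

/-- The form of `|D₀|` with the symbol cut off at height `R`. -/
noncomputable def cutForm (m R : ℝ) (u : Hil) : ℝ≥0∞ :=
  ∫⁻ ξ, ENNReal.ofReal (min (freeEnergy m ξ) R * ‖fourierL2 u ξ‖ ^ 2)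

theorem cutForm_le (m R : ℝ) (u : Hil) : cutForm m R u ≤ freeAbsForm m u :=
  lintegral_mono fun ξ => by gcongr; exact min_le_left _ _

theorem tendsto_cutForm (m : ℝ) (u : Hil) :
    Tendsto (fun R : ℕ => cutForm m R u) atTop (𝓝 (freeAbsForm m u)) := by
  have hE : Measurable fun ξ : R3 => freeEnergy m ξ := (continuous_freeEnergy m).measurable
  have hu := measurable_norm_coe (fourierL2 u)
  refine lintegral_tendsto_of_tendsto_of_monotone
    (fun R => Measurable.aemeasurable (by fun_prop)) (ae_of_all _ fun ξ R R' h => ?_)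
    (ae_of_all _ fun ξ => tendsto_const_nhds.congr' ?_)
  · have : (R : ℝ) ≤ R' := by exact_mod_cast h
    simp only
    gcongr
  · obtain ⟨N, hN⟩ := exists_nat_ge (freeEnergy m ξ)
    filter_upwards [eventually_ge_atTop N] with R hR
    rw [min_eq_left (hN.trans (by exact_mod_cast hR))]

theorem exists_cutOperator (m : ℝ) {R : ℝ} (hR : 0 ≤ R) :
    ∃ A : Hil →L[ℂ] Hil, ∀ u, ENNReal.ofReal (‖A u‖ ^ 2) = cutForm m R u := by
  have hE : Continuous fun ξ : R3 => ((√(min (freeEnergy m ξ) R) : ℝ) : ℂ) :=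
    Complex.continuous_ofReal.comp
      (((continuous_freeEnergy m).min continuous_const).sqrt)
  obtain ⟨A, hA⟩ := exists_scalarMulOperator hE.aestronglyMeasurable (C := √R) fun ξ => by
    rw [Complex.norm_real, Real.norm_of_nonneg (Real.sqrt_nonneg _)]
    exact Real.sqrt_le_sqrt (min_le_right _ _)
  refine ⟨A.comp (fourierL2.toContinuousLinearEquiv : Hil →L[ℂ] Hil), fun u => ?_⟩
  rw [ContinuousLinearMap.comp_apply, ← lintegral_norm_sq, cutForm]
  refine lintegral_congr_ae ?_
  filter_upwards [hA (fourierL2 u)] with ξ hξ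
  change ENNReal.ofReal (‖A (fourierL2 u) ξ‖ ^ 2) = _
  rw [hξ, norm_smul, Complex.norm_real, mul_pow, Real.norm_eq_abs, sq_abs, Real.sq_sqrt]
  exact le_min (freeEnergy_nonneg m ξ) hR

/-- With the symbol cut off at `R` the sum is the squared Hilbert-Schmidt norm of a bounded operator
and does not depend on the basis; then `R → ∞` on finite partial sums. As the two bases are
arbitrary, one inequality is enough. -/
theorem tsum_freeAbsForm_le (m : ℝ) {ι κ : Type*} (e : HilbertBasis ι ℂ Hil)
    (b : HilbertBasis κ ℂ Hil) (S : Hil →L[ℂ] Hil) :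
    ∑' i, freeAbsForm m (S (e i)) ≤ ∑' j, freeAbsForm m (S (b j)) := by
  rw [ENNReal.tsum_eq_iSup_sum]
  refine iSup_le fun s => le_of_tendsto (tendsto_finsetSum s fun i _ =>
    tendsto_cutForm m (S (e i))) (Eventually.of_forall fun R => ?_)
  obtain ⟨A, hA⟩ := exists_cutOperator m (Nat.cast_nonneg (α := ℝ) R)
  refine (ENNReal.sum_le_tsum s).trans ?_
  have h := tsum_norm_sq_eq e b (A.comp S)
  simp only [ContinuousLinearMap.comp_apply, hA] at h
  rw [h]
  exact ENNReal.tsum_le_tsum fun j => cutForm_le _ _ _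

theorem normF_eq {m : ℝ} {T : Hil →L[ℂ] Hil} {l : ℕ → ℝ} {ξ : HilbertBasis ℕ ℂ Hil}
    (h : IsEigensystem T l ξ) :
    normF m T = ∑' n, ENNReal.ofReal |l n| * freeAbsForm m (ξ n) := by
  have h1 : normF m T = ∑' n, freeAbsForm m (sqrtAbs T (ξ n)) :=
    le_antisymm (tsum_freeAbsForm_le m _ _ _) (tsum_freeAbsForm_le m _ _ _)
  rw [h1]
  refine tsum_congr fun n => ?_
  rw [sqrtAbs_eigenvector (isSymmetric_of_eigenbasis ξ h) (h n), freeAbsForm_smul,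
    Complex.norm_real, Real.norm_eq_abs, sq_abs, Real.sq_sqrt (abs_nonneg _)]

/-- The mass gap makes `|T|^{1/2}`, hence `T`, Hilbert-Schmidt and so compact. Its eigenbasis is
then reindexed by `ℕ`. -/
theorem exists_eigensystem {m : ℝ} (hm : 0 < m) {T : Hil →L[ℂ] Hil} (hT : T ∈ spaceF m) :
    ∃ p : (ℕ → ℝ) × HilbertBasis ℕ ℂ Hil, IsEigensystem T p.1 p.2 := by
  have hsym := ContinuousLinearMap.isSelfAdjoint_iff_isSymmetric.1 hT.1
  have hS : ∑' i, ENNReal.ofReal (‖sqrtAbs T (stdBasis Hil i)‖ ^ 2) < ∞ := by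
    have h1 : ENNReal.ofReal |m| * ∑' i, ENNReal.ofReal (‖sqrtAbs T (stdBasis Hil i)‖ ^ 2) ≤
        normF m T := by
      rw [← ENNReal.tsum_mul_left]
      exact ENNReal.tsum_le_tsum fun i => freeAbsForm_ge m _
    refine lt_top_iff_ne_top.2 fun h2 => ?_
    rw [h2, ENNReal.mul_top (by simpa using hm.ne')] at h1
    exact (h1.trans_lt hT.2).ne rfl
  have hc := isCompactOperator_of_tsum_norm_sq (stdBasis Hil) hsym
    (tsum_norm_sq_lt_top_of_sqrtAbs hS)
  obtain ⟨ι, b, l, hb⟩ := exists_hilbertBasis_eigenvectors hc hsym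
  have := separableSpace_Hil
  obtain ⟨σ, b', hb'⟩ := exists_hilbertBasis_nat infiniteDimensional_Hil b
  refine ⟨(fun n => l (σ n), b'), fun n => ?_⟩
  simp only [hb', hb]

/-- An orthonormal basis of eigenvectors whose vectors are `eigenvector T`. -/
theorem exists_eigenvector_basis {m : ℝ} (hm : 0 < m) {T : Hil →L[ℂ] Hil} (hT : T ∈ spaceF m) :
    ∃ ξ : HilbertBasis ℕ ℂ Hil, eigenvector T = ξ ∧ IsEigensystem T (eigenvalue T) ξ := by
  have h := exists_eigensystem hm hT
  refine ⟨h.choose.2, ?_, ?_⟩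
  · rw [eigenvector, dif_pos h]
  · rw [eigenvalue, dif_pos h]
    exact h.choose_spec

/-! ### The interaction energy in terms of an eigensystem -/

theorem ae_summable_norm {ι α : Type*} [Countable ι] [MeasurableSpace α] {μ : Measure α}
    {E : Type*} [NormedAddCommGroup E] {F : ι → α → E} (hF : ∀ i, Integrable (F i) μ)
    (hs : Summable fun i => ∫ a, ‖F i a‖ ∂μ) : ∀ᵐ a ∂μ, Summable fun i => ‖F i a‖ := by
  refine summable_norm_of_tsum_eLpNorm_ne_top le_rfl (fun i => (hF i).aestronglyMeasurable) ?_
  have h : ∀ i, eLpNorm (F i) 1 μ = ENNReal.ofReal (∫ a, ‖F i a‖ ∂μ) := by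
    intro i
    rw [eLpNorm_one_eq_lintegral_enorm, ofReal_integral_norm_eq_lintegral_enorm (hF i)]
  simp only [h]
  rw [← ENNReal.ofReal_tsum_of_nonneg (fun i => integral_nonneg fun a => norm_nonneg _) hs]
  exact ENNReal.ofReal_ne_top

theorem integrable_tsum_of_summable {ι α : Type*} [Countable ι] [MeasurableSpace α]
    {μ : Measure α} {E : Type*} [NormedAddCommGroup E] [CompleteSpace E] [MeasurableSpace E]
    [BorelSpace E] [SecondCountableTopology E] {F : ι → α → E} (hF : ∀ i, Integrable (F i) μ)
    (hs : Summable fun i => ∫ a, ‖F i a‖ ∂μ) : Integrable (fun a => ∑' i, F i a) μ := by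
  refine ⟨(AEMeasurable.tsum fun i => (hF i).aestronglyMeasurable.aemeasurable).aestronglyMeasurable,
    ?_⟩
  have h : ∀ i, ∫⁻ a, ‖F i a‖ₑ ∂μ = ENNReal.ofReal (∫ a, ‖F i a‖ ∂μ) := fun i =>
    (ofReal_integral_norm_eq_lintegral_enorm (hF i)).symm
  refine lt_of_le_of_lt (b := ∫⁻ a, ∑' i, ‖F i a‖ₑ ∂μ) (lintegral_mono fun a => ?_) ?_
  · exact enorm_tsum_le_tsum_enorm
  · rw [lintegral_tsum fun i => (hF i).aestronglyMeasurable.enorm]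
    simp only [h]
    rw [← ENNReal.ofReal_tsum_of_nonneg (fun i => integral_nonneg fun a => norm_nonneg _) hs]
    exact ENNReal.ofReal_lt_top

/-- Finiteness of `∑ |lₙ| ⟪ξₙ, |D₀| ξₙ⟫`. -/
def FiniteKinetic (m : ℝ) (l : ℕ → ℝ) (ξ : ℕ → Hil) : Prop :=
  ∑' n, ENNReal.ofReal |l n| * freeAbsForm m (ξ n) < ∞

/-- Since `0 * ∞ = 0`, eigenvectors with `lₙ = 0` may lie outside `H^{1/2}`. Hence the recurring
case distinction on `lₙ = 0`. -/
theorem FiniteKinetic.lt_top {m : ℝ} {l : ℕ → ℝ} {ξ : ℕ → Hil} (h : FiniteKinetic m l ξ) {n : ℕ}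
    (hn : l n ≠ 0) : freeAbsForm m (ξ n) < ∞ := by
  have h1 := (ENNReal.le_tsum (f := fun n => ENNReal.ofReal |l n| * freeAbsForm m (ξ n)) n).trans_lt h
  refine lt_top_iff_ne_top.2 fun h2 => ?_
  rw [h2, ENNReal.mul_top (by simpa using hn)] at h1
  exact h1.ne rfl

theorem FiniteKinetic.summable_mul {m : ℝ} {l : ℕ → ℝ} {ξ : ℕ → Hil} (h : FiniteKinetic m l ξ) :
    Summable fun n => |l n| * (freeAbsForm m (ξ n)).toReal := by
  refine (ENNReal.summable_toReal h.ne).congr fun n => ?_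
  rw [ENNReal.toReal_mul, ENNReal.toReal_ofReal (abs_nonneg _)]

theorem FiniteKinetic.summable_abs {m : ℝ} (hm : 0 < m) {l : ℕ → ℝ} {ξ : ℕ → Hil}
    (h : FiniteKinetic m l ξ) (hξ : ∀ n, ‖ξ n‖ = 1) : Summable fun n => |l n| := by
  refine Summable.of_nonneg_of_le (fun n => abs_nonneg _) (fun n => ?_) (h.summable_mul.mul_left m⁻¹)
  by_cases hn : l n = 0
  · simp [hn]
  have h1 := ENNReal.toReal_mono (h.lt_top hn).ne (freeAbsForm_ge m (ξ n))
  rw [hξ, ENNReal.toReal_mul, ENNReal.toReal_ofReal (abs_nonneg _),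
    ENNReal.toReal_ofReal (by positivity), abs_of_pos hm] at h1
  rw [inv_mul_eq_div, le_div_iff₀ hm]
  nlinarith [abs_nonneg (l n)]

theorem FiniteKinetic.summable {m : ℝ} (hm : 0 < m) {l : ℕ → ℝ} {ξ : ℕ → Hil}
    (h : FiniteKinetic m l ξ) (hξ : ∀ n, ‖ξ n‖ = 1) : Summable l :=
  (h.summable_abs hm hξ).of_abs

theorem FiniteKinetic.mono {m C : ℝ} {l l' : ℕ → ℝ} {ξ : ℕ → Hil}
    (h : FiniteKinetic m l ξ) (hl : ∀ n, |l' n| ≤ C * |l n|) : FiniteKinetic m l' ξ := by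
  refine lt_of_le_of_lt (b := ∑' n, ENNReal.ofReal C *
    (ENNReal.ofReal |l n| * freeAbsForm m (ξ n))) (ENNReal.tsum_le_tsum fun n => ?_) ?_
  · rw [← mul_assoc, ← ENNReal.ofReal_mul' (abs_nonneg _)]
    gcongr
    exact hl n
  · rw [ENNReal.tsum_mul_left]
    exact ENNReal.mul_lt_top ENNReal.ofReal_lt_top h

theorem FiniteKinetic.add {m : ℝ} {l l' : ℕ → ℝ} {ξ : ℕ → Hil}
    (h : FiniteKinetic m l ξ) (h' : FiniteKinetic m l' ξ) :
    FiniteKinetic m (fun n => l n + l' n) ξ := by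
  refine lt_of_le_of_lt (ENNReal.tsum_le_tsum fun n => ?_)
    ((ENNReal.tsum_add (f := fun n => ENNReal.ofReal |l n| * freeAbsForm m (ξ n))
      (g := fun n => ENNReal.ofReal |l' n| * freeAbsForm m (ξ n))).trans_lt
      (ENNReal.add_lt_top.2 ⟨h, h'⟩))
  rw [← add_mul, ← ENNReal.ofReal_add (abs_nonneg _) (abs_nonneg _)]
  gcongr
  exact abs_add_le _ _

theorem ae_summable_norm_sq {l : ℕ → ℝ} {ξ : ℕ → Hil} (hl : Summable fun n => |l n|)
    (hξ : ∀ n, ‖ξ n‖ = 1) : ∀ᵐ x, Summable fun n => |l n| * ‖ξ n x‖ ^ 2 := by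
  have h := ae_summable_norm (μ := (volume : Measure R3))
    (F := fun n x => |l n| * ‖ξ n x‖ ^ 2)
    (fun n => (integrable_norm_sq (ξ n)).const_mul _) (hl.congr fun n => ?_)
  · filter_upwards [h] with x hx
    refine hx.congr fun n => ?_
    rw [Real.norm_of_nonneg (by positivity)]
  · have h1 : ∀ x, ‖|l n| * ‖ξ n x‖ ^ 2‖ = |l n| * ‖ξ n x‖ ^ 2 := fun x =>
      Real.norm_of_nonneg (by positivity)
    simp only [h1]
    rw [integral_const_mul, integral_norm_sq, hξ]
    norm_num

theorem summable_component {l : ℕ → ℝ} {ξ : ℕ → Hil} {x : R3}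
    (h : Summable fun n => |l n| * ‖ξ n x‖ ^ 2) (s : Fin 4) :
    Summable fun n => l n * ‖ξ n x s‖ ^ 2 := by
  refine Summable.of_norm_bounded h fun n => ?_
  rw [norm_mul, Real.norm_eq_abs, Real.norm_of_nonneg (by positivity)]
  gcongr
  exact PiLp.norm_apply_le _ _

theorem sum_tsum_component {l : ℕ → ℝ} {ξ : ℕ → Hil} {x : R3}
    (h : Summable fun n => |l n| * ‖ξ n x‖ ^ 2) :
    HasSum (fun n => l n * ‖ξ n x‖ ^ 2) (∑ s : Fin 4, ∑' n, l n * ‖ξ n x s‖ ^ 2) := by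
  refine (hasSum_sum fun s _ => (summable_component h s).hasSum).congr_fun fun n => ?_
  rw [EuclideanSpace.norm_sq_eq, Finset.mul_sum]

/-- Kato's inequality charges the kinetic energy to one factor only; for the other, absolute
summability of the occupations suffices. -/
theorem FiniteKinetic.summable_pair {m : ℝ} {k l : ℕ → ℝ} {η ξ : ℕ → Hil}
    (hk : Summable fun n => |k n|) (hη : ∀ n, ‖η n‖ = 1) (h : FiniteKinetic m l ξ)
    {t : Hil → Hil → ℝ} {C : ℝ} (hC : 0 ≤ C)
    (ht : ∀ u v, freeAbsForm m v < ∞ → |t u v| ≤ C * (‖u‖ ^ 2 * (freeAbsForm m v).toReal)) :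
    Summable fun p : ℕ × ℕ => k p.1 * l p.2 * t (η p.1) (ξ p.2) := by
  have h1 := hk.mul_of_nonneg (h.summable_mul.mul_left C) (fun n => abs_nonneg _)
    fun n => by positivity
  refine Summable.of_norm_bounded h1 fun p => ?_
  by_cases hp : l p.2 = 0
  · simp [hp]
  have h2 := ht (η p.1) (ξ p.2) (h.lt_top hp)
  rw [hη, one_pow, one_mul] at h2
  rw [norm_mul, norm_mul, Real.norm_eq_abs, Real.norm_eq_abs, Real.norm_eq_abs]
  calc |k p.1| * |l p.2| * |t (η p.1) (ξ p.2)|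
      ≤ |k p.1| * |l p.2| * (C * (freeAbsForm m (ξ p.2)).toReal) := by gcongr
    _ = _ := by ring

theorem abs_directTerm_le {m : ℝ} (u v : Hil) (hv : freeAbsForm m v < ∞) :
    |directTerm u v| ≤ Real.pi / 4 * (‖u‖ ^ 2 * (freeAbsForm m v).toReal) := by
  rw [abs_of_nonneg (directTerm_nonneg u v)]
  exact directTerm_le u hv

theorem abs_pairTerm_le {m : ℝ} (u v : Hil) (hv : freeAbsForm m v < ∞) :
    |pairTerm u v| ≤ Real.pi / 4 * (‖u‖ ^ 2 * (freeAbsForm m v).toReal) := by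
  rw [abs_of_nonneg (pairTerm_nonneg u hv)]
  exact (pairTerm_le_directTerm u hv).trans (directTerm_le u hv)

theorem hasSum_mul_prod {𝕜 : Type*} [RCLike 𝕜] {f g : ℕ → 𝕜} {a b : 𝕜} (hf : HasSum f a)
    (hg : HasSum g b) : HasSum (fun p : ℕ × ℕ => f p.1 * g p.2) (a * b) :=
  hf.mul hg (summable_mul_of_summable_norm hf.summable.norm hg.summable.norm)

theorem hasSum_conj_mul_prod {f : ℕ → ℂ} {a : ℂ} (hf : HasSum f a) :
    HasSum (fun p : ℕ × ℕ => (starRingEnd ℂ) (f p.1) * f p.2) ((starRingEnd ℂ) a * a) :=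
  hasSum_mul_prod (f := fun n => (starRingEnd ℂ) (f n)) (Complex.hasSum_conj'.2 hf) hf

theorem ae_fst_and_snd {p : R3 → Prop} (h : ∀ᵐ x, p x) : ∀ᵐ z : R3 × R3, p z.1 ∧ p z.2 := by
  have h1 : ∀ᵐ z : R3 × R3 ∂(volume.prod volume), p z.1 :=
    Measure.quasiMeasurePreserving_fst.ae h
  have h2 : ∀ᵐ z : R3 × R3 ∂(volume.prod volume), p z.2 :=
    Measure.quasiMeasurePreserving_snd.ae h
  exact h1.and h2

theorem FiniteKinetic.integrable_direct {m : ℝ} {l : ℕ → ℝ} {ξ : ℕ → Hil}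
    (h : FiniteKinetic m l ξ) (n k : ℕ) : Integrable fun z : R3 × R3 =>
      l n * l k * (‖ξ n z.1‖ ^ 2 * ‖ξ k z.2‖ ^ 2 * ‖z.1 - z.2‖⁻¹) := by
  by_cases hk : l k = 0
  · simp [hk]
  · exact (DiracFock.integrable_direct _ (h.lt_top hk)).const_mul _

theorem FiniteKinetic.integral_norm_direct {l : ℕ → ℝ} {ξ : ℕ → Hil} (n k : ℕ) :
    ∫ z : R3 × R3, ‖l n * l k * (‖ξ n z.1‖ ^ 2 * ‖ξ k z.2‖ ^ 2 * ‖z.1 - z.2‖⁻¹)‖ =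
      2 * (|l n| * |l k| * directTerm (ξ n) (ξ k)) := by
  have h1 : ∀ z : R3 × R3, ‖l n * l k * (‖ξ n z.1‖ ^ 2 * ‖ξ k z.2‖ ^ 2 * ‖z.1 - z.2‖⁻¹)‖ =
      |l n| * |l k| * (‖ξ n z.1‖ ^ 2 * ‖ξ k z.2‖ ^ 2 * ‖z.1 - z.2‖⁻¹) := by
    intro z
    rw [norm_mul, norm_mul, Real.norm_eq_abs, Real.norm_eq_abs,
      Real.norm_of_nonneg (by positivity : 0 ≤ ‖ξ n z.1‖ ^ 2 * ‖ξ k z.2‖ ^ 2 * ‖z.1 - z.2‖⁻¹)]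
  simp only [h1]
  rw [integral_const_mul, directTerm]
  ring

theorem FiniteKinetic.summable_direct {m : ℝ} (hm : 0 < m) {l : ℕ → ℝ} {ξ : ℕ → Hil}
    (h : FiniteKinetic m l ξ) (hξ : ∀ n, ‖ξ n‖ = 1) :
    Summable fun p : ℕ × ℕ => |l p.1| * |l p.2| * directTerm (ξ p.1) (ξ p.2) :=
  FiniteKinetic.summable_pair (k := fun n => |l n|) (l := fun n => |l n|)
    (by simpa using h.summable_abs hm hξ) hξ (h.mono (C := 1) fun n => by simp)
    (C := Real.pi / 4) (by positivity) abs_directTerm_le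

/-- Absolute convergence of the double series of direct energies justifies exchanging sum and
integral, and makes the pointwise density series converge almost everywhere, where the default value
of a divergent `tsum` plays no role. -/
theorem hasSum_coulombEnergy {m : ℝ} (hm : 0 < m) {l : ℕ → ℝ} {ξ : ℕ → Hil}
    (h : FiniteKinetic m l ξ) (hξ : ∀ n, ‖ξ n‖ = 1) {ρ : R3 → ℝ}
    (hρ : ∀ x, ρ x = ∑ s : Fin 4, ∑' n, l n * ‖ξ n x s‖ ^ 2) :
    HasSum (fun p : ℕ × ℕ => l p.1 * l p.2 * directTerm (ξ p.1) (ξ p.2)) (coulombEnergy ρ ρ) := by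
  set F : ℕ × ℕ → R3 × R3 → ℝ := fun p z =>
    l p.1 * l p.2 * (‖ξ p.1 z.1‖ ^ 2 * ‖ξ p.2 z.2‖ ^ 2 * ‖z.1 - z.2‖⁻¹) with hF
  have hFi : ∀ p, Integrable (F p) := fun p => h.integrable_direct p.1 p.2
  have hFs : Summable fun p => ∫ z, ‖F p z‖ :=
    ((h.summable_direct hm hξ).mul_left 2).congr fun p =>
      (FiniteKinetic.integral_norm_direct p.1 p.2).symm
  have hpt : (fun z : R3 × R3 => ∑' p, F p z) =ᵐ[volume]
      fun z => ρ z.1 * ρ z.2 / ‖z.1 - z.2‖ := by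
    filter_upwards [ae_fst_and_snd (ae_summable_norm_sq (h.summable_abs hm hξ) hξ)] with z hz
    have h1 := sum_tsum_component hz.1
    have h2 := sum_tsum_component hz.2
    rw [← hρ] at h1 h2
    have h3 := (hasSum_mul_prod h1 h2).mul_right ‖z.1 - z.2‖⁻¹
    rw [← div_eq_mul_inv] at h3
    rw [← h3.tsum_eq]
    refine tsum_congr fun p => ?_
    simp only [hF]
    ring
  have h4 := hasSum_integral_of_summable_integral_norm hFi hFs
  have h5 : Integrable (fun z : R3 × R3 => ρ z.1 * ρ z.2 / ‖z.1 - z.2‖) :=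
    (integrable_tsum_of_summable hFi hFs).congr hpt
  have h6 : ∫ z, ∑' p, F p z = ∫ x, ∫ y, ρ x * ρ y / ‖x - y‖ :=
    (integral_congr_ae hpt).trans (integral_prod _ h5)
  rw [h6] at h4
  refine (h4.mul_left (1 / 2)).congr_fun fun p => ?_
  simp only [hF]
  rw [integral_const_mul, directTerm]
  ring

theorem hasSum_kernelSq {l : ℕ → ℝ} {ξ : ℕ → Hil} {x y : R3}
    (hx : Summable fun n => |l n| * ‖ξ n x‖ ^ 2) (hy : Summable fun n => |l n| * ‖ξ n y‖ ^ 2)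
    {K : Fin 4 → Fin 4 → ℂ} (hK : ∀ s t, K s t = ∑' n, (l n : ℂ) * ξ n x s * star (ξ n y t)) :
    HasSum (fun p : ℕ × ℕ => ((l p.1 * l p.2 : ℝ) : ℂ) *
      (⟪ξ p.1 x, ξ p.2 x⟫_ℂ * ⟪ξ p.2 y, ξ p.1 y⟫_ℂ)) (∑ s, ∑ t, star (K s t) * K s t) := by
  have h1 : ∀ s t, Summable fun n => ‖(l n : ℂ) * ξ n x s * star (ξ n y t)‖ := by
    intro s t
    refine Summable.of_nonneg_of_le (fun n => norm_nonneg _) (fun n => ?_) (hx.add hy)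
    rw [norm_mul, norm_mul, Complex.norm_real, Real.norm_eq_abs, norm_star, ← mul_add, mul_assoc]
    refine mul_le_mul_of_nonneg_left ?_ (abs_nonneg _)
    have h2 := PiLp.norm_apply_le (ξ n x) s
    have h3 := PiLp.norm_apply_le (ξ n y) t
    calc ‖ξ n x s‖ * ‖ξ n y t‖ ≤ ‖ξ n x‖ * ‖ξ n y‖ := by gcongr
      _ ≤ _ := by nlinarith [sq_nonneg (‖ξ n x‖ - ‖ξ n y‖), sq_nonneg ‖ξ n x‖, sq_nonneg ‖ξ n y‖]
  have h2 : ∀ s t, HasSum (fun p : ℕ × ℕ =>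
      (starRingEnd ℂ) ((l p.1 : ℂ) * ξ p.1 x s * star (ξ p.1 y t)) *
      ((l p.2 : ℂ) * ξ p.2 x s * star (ξ p.2 y t))) ((starRingEnd ℂ) (K s t) * K s t) := by
    intro s t
    rw [hK]
    exact hasSum_conj_mul_prod (f := fun n => (l n : ℂ) * ξ n x s * star (ξ n y t))
      (h1 s t).of_norm.hasSum
  have h3 : HasSum (fun p : ℕ × ℕ => ∑ s, ∑ t,
      (starRingEnd ℂ) ((l p.1 : ℂ) * ξ p.1 x s * star (ξ p.1 y t)) *
      ((l p.2 : ℂ) * ξ p.2 x s * star (ξ p.2 y t)))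
      (∑ s, ∑ t, (starRingEnd ℂ) (K s t) * K s t) :=
    hasSum_sum fun s _ => hasSum_sum fun t _ => h2 s t
  simp only [Complex.star_def]
  refine h3.congr_fun fun p => ?_
  rw [PiLp.inner_apply, PiLp.inner_apply, Finset.sum_mul_sum, Finset.mul_sum]
  refine Finset.sum_congr rfl fun s _ => ?_
  rw [Finset.mul_sum]
  refine Finset.sum_congr rfl fun t _ => ?_
  rw [RCLike.inner_apply, RCLike.inner_apply]
  simp only [Complex.star_def, map_mul, Complex.conj_ofReal, Complex.conj_conj]
  push_cast
  ring

theorem FiniteKinetic.integrable_exchange {m : ℝ} {l : ℕ → ℝ} {ξ : ℕ → Hil}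
    (h : FiniteKinetic m l ξ) (n k : ℕ) : Integrable fun z : R3 × R3 =>
      ((l n * l k : ℝ) : ℂ) *
        (⟪ξ n z.1, ξ k z.1⟫_ℂ * ⟪ξ k z.2, ξ n z.2⟫_ℂ * ((‖z.1 - z.2‖⁻¹ : ℝ) : ℂ)) := by
  by_cases hk : l k = 0
  · simp [hk]
  · exact (DiracFock.integrable_exchange _ (h.lt_top hk)).const_mul _

theorem FiniteKinetic.integral_norm_exchange_le {m : ℝ} {l : ℕ → ℝ} {ξ : ℕ → Hil}
    (h : FiniteKinetic m l ξ) (n k : ℕ) :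
    ∫ z : R3 × R3, ‖((l n * l k : ℝ) : ℂ) *
        (⟪ξ n z.1, ξ k z.1⟫_ℂ * ⟪ξ k z.2, ξ n z.2⟫_ℂ * ((‖z.1 - z.2‖⁻¹ : ℝ) : ℂ))‖ ≤
      4 * (|l n| * |l k| * directTerm (ξ n) (ξ k)) := by
  have h1 := (h.integrable_direct n k).norm
  have h2 := (h.integrable_direct k n).norm
  have h3 : 4 * (|l n| * |l k| * directTerm (ξ n) (ξ k)) =
      ∫ z : R3 × R3, (‖l n * l k * (‖ξ n z.1‖ ^ 2 * ‖ξ k z.2‖ ^ 2 * ‖z.1 - z.2‖⁻¹)‖ +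
        ‖l k * l n * (‖ξ k z.1‖ ^ 2 * ‖ξ n z.2‖ ^ 2 * ‖z.1 - z.2‖⁻¹)‖) := by
    rw [integral_add h1 h2, FiniteKinetic.integral_norm_direct,
      FiniteKinetic.integral_norm_direct, directTerm_comm (ξ k)]
    ring
  rw [h3]
  refine integral_mono (h.integrable_exchange n k).norm (h1.add h2) fun z => ?_
  simp only
  have h4 := norm_exchange_le (ξ n z.1) (ξ k z.1) (ξ k z.2) (ξ n z.2)
    (inv_nonneg.2 (norm_nonneg (z.1 - z.2)))
  rw [norm_mul, Complex.norm_real, norm_mul (l n * l k), norm_mul (l k * l n), mul_comm (l k),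
    ← mul_add]
  refine mul_le_mul_of_nonneg_left (h4.trans (le_of_eq ?_)) (norm_nonneg _)
  rw [Real.norm_of_nonneg (by positivity), Real.norm_of_nonneg (by positivity)]

/-- The same exchange of sum and integral as for the direct energy, which up to a constant also
dominates the norms of the exchange terms. -/
theorem hasSum_exchangeEnergy {m : ℝ} (hm : 0 < m) {T : Hil →L[ℂ] Hil}
    (h : FiniteKinetic m (eigenvalue T) (eigenvector T)) (hξ : ∀ n, ‖eigenvector T n‖ = 1) :
    HasSum (fun p : ℕ × ℕ => eigenvalue T p.1 * eigenvalue T p.2 *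
      exchangeTerm (eigenvector T p.1) (eigenvector T p.2)) (exchangeEnergy T T).re := by
  set l := eigenvalue T with hl
  set ξ := eigenvector T with hξd
  set F : ℕ × ℕ → R3 × R3 → ℂ := fun p z => ((l p.1 * l p.2 : ℝ) : ℂ) *
    (⟪ξ p.1 z.1, ξ p.2 z.1⟫_ℂ * ⟪ξ p.2 z.2, ξ p.1 z.2⟫_ℂ * ((‖z.1 - z.2‖⁻¹ : ℝ) : ℂ)) with hF
  have hFi : ∀ p, Integrable (F p) := fun p => h.integrable_exchange p.1 p.2
  have hFs : Summable fun p => ∫ z, ‖F p z‖ :=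
    Summable.of_nonneg_of_le (fun p => integral_nonneg fun z => norm_nonneg _)
      (fun p => h.integral_norm_exchange_le p.1 p.2) ((h.summable_direct hm hξ).mul_left 4)
  have hpt : (fun z : R3 × R3 => ∑' p, F p z) =ᵐ[volume] fun z =>
      (∑ s : Fin 4, ∑ t : Fin 4, star (kernel T z.1 z.2 s t) * kernel T z.1 z.2 s t) /
        (‖z.1 - z.2‖ : ℂ) := by
    filter_upwards [ae_fst_and_snd (ae_summable_norm_sq (h.summable_abs hm hξ) hξ)] with z hz
    have h1 := (hasSum_kernelSq hz.1 hz.2 (K := kernel T z.1 z.2) fun s t => rfl).mul_right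
      ((‖z.1 - z.2‖⁻¹ : ℝ) : ℂ)
    rw [Complex.ofReal_inv, ← div_eq_mul_inv] at h1
    rw [← h1.tsum_eq]
    refine tsum_congr fun p => ?_
    simp only [hF]
    rw [Complex.ofReal_inv]
    ring
  have h4 := hasSum_integral_of_summable_integral_norm hFi hFs
  have h5 := (integrable_tsum_of_summable hFi hFs).congr hpt
  have h6 := (integral_congr_ae hpt).trans (integral_prod _ h5)
  rw [h6] at h4
  have h7 := Complex.hasSum_re (h4.mul_left (1 / 2))
  refine h7.congr_fun fun p => ?_
  simp only [hF]
  rw [integral_const_mul, exchangeTerm, show (1 / 2 : ℂ) = ((1 / 2 : ℝ) : ℂ) by norm_num,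
    Complex.re_ofReal_mul, Complex.re_ofReal_mul]
  ring

theorem hasSum_interaction {m : ℝ} (hm : 0 < m) {T : Hil →L[ℂ] Hil}
    (h : FiniteKinetic m (eigenvalue T) (eigenvector T)) (hξ : ∀ n, ‖eigenvector T n‖ = 1) :
    HasSum (fun p : ℕ × ℕ => eigenvalue T p.1 * eigenvalue T p.2 *
      pairTerm (eigenvector T p.1) (eigenvector T p.2)) (interaction T T) := by
  refine ((hasSum_coulombEnergy hm h hξ (ρ := density T) fun x => rfl).sub
    (hasSum_exchangeEnergy hm h hξ)).congr_fun fun p => ?_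
  rw [pairTerm]
  ring

/-! ### Bounded sesquilinear forms -/

/-- The minimizing choice is `s = √b / √a`; if `a` or `b` vanishes, `s` is sent to `∞` or to `0`
instead. -/
theorem le_two_mul_sqrt_mul_sqrt {x a b C : ℝ} (ha : 0 ≤ a) (hb : 0 ≤ b)
    (h : ∀ s, 0 < s → x ≤ C * (s * a + s⁻¹ * b)) : x ≤ 2 * C * √a * √b := by
  rcases ha.eq_or_lt with rfl | ha
  · have h1 : Tendsto (fun s : ℝ => C * (s * 0 + s⁻¹ * b)) atTop (𝓝 (C * (0 + 0 * b))) := by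
      simp only [mul_zero]
      exact tendsto_const_nhds.mul (tendsto_const_nhds.add (tendsto_inv_atTop_zero.mul_const b))
    have := ge_of_tendsto h1 (by filter_upwards [eventually_gt_atTop 0] with s hs using h s hs)
    simpa using this
  rcases hb.eq_or_lt with rfl | hb
  · have h1 : Tendsto (fun s : ℝ => C * (s⁻¹ * a + s * 0)) atTop (𝓝 (C * (0 * a + 0))) := by
      simp only [mul_zero]
      exact tendsto_const_nhds.mul ((tendsto_inv_atTop_zero.mul_const a).add tendsto_const_nhds)
    have := ge_of_tendsto h1 (by
      filter_upwards [eventually_gt_atTop 0] with s hs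
      have := h s⁻¹ (inv_pos.2 hs)
      rwa [inv_inv] at this)
    simpa using this
  have h1 := h (√b / √a) (by positivity)
  refine h1.trans (le_of_eq ?_)
  have ha' : √a ≠ 0 := (Real.sqrt_pos.2 ha).ne'
  have hb' : √b ≠ 0 := (Real.sqrt_pos.2 hb).ne'
  have h2 : √b / √a * a = √a * √b := by
    rw [div_mul_eq_mul_div, div_eq_iff ha']
    linear_combination -√b * Real.mul_self_sqrt ha.le
  have h3 : (√b / √a)⁻¹ * b = √a * √b := by
    rw [inv_div, div_mul_eq_mul_div, div_eq_iff hb']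
    linear_combination -√a * Real.mul_self_sqrt hb.le
  rw [h2, h3]
  ring

/-- A form bounded by `C (F u + F v)`, with `F` homogeneous of degree two, is bounded by
`2 C (F u)^{1/2} (F v)^{1/2}`. -/
theorem norm_form_le {V : Type*} [AddCommGroup V] [Module ℂ V] {B : V → V → ℂ} {F : V → ℝ}
    {C : ℝ} (hF0 : ∀ u, 0 ≤ F u) (hF : ∀ (t : ℝ) u, F ((t : ℂ) • u) = t ^ 2 * F u)
    (hB : ∀ (s t : ℝ) u v, B ((s : ℂ) • u) ((t : ℂ) • v) = ((s * t : ℝ) : ℂ) * B u v)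
    {D : Set V} (hD : ∀ (t : ℝ), ∀ u ∈ D, (t : ℂ) • u ∈ D)
    (hb : ∀ u ∈ D, ∀ v ∈ D, ‖B u v‖ ≤ C * (F u + F v)) {u v : V} (hu : u ∈ D) (hv : v ∈ D) :
    ‖B u v‖ ≤ 2 * C * √(F u) * √(F v) := by
  refine le_two_mul_sqrt_mul_sqrt (hF0 u) (hF0 v) fun s hs => ?_
  have h := hb _ (hD √s u hu) _ (hD (√s)⁻¹ v hv)
  rw [hB, mul_inv_cancel₀ (Real.sqrt_pos.2 hs).ne', hF, hF, inv_pow, Real.sq_sqrt hs.le] at h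
  simpa using h

theorem exists_operator_of_form {B : Hil → Hil → ℂ} {C : ℝ}
    (hadd : ∀ u v w, B (u + v) w = B u w + B v w)
    (hsmul : ∀ (c : ℂ) u w, B (c • u) w = (starRingEnd ℂ) c * B u w)
    (hadd' : ∀ u v w, B u (v + w) = B u v + B u w)
    (hsmul' : ∀ (c : ℂ) u w, B u (c • w) = c * B u w)
    (hb : ∀ u v, ‖B u v‖ ≤ C * (‖u‖ ^ 2 + ‖v‖ ^ 2)) :
    ∃ M : Hil →L[ℂ] Hil, ∀ u v, ⟪u, M v⟫_ℂ = B u v := by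
  set L : Hil →ₗ⋆[ℂ] Hil →ₗ[ℂ] ℂ := LinearMap.mk₂'ₛₗ (starRingEnd ℂ) (RingHom.id ℂ) B hadd hsmul
    hadd' hsmul' with hL
  have hbd : ∀ u v, ‖L u v‖ ≤ 2 * C * ‖u‖ * ‖v‖ := by
    intro u v
    have h := norm_form_le (B := B) (F := fun u : Hil => ‖u‖ ^ 2) (C := C) (D := univ)
      (fun u => by positivity) (fun t u => by
        rw [norm_smul, mul_pow, Complex.norm_real, Real.norm_eq_abs, sq_abs])
      (fun s t u v => by
        rw [hsmul, hsmul', Complex.conj_ofReal]; push_cast; ring)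
      (fun t u _ => mem_univ _) (fun u _ v _ => hb u v) (mem_univ u) (mem_univ v)
    rwa [Real.sqrt_sq (norm_nonneg _), Real.sqrt_sq (norm_nonneg _)] at h
  refine ⟨ContinuousLinearMap.adjoint (InnerProductSpace.continuousLinearMapOfBilin
    (L.mkContinuous₂ (2 * C) hbd)), fun u v => ?_⟩
  rw [ContinuousLinearMap.adjoint_inner_right,
    InnerProductSpace.continuousLinearMapOfBilin_apply]
  rfl

/-- The sesquilinear form whose quadratic form is `v ↦ pairTerm u v`. -/
noncomputable def pairForm (u v w : Hil) : ℂ :=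
  1 / 2 * ∫ p : R3 × R3, (⟪u p.1, u p.1⟫_ℂ * ⟪v p.2, w p.2⟫_ℂ * ((‖p.1 - p.2‖⁻¹ : ℝ) : ℂ) -
    ⟪u p.1, w p.1⟫_ℂ * ⟪v p.2, u p.2⟫_ℂ * ((‖p.1 - p.2‖⁻¹ : ℝ) : ℂ))

theorem integrable_pairForm_direct {m : ℝ} {u : Hil} (hu : freeAbsForm m u < ∞) (v w : Hil) :
    Integrable fun p : R3 × R3 =>
      ⟪u p.1, u p.1⟫_ℂ * ⟪v p.2, w p.2⟫_ℂ * ((‖p.1 - p.2‖⁻¹ : ℝ) : ℂ) :=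
  ((integrable_direct_swap v hu).add (integrable_direct_swap w hu)).mono'
    (measurable_exchange u u v w) (ae_of_all _ fun p => norm_exchange_le _ _ _ _ (by positivity))

theorem integrable_pairForm_exchange {m : ℝ} {u : Hil} (hu : freeAbsForm m u < ∞) (v w : Hil) :
    Integrable fun p : R3 × R3 =>
      ⟪u p.1, w p.1⟫_ℂ * ⟪v p.2, u p.2⟫_ℂ * ((‖p.1 - p.2‖⁻¹ : ℝ) : ℂ) :=
  ((integrable_direct_swap v hu).add (integrable_direct w hu)).mono'
    (measurable_exchange u w v u) (ae_of_all _ fun p => norm_exchange_le _ _ _ _ (by positivity))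

theorem integrable_pairForm {m : ℝ} {u : Hil} (hu : freeAbsForm m u < ∞) (v w : Hil) :
    Integrable fun p : R3 × R3 =>
      ⟪u p.1, u p.1⟫_ℂ * ⟪v p.2, w p.2⟫_ℂ * ((‖p.1 - p.2‖⁻¹ : ℝ) : ℂ) -
      ⟪u p.1, w p.1⟫_ℂ * ⟪v p.2, u p.2⟫_ℂ * ((‖p.1 - p.2‖⁻¹ : ℝ) : ℂ) :=
  (integrable_pairForm_direct hu v w).sub (integrable_pairForm_exchange hu v w)

theorem pairForm_self {m : ℝ} {u : Hil} (hu : freeAbsForm m u < ∞) (v : Hil) :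
    (pairForm u v v).re = pairTerm u v := by
  unfold pairForm
  rw [integral_sub (integrable_pairForm_direct hu v v) (integrable_pairForm_exchange hu v v)]
  have h : ∀ p : R3 × R3, ⟪u p.1, u p.1⟫_ℂ * ⟪v p.2, v p.2⟫_ℂ * ((‖p.1 - p.2‖⁻¹ : ℝ) : ℂ) =
      ((‖u p.1‖ ^ 2 * ‖v p.2‖ ^ 2 * ‖p.1 - p.2‖⁻¹ : ℝ) : ℂ) := by
    intro p
    rw [inner_self_eq_norm_sq_to_K, inner_self_eq_norm_sq_to_K]
    push_cast
    rfl
  simp only [h]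
  rw [integral_complex_ofReal, show (1 / 2 : ℂ) = ((1 / 2 : ℝ) : ℂ) by norm_num,
    Complex.re_ofReal_mul, Complex.sub_re, Complex.ofReal_re, pairTerm, directTerm, exchangeTerm]
  ring

theorem norm_pairForm_le {m : ℝ} {u : Hil} (hu : freeAbsForm m u < ∞) (v w : Hil) :
    ‖pairForm u v w‖ ≤ Real.pi / 2 * (freeAbsForm m u).toReal * (‖v‖ ^ 2 + ‖w‖ ^ 2) := by
  have h1 := integrable_direct_swap v hu
  have h2 := integrable_direct_swap w hu
  have h3 := integrable_direct w hu
  have h4 : ‖∫ p : R3 × R3, (⟪u p.1, u p.1⟫_ℂ * ⟪v p.2, w p.2⟫_ℂ * ((‖p.1 - p.2‖⁻¹ : ℝ) : ℂ) -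
      ⟪u p.1, w p.1⟫_ℂ * ⟪v p.2, u p.2⟫_ℂ * ((‖p.1 - p.2‖⁻¹ : ℝ) : ℂ))‖ ≤
      ∫ p : R3 × R3, ((‖u p.1‖ ^ 2 * ‖v p.2‖ ^ 2 * ‖p.1 - p.2‖⁻¹ +
        ‖u p.1‖ ^ 2 * ‖w p.2‖ ^ 2 * ‖p.1 - p.2‖⁻¹) +
        (‖u p.1‖ ^ 2 * ‖v p.2‖ ^ 2 * ‖p.1 - p.2‖⁻¹ +
        ‖w p.1‖ ^ 2 * ‖u p.2‖ ^ 2 * ‖p.1 - p.2‖⁻¹)) := by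
    refine norm_integral_le_of_norm_le ((h1.add h2).add (h1.add h3)) (ae_of_all _ fun p => ?_)
    refine (norm_sub_le _ _).trans (add_le_add ?_ ?_)
    · exact norm_exchange_le _ _ _ _ (by positivity)
    · exact norm_exchange_le _ _ _ _ (by positivity)
  have h12 : Integrable (fun p : R3 × R3 => ‖u p.1‖ ^ 2 * ‖v p.2‖ ^ 2 * ‖p.1 - p.2‖⁻¹ +
        ‖u p.1‖ ^ 2 * ‖w p.2‖ ^ 2 * ‖p.1 - p.2‖⁻¹) volume := h1.add h2
  have h13 : Integrable (fun p : R3 × R3 => ‖u p.1‖ ^ 2 * ‖v p.2‖ ^ 2 * ‖p.1 - p.2‖⁻¹ +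
        ‖w p.1‖ ^ 2 * ‖u p.2‖ ^ 2 * ‖p.1 - p.2‖⁻¹) volume := h1.add h3
  rw [integral_add h12 h13, integral_add h1 h2, integral_add h1 h3] at h4
  have h5 := directTerm_le v hu
  have h6 := directTerm_le w hu
  have h7 := directTerm_comm u v
  have h8 := directTerm_comm u w
  unfold pairForm
  unfold directTerm at h5 h6 h7 h8
  rw [norm_mul]
  norm_num
  norm_num at h4 h5 h6 h7 h8
  linarith

/-- For fixed `u` of finite kinetic energy, Kato's inequality makes `v ↦ pairTerm u v` a bounded
quadratic form. Realizing it by an operator brings in the basis independence of the trace. -/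
theorem exists_pairOperator {m : ℝ} {u : Hil} (hu : freeAbsForm m u < ∞) :
    ∃ M : Hil →L[ℂ] Hil, ∀ v, (⟪v, M v⟫_ℂ).re = pairTerm u v := by
  refine (exists_operator_of_form (B := pairForm u) (C := Real.pi / 2 * (freeAbsForm m u).toReal)
    ?_ ?_ ?_ ?_ (norm_pairForm_le hu)).imp fun M hM v => by rw [hM, pairForm_self hu]
  · intro v w z
    unfold pairForm
    rw [← mul_add, ← integral_add (integrable_pairForm hu v z) (integrable_pairForm hu w z)]
    congr 1
    refine integral_congr_ae ?_
    filter_upwards [ae_fst_and_snd (Lp.coeFn_add v w)] with p hp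
    rw [hp.2, Pi.add_apply, inner_add_left, inner_add_left]
    ring
  · intro c v w
    unfold pairForm
    rw [mul_left_comm]
    congr 1
    rw [← integral_const_mul]
    refine integral_congr_ae ?_
    filter_upwards [ae_fst_and_snd (Lp.coeFn_smul c v)] with p hp
    rw [hp.2, Pi.smul_apply, inner_smul_left, inner_smul_left]
    ring
  · intro z v w
    unfold pairForm
    rw [← mul_add, ← integral_add (integrable_pairForm hu z v) (integrable_pairForm hu z w)]
    congr 1
    refine integral_congr_ae ?_
    filter_upwards [ae_fst_and_snd (Lp.coeFn_add v w)] with p hp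
    rw [hp.1, hp.2, Pi.add_apply, Pi.add_apply, inner_add_right, inner_add_right]
    ring
  · intro c v w
    unfold pairForm
    rw [mul_left_comm]
    congr 1
    rw [← integral_const_mul]
    refine integral_congr_ae ?_
    filter_upwards [ae_fst_and_snd (Lp.coeFn_smul c w)] with p hp
    rw [hp.1, hp.2, Pi.smul_apply, Pi.smul_apply, inner_smul_right, inner_smul_right]
    ring

/-! ### The one-particle form -/

/-- Any constant independent of `m` and `ξ` will do: it serves for continuity of forms and
domination of series and never enters the final estimate. -/
theorem exists_norm_diracSymbol_le :
    ∃ C, 0 ≤ C ∧ ∀ m ξ s, ‖diracSymbol m ξ s‖ ≤ C * (freeEnergy m ξ * ‖s‖) := by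
  set A : Fin 3 → Spinor →L[ℂ] Spinor := fun j =>
    LinearMap.toContinuousLinearMap (Matrix.toEuclideanLin (diracAlpha j)) with hA
  set B : Spinor →L[ℂ] Spinor := LinearMap.toContinuousLinearMap (Matrix.toEuclideanLin diracBeta)
    with hB
  refine ⟨∑ j, ‖A j‖ + ‖B‖, by positivity, fun m ξ s => ?_⟩
  have h1 : diracSymbol m ξ s =
      ∑ j : Fin 3, ((2 * Real.pi * ξ j : ℝ) : ℂ) • A j s + (m : ℂ) • B s := by
    simp only [diracSymbol, hA, hB, map_add, map_sum, map_smul, LinearMap.add_apply,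
      LinearMap.sum_apply, LinearMap.smul_apply, LinearMap.coe_toContinuousLinearMap']
  rw [h1, add_mul, Finset.sum_mul]
  have hξ : ∀ j, |2 * Real.pi * ξ j| ≤ freeEnergy m ξ := fun j => by
    refine le_trans ?_ (two_pi_mul_norm_le_freeEnergy m ξ)
    rw [abs_mul, abs_of_pos (by positivity : 0 < 2 * Real.pi)]
    gcongr
    exact PiLp.norm_apply_le ξ j
  refine (norm_add_le _ _).trans (add_le_add ((norm_sum_le _ _).trans
    (Finset.sum_le_sum fun j _ => ?_)) ?_)
  · rw [norm_smul, Complex.norm_real, Real.norm_eq_abs]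
    calc |2 * Real.pi * ξ j| * ‖A j s‖ ≤ freeEnergy m ξ * (‖A j‖ * ‖s‖) :=
          mul_le_mul (hξ j) ((A j).le_opNorm s) (norm_nonneg _) (freeEnergy_nonneg m ξ)
      _ = _ := by ring
  · rw [norm_smul, Complex.norm_real, Real.norm_eq_abs]
    calc |m| * ‖B s‖ ≤ freeEnergy m ξ * (‖B‖ * ‖s‖) :=
          mul_le_mul (abs_le_freeEnergy m ξ) (B.le_opNorm s) (norm_nonneg _) (freeEnergy_nonneg m ξ)
      _ = _ := by ring

/-- The constant of `exists_norm_diracSymbol_le`. -/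
noncomputable def symbolBound : ℝ := exists_norm_diracSymbol_le.choose

theorem symbolBound_nonneg : 0 ≤ symbolBound := exists_norm_diracSymbol_le.choose_spec.1

theorem norm_diracSymbol_le (m : ℝ) (ξ : R3) (s : Spinor) :
    ‖diracSymbol m ξ s‖ ≤ symbolBound * (freeEnergy m ξ * ‖s‖) :=
  exists_norm_diracSymbol_le.choose_spec.2 m ξ s

theorem continuous_diracSymbol (m : ℝ) :
    Continuous fun ξ : R3 => LinearMap.toContinuousLinearMap (diracSymbol m ξ) := by
  have h : (fun ξ : R3 => LinearMap.toContinuousLinearMap (diracSymbol m ξ)) = fun ξ : R3 =>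
      ∑ j : Fin 3, ((2 * Real.pi * ξ j : ℝ) : ℂ) •
        LinearMap.toContinuousLinearMap (Matrix.toEuclideanLin (diracAlpha j)) +
      (m : ℂ) • LinearMap.toContinuousLinearMap (Matrix.toEuclideanLin diracBeta) := by
    funext ξ
    ext1 s
    simp only [diracSymbol, map_add, map_sum, map_smul]
  rw [h]
  have hc : ∀ j : Fin 3, Continuous fun ξ : R3 => ξ j := fun j => by fun_prop
  refine Continuous.add (continuous_finsetSum _ fun j _ => Continuous.fun_smul ?_ continuous_const)
    continuous_const
  exact Complex.continuous_ofReal.comp (continuous_const.mul (hc j))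

theorem stronglyMeasurable_diracSymbol (m : ℝ) (v : Hil) :
    StronglyMeasurable fun ξ => diracSymbol m ξ (v ξ) :=
  (isBoundedBilinearMap_apply (𝕜 := ℂ) (E := Spinor) (F := Spinor)).continuous.comp_stronglyMeasurable
    ((continuous_diracSymbol m).stronglyMeasurable.prodMk (Lp.stronglyMeasurable v))

theorem integrable_freeEnergy {m : ℝ} {u : Hil} (hu : freeAbsForm m u < ∞) :
    Integrable fun ξ => freeEnergy m ξ * ‖fourierL2 u ξ‖ ^ 2 := by
  have hm := measurable_norm_coe (fourierL2 u)
  have hE : Measurable fun ξ : R3 => freeEnergy m ξ := (continuous_freeEnergy m).measurable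
  have h0 : ∀ ξ, 0 ≤ freeEnergy m ξ * ‖fourierL2 u ξ‖ ^ 2 := fun ξ =>
    mul_nonneg (freeEnergy_nonneg m ξ) (by positivity)
  refine ⟨Measurable.aestronglyMeasurable (by fun_prop), ?_⟩
  rw [hasFiniteIntegral_iff_ofReal (ae_of_all _ h0)]
  exact hu

theorem integral_freeEnergy (m : ℝ) (u : Hil) :
    ∫ ξ, freeEnergy m ξ * ‖fourierL2 u ξ‖ ^ 2 = (freeAbsForm m u).toReal := by
  have hm := measurable_norm_coe (fourierL2 u)
  have hE : Measurable fun ξ : R3 => freeEnergy m ξ := (continuous_freeEnergy m).measurable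
  rw [integral_eq_lintegral_of_nonneg_ae (ae_of_all _ fun ξ =>
    mul_nonneg (freeEnergy_nonneg m ξ) (by positivity))
    (Measurable.aestronglyMeasurable (by fun_prop))]
  rfl

theorem integrable_coulomb {m : ℝ} {u : Hil} (hu : freeAbsForm m u < ∞) :
    Integrable fun x => ‖u x‖ ^ 2 * ‖x‖⁻¹ := by
  have hm := measurable_norm_coe u
  refine ⟨Measurable.aestronglyMeasurable (by fun_prop), ?_⟩
  rw [hasFiniteIntegral_iff_ofReal (ae_of_all _ fun x => by positivity)]
  refine lt_of_le_of_lt (le_trans (le_of_eq (lintegral_congr fun x => ?_)) (kato m u 0))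
    (ENNReal.mul_lt_top ENNReal.ofReal_lt_top hu)
  rw [ENNReal.ofReal_mul (by positivity), sub_zero]

theorem integral_coulomb_le {m : ℝ} {u : Hil} (hu : freeAbsForm m u < ∞) :
    ∫ x, ‖u x‖ ^ 2 * ‖x‖⁻¹ ≤ Real.pi / 2 * (freeAbsForm m u).toReal := by
  have hm := measurable_norm_coe u
  rw [integral_eq_lintegral_of_nonneg_ae (ae_of_all _ fun x => by positivity)
    (integrable_coulomb hu).aestronglyMeasurable]
  have h := ENNReal.toReal_mono (ENNReal.mul_lt_top ENNReal.ofReal_lt_top hu).ne (kato m u 0)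
  rw [ENNReal.toReal_mul, ENNReal.toReal_ofReal (by positivity)] at h
  refine le_trans (le_of_eq (congrArg _ (lintegral_congr fun x => ?_))) h
  rw [ENNReal.ofReal_mul (by positivity), sub_zero]

/-! ### The energy in terms of an arbitrary eigensystem -/

/-- The kinetic form density, cut off at `|ξ| ≤ R`. -/
noncomputable def cutDiracForm (α Z m R : ℝ) (u : Hil) : ℝ :=
  (∫ ξ, (((Metric.closedBall (0 : R3) R).indicator (fun _ => (1 : ℝ)) ξ : ℝ) : ℂ) *
    ⟪fourierL2 u ξ, diracSymbol m ξ (fourierL2 u ξ)⟫_ℂ).re -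
    α * Z * ∫ x, ‖u x‖ ^ 2 * min ‖x‖⁻¹ R

theorem stronglyMeasurable_diracInner (m : ℝ) (u v : Hil) :
    StronglyMeasurable fun ξ => ⟪u ξ, diracSymbol m ξ (v ξ)⟫_ℂ :=
  (Lp.stronglyMeasurable u).inner (stronglyMeasurable_diracSymbol m v)

theorem norm_diracInner_le (m : ℝ) (ξ : R3) (s t : Spinor) :
    ‖⟪s, diracSymbol m ξ t⟫_ℂ‖ ≤ symbolBound * (freeEnergy m ξ * (‖s‖ * ‖t‖)) := by
  refine (norm_inner_le_norm _ _).trans ?_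
  calc ‖s‖ * ‖diracSymbol m ξ t‖ ≤ ‖s‖ * (symbolBound * (freeEnergy m ξ * ‖t‖)) := by
        gcongr
        exact norm_diracSymbol_le m ξ t
    _ = _ := by ring

theorem norm_diracInner_self_le (m : ℝ) (ξ : R3) (s : Spinor) :
    ‖⟪s, diracSymbol m ξ s⟫_ℂ‖ ≤ symbolBound * (freeEnergy m ξ * ‖s‖ ^ 2) := by
  rw [sq]
  exact norm_diracInner_le m ξ s s

theorem measurable_cutIndicator (R : ℝ) :
    Measurable fun ξ : R3 => (Metric.closedBall (0 : R3) R).indicator (fun _ => (1 : ℝ)) ξ :=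
  measurable_const.indicator Metric.isClosed_closedBall.measurableSet

theorem cutIndicator_nonneg (R : ℝ) (ξ : R3) :
    0 ≤ (Metric.closedBall (0 : R3) R).indicator (fun _ => (1 : ℝ)) ξ :=
  indicator_nonneg (fun _ _ => zero_le_one) _

theorem cutIndicator_le (R : ℝ) (ξ : R3) :
    (Metric.closedBall (0 : R3) R).indicator (fun _ => (1 : ℝ)) ξ ≤ 1 :=
  indicator_le_self' (fun _ _ => zero_le_one) ξ

theorem norm_cutIndicator_mul_le (R : ℝ) (ξ : R3) (z : ℂ) :
    ‖(((Metric.closedBall (0 : R3) R).indicator (fun _ => (1 : ℝ)) ξ : ℝ) : ℂ) * z‖ ≤ ‖z‖ := by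
  rw [norm_mul, Complex.norm_real, Real.norm_of_nonneg (cutIndicator_nonneg R ξ)]
  exact mul_le_of_le_one_left (norm_nonneg _) (cutIndicator_le R ξ)

theorem exists_cutDiracOperator (α Z m : ℝ) {R : ℝ} (hR : 0 ≤ R) :
    ∃ M : Hil →L[ℂ] Hil, ∀ u, (⟪u, M u⟫_ℂ).re = cutDiracForm α Z m R u := by
  set χ : R3 → ℝ := fun ξ => (Metric.closedBall (0 : R3) R).indicator (fun _ => (1 : ℝ)) ξ with hχ
  obtain ⟨A, hA⟩ := exists_mulOperator
    (M := fun ξ => (χ ξ : ℂ) • LinearMap.toContinuousLinearMap (diracSymbol m ξ))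
    ((Complex.measurable_ofReal.comp (measurable_cutIndicator R)).aestronglyMeasurable.smul
      (continuous_diracSymbol m).aestronglyMeasurable)
    (C := symbolBound * √((2 * Real.pi * R) ^ 2 + m ^ 2)) (fun ξ => by
      have h0 := symbolBound_nonneg
      refine ContinuousLinearMap.opNorm_le_bound _ (by positivity) fun s => ?_
      rw [smul_apply, norm_smul, Complex.norm_real]
      by_cases hξ : ξ ∈ Metric.closedBall (0 : R3) R
      · simp only [hχ, indicator_of_mem hξ, norm_one, one_mul]
        refine (norm_diracSymbol_le m ξ s).trans ?_
        rw [mem_closedBall_zero_iff] at hξ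
        rw [← mul_assoc, freeEnergy]
        gcongr
      · simp only [hχ, indicator_of_notMem hξ, norm_zero, zero_mul]
        positivity)
  have hg : Measurable fun x : R3 => ((min ‖x‖⁻¹ R : ℝ) : ℂ) :=
    Complex.measurable_ofReal.comp (by fun_prop)
  obtain ⟨N, hN⟩ := exists_scalarMulOperator hg.aestronglyMeasurable (C := R) fun x => by
    rw [Complex.norm_real, Real.norm_of_nonneg (le_min (by positivity) hR)]
    exact min_le_right _ _
  set F : Hil →L[ℂ] Hil := (fourierL2.toContinuousLinearEquiv : Hil →L[ℂ] Hil) with hF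
  refine ⟨(ContinuousLinearMap.adjoint F).comp (A.comp F) - ((α * Z : ℝ) : ℂ) • N, fun u => ?_⟩
  rw [sub_apply, smul_apply, inner_sub_right, inner_smul_right, ContinuousLinearMap.comp_apply,
    ContinuousLinearMap.adjoint_inner_right, ContinuousLinearMap.comp_apply, Complex.sub_re,
    Complex.re_ofReal_mul, cutDiracForm]
  refine congrArg₂ (· - ·) ?_ (congrArg _ ?_)
  · rw [show F u = fourierL2 u from rfl, L2.inner_def]
    refine congrArg Complex.re (integral_congr_ae ?_)
    filter_upwards [hA (fourierL2 u)] with ξ hξ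
    rw [hξ, smul_apply, inner_smul_right]
    rfl
  · rw [L2.inner_def, ← Complex.ofReal_re (∫ x, ‖u x‖ ^ 2 * min ‖x‖⁻¹ R), ← integral_complex_ofReal]
    refine congrArg Complex.re (integral_congr_ae ?_)
    filter_upwards [hN u] with x hx
    rw [hx, inner_smul_right, inner_self_eq_norm_sq_to_K]
    push_cast
    exact mul_comm _ _

theorem integrable_diracInner {m : ℝ} {u : Hil} (hu : freeAbsForm m u < ∞) :
    Integrable fun ξ => ⟪fourierL2 u ξ, diracSymbol m ξ (fourierL2 u ξ)⟫_ℂ :=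
  ((integrable_freeEnergy hu).const_mul symbolBound).mono'
    (stronglyMeasurable_diracInner m _ _).aestronglyMeasurable
    (ae_of_all _ fun ξ => norm_diracInner_self_le m ξ _)

theorem abs_cutDiracForm_le (α Z m : ℝ) {R : ℝ} (hR : 0 ≤ R) {u : Hil}
    (hu : freeAbsForm m u < ∞) :
    |cutDiracForm α Z m R u| ≤
      (symbolBound + |α * Z| * (Real.pi / 2)) * (freeAbsForm m u).toReal := by
  unfold cutDiracForm
  refine (abs_sub _ _).trans ?_
  rw [add_mul]
  refine add_le_add ?_ ?_
  · refine (Complex.abs_re_le_norm _).trans ?_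
    rw [← integral_freeEnergy, ← integral_const_mul]
    refine norm_integral_le_of_norm_le ((integrable_freeEnergy hu).const_mul _)
      (ae_of_all _ fun ξ => ?_)
    exact (norm_cutIndicator_mul_le R ξ _).trans (norm_diracInner_self_le m ξ _)
  · rw [abs_mul, mul_assoc]
    refine mul_le_mul_of_nonneg_left ?_ (abs_nonneg _)
    rw [abs_of_nonneg (integral_nonneg fun x =>
      mul_nonneg (by positivity) (le_min (by positivity) hR))]
    refine le_trans (integral_mono_of_nonneg (ae_of_all _ fun x =>
      mul_nonneg (by positivity) (le_min (by positivity) hR)) (integrable_coulomb hu)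
      (ae_of_all _ fun x => ?_)) (integral_coulomb_le hu)
    exact mul_le_mul_of_nonneg_left (min_le_left _ _) (by positivity)

theorem tendsto_cutDiracForm (α Z : ℝ) {m : ℝ} {u : Hil} (hu : freeAbsForm m u < ∞) :
    Tendsto (fun R : ℕ => cutDiracForm α Z m R u) atTop (𝓝 (coulombDiracForm α Z m u)) := by
  have hum := measurable_norm_coe u
  unfold cutDiracForm coulombDiracForm
  refine Tendsto.sub ?_ (Tendsto.const_mul _ ?_)
  · refine (Complex.continuous_re.tendsto _).comp (tendsto_integral_of_dominated_convergence
      (fun ξ => ‖⟪fourierL2 u ξ, diracSymbol m ξ (fourierL2 u ξ)⟫_ℂ‖) (fun R => ?_)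
      (integrable_diracInner hu).norm (fun R => ae_of_all _ fun ξ =>
        norm_cutIndicator_mul_le R ξ _) (ae_of_all _ fun ξ => tendsto_const_nhds.congr' ?_))
    · exact (Complex.measurable_ofReal.comp (measurable_cutIndicator R)).aestronglyMeasurable.mul
        (stronglyMeasurable_diracInner m _ _).aestronglyMeasurable
    · obtain ⟨N, hN⟩ := exists_nat_ge ‖ξ‖
      filter_upwards [eventually_ge_atTop N] with R hR
      have hmem : ξ ∈ Metric.closedBall (0 : R3) R := by
        rw [mem_closedBall_zero_iff]
        exact hN.trans (by exact_mod_cast hR)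
      rw [indicator_of_mem hmem, Complex.ofReal_one, one_mul]
  · refine tendsto_integral_of_dominated_convergence (fun x => ‖u x‖ ^ 2 * ‖x‖⁻¹)
      (fun R => Measurable.aestronglyMeasurable (by fun_prop)) (integrable_coulomb hu)
      (fun R => ae_of_all _ fun x => ?_) (ae_of_all _ fun x => tendsto_const_nhds.congr' ?_)
    · have h0 : 0 ≤ min ‖x‖⁻¹ (R : ℝ) := le_min (by positivity) (by positivity)
      rw [Real.norm_of_nonneg (by positivity)]
      exact mul_le_mul_of_nonneg_left (min_le_left _ _) (by positivity)
    · obtain ⟨N, hN⟩ := exists_nat_ge ‖x‖⁻¹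
      filter_upwards [eventually_ge_atTop N] with R hR
      rw [min_eq_left (hN.trans (by exact_mod_cast hR)), div_eq_mul_inv]

theorem abs_coulombDiracForm_le (α Z : ℝ) {m : ℝ} {u : Hil} (hu : freeAbsForm m u < ∞) :
    |coulombDiracForm α Z m u| ≤
      (symbolBound + |α * Z| * (Real.pi / 2)) * (freeAbsForm m u).toReal :=
  le_of_tendsto (tendsto_cutDiracForm α Z hu).abs
    (Eventually.of_forall fun R => abs_cutDiracForm_le α Z m (Nat.cast_nonneg R) hu)

/-- Dominated convergence: the truncated forms are bounded by a multiple of the kinetic form,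
uniformly in `R`. -/
theorem FiniteKinetic.tendsto_tsum_cut (α Z : ℝ) {m : ℝ} {l : ℕ → ℝ} {ξ : ℕ → Hil}
    (h : FiniteKinetic m l ξ) :
    Tendsto (fun R : ℕ => ∑' n, l n * cutDiracForm α Z m R (ξ n)) atTop
      (𝓝 (∑' n, l n * coulombDiracForm α Z m (ξ n))) := by
  refine tendsto_tsum_of_dominated_convergence
    (h.summable_mul.mul_left (symbolBound + |α * Z| * (Real.pi / 2))) (fun n => ?_)
    (Eventually.of_forall fun R n => ?_)
  · by_cases hn : l n = 0
    · simp [hn]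
    · exact (tendsto_cutDiracForm α Z (h.lt_top hn)).const_mul _
  · by_cases hn : l n = 0
    · simp [hn]
    · rw [norm_mul, Real.norm_eq_abs, Real.norm_eq_abs]
      calc |l n| * |cutDiracForm α Z m R (ξ n)| ≤ |l n| * _ :=
            mul_le_mul_of_nonneg_left
              (abs_cutDiracForm_le α Z m (Nat.cast_nonneg R) (h.lt_top hn)) (abs_nonneg _)
        _ = _ := by ring

theorem FiniteKinetic.summable_coulombDiracForm (α Z : ℝ) {m : ℝ} {l : ℕ → ℝ} {ξ : ℕ → Hil}
    (h : FiniteKinetic m l ξ) : Summable fun n => l n * coulombDiracForm α Z m (ξ n) := by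
  refine Summable.of_norm_bounded
    (h.summable_mul.mul_left (symbolBound + |α * Z| * (Real.pi / 2))) fun n => ?_
  by_cases hn : l n = 0
  · simp [hn]
  · rw [norm_mul, Real.norm_eq_abs, Real.norm_eq_abs]
    calc |l n| * |coulombDiracForm α Z m (ξ n)| ≤ |l n| * _ :=
          mul_le_mul_of_nonneg_left (abs_coulombDiracForm_le α Z (h.lt_top hn)) (abs_nonneg _)
      _ = _ := by ring

theorem tsum_re_inner_eigenbasis_eq {ξ η : HilbertBasis ℕ ℂ Hil} {T : Hil →L[ℂ] Hil}
    {l k : ℕ → ℝ} (hξ : IsEigensystem T l ξ) (hη : IsEigensystem T k η)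
    (hl : Summable l) (hk : Summable k) (M : Hil →L[ℂ] Hil) :
    ∑' n, k n * (⟪η n, M (η n)⟫_ℂ).re = ∑' n, l n * (⟪ξ n, M (ξ n)⟫_ℂ).re := by
  have h : ∀ (ξ : HilbertBasis ℕ ℂ Hil) (l : ℕ → ℝ), IsEigensystem T l ξ → Summable l →
      ∑' n, l n * (⟪ξ n, M (ξ n)⟫_ℂ).re = (∑' n, (l n : ℂ) * ⟪ξ n, M (ξ n)⟫_ℂ).re := by
    intro ξ l hξ hl
    have h1 := hasSum_trace ξ ξ hξ hl M
    have h2 := Complex.hasSum_re h1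
    rw [← h2.tsum_eq]
    refine tsum_congr fun n => ?_
    rw [hξ, map_smul, inner_smul_right, Complex.re_ofReal_mul]
  rw [h ξ l hξ hl, h η k hη hk, tsum_inner_eigenbasis_eq ξ η hξ hη hl M]

/-- For each cutoff the sum is the trace of a bounded operator times `T`, which does not depend on
the eigenbasis; the cutoff is then removed. -/
theorem tsum_coulombDiracForm_eq (α Z : ℝ) {m : ℝ} (hm : 0 < m) {ξ η : HilbertBasis ℕ ℂ Hil}
    {T : Hil →L[ℂ] Hil} {l k : ℕ → ℝ} (hξ : IsEigensystem T l ξ) (hη : IsEigensystem T k η)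
    (hl : FiniteKinetic m l ξ) (hk : FiniteKinetic m k η) :
    ∑' n, k n * coulombDiracForm α Z m (η n) = ∑' n, l n * coulombDiracForm α Z m (ξ n) := by
  refine tendsto_nhds_unique (hk.tendsto_tsum_cut α Z)
    ((hl.tendsto_tsum_cut α Z).congr fun R => ?_)
  obtain ⟨M, hM⟩ := exists_cutDiracOperator α Z m (Nat.cast_nonneg (α := ℝ) R)
  simp only [← hM]
  exact (tsum_re_inner_eigenbasis_eq hξ hη (hl.summable hm ξ.orthonormal.1)
    (hk.summable hm η.orthonormal.1) M).symm

theorem tsum_pairTerm_eq {m : ℝ} (hm : 0 < m) {ξ η : HilbertBasis ℕ ℂ Hil}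
    {T : Hil →L[ℂ] Hil} {l k : ℕ → ℝ} (hξ : IsEigensystem T l ξ) (hη : IsEigensystem T k η)
    (hl : FiniteKinetic m l ξ) (hk : FiniteKinetic m k η) {u : Hil} (hu : freeAbsForm m u < ∞) :
    ∑' n, k n * pairTerm u (η n) = ∑' n, l n * pairTerm u (ξ n) := by
  obtain ⟨M, hM⟩ := exists_pairOperator hu
  simp only [← hM]
  exact tsum_re_inner_eigenbasis_eq hξ hη (hl.summable hm ξ.orthonormal.1)
    (hk.summable hm η.orthonormal.1) M

theorem FiniteKinetic.summable_pairTerm {m : ℝ} (hm : 0 < m) {k l : ℕ → ℝ}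
    {η ξ : HilbertBasis ℕ ℂ Hil} (hk : FiniteKinetic m k η) (hl : FiniteKinetic m l ξ) :
    Summable fun p : ℕ × ℕ => k p.1 * l p.2 * pairTerm (η p.1) (ξ p.2) :=
  FiniteKinetic.summable_pair (hk.summable_abs hm η.orthonormal.1) η.orthonormal.1 hl
    (C := Real.pi / 4) (by positivity) abs_pairTerm_le

/-- The eigenbases are exchanged in one variable at a time, with the orbital in the other variable
held fixed; symmetry of `pairTerm` links the two halves. -/
theorem tsum_tsum_pairTerm_eq {m : ℝ} (hm : 0 < m) {ξ η : HilbertBasis ℕ ℂ Hil}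
    {T : Hil →L[ℂ] Hil} {l k : ℕ → ℝ} (hξ : IsEigensystem T l ξ) (hη : IsEigensystem T k η)
    (hl : FiniteKinetic m l ξ) (hk : FiniteKinetic m k η) :
    ∑' p : ℕ × ℕ, k p.1 * k p.2 * pairTerm (η p.1) (η p.2) =
      ∑' p : ℕ × ℕ, l p.1 * l p.2 * pairTerm (ξ p.1) (ξ p.2) := by
  have h1 : ∀ (ζ : HilbertBasis ℕ ℂ Hil) (j : ℕ → ℝ), FiniteKinetic m j ζ → ∀ i,
      ∑' n, j i * k n * pairTerm (ζ i) (η n) = ∑' n, j i * l n * pairTerm (ζ i) (ξ n) := by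
    intro ζ j hj i
    by_cases hi : j i = 0
    · simp [hi]
    · simp only [mul_assoc]
      rw [tsum_mul_left, tsum_mul_left, tsum_pairTerm_eq hm hξ hη hl hk (hj.lt_top hi)]
  rw [(hk.summable_pairTerm hm hk).tsum_prod, (hl.summable_pairTerm hm hl).tsum_prod]
  simp only [h1 η k hk, ← h1 ξ l hl]
  have h2 : Summable (Function.uncurry fun i n => k i * l n * pairTerm (η i) (ξ n)) :=
    hk.summable_pairTerm hm hl
  refine h2.tsum_comm.symm.trans ?_
  refine tsum_congr fun n => tsum_congr fun i => ?_
  rw [pairTerm_comm]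
  ring

/-- The Hartree-Fock energy computed from any basis of eigenvectors. -/
theorem energy_eq (α Z : ℝ) {m : ℝ} (hm : 0 < m) {ξ : HilbertBasis ℕ ℂ Hil}
    {T : Hil →L[ℂ] Hil} {l : ℕ → ℝ} (hξ : IsEigensystem T l ξ) (hl : FiniteKinetic m l ξ) :
    T ∈ spaceF m ∧ energy α Z m T = ∑' n, l n * coulombDiracForm α Z m (ξ n) +
      α * ∑' p : ℕ × ℕ, l p.1 * l p.2 * pairTerm (ξ p.1) (ξ p.2) := by
  have hT : T ∈ spaceF m :=
    ⟨ContinuousLinearMap.isSelfAdjoint_iff_isSymmetric.2 (isSymmetric_of_eigenbasis ξ hξ), by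
      rw [normF_eq hξ]; exact hl⟩
  refine ⟨hT, ?_⟩
  -- The basis chosen by `eigenvector T` may differ from `ξ` inside degenerate eigenspaces, so the
  -- energy, defined by the former, must be transported to the latter.
  obtain ⟨η, hη, hk⟩ := exists_eigenvector_basis hm hT
  have hkf : FiniteKinetic m (eigenvalue T) η := by
    have := hT.2
    rwa [normF_eq hk] at this
  have h1 := hasSum_interaction hm (hη ▸ hkf) fun n => by rw [hη]; exact η.orthonormal.1 n
  rw [energy, oneParticleEnergy, ← h1.tsum_eq, hη, tsum_coulombDiracForm_eq α Z hm hξ hk hl hkf,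
    tsum_tsum_pairTerm_eq hm hξ hk hl hkf]

/-! ### The mean-field potential -/

theorem measurable_density (T : Hil →L[ℂ] Hil) : Measurable (density T) := by
  refine Finset.measurable_fun_sum _ fun s _ => Measurable.tsum fun n => ?_
  have := measurable_coe_apply (eigenvector T n) s
  fun_prop

theorem stronglyMeasurable_electricPotential (T : Hil →L[ℂ] Hil) :
    StronglyMeasurable (electricPotential T) := by
  have h := measurable_density T
  refine StronglyMeasurable.integral_prod_right
    (f := fun x y : R3 => density T y / ‖x - y‖) (Measurable.stronglyMeasurable ?_)
  exact (h.comp measurable_snd).fun_div (measurable_fst.sub measurable_snd).norm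

theorem FiniteKinetic.integrable_weight {m : ℝ} {u : Hil} (hu : freeAbsForm m u < ∞) (x : R3) :
    Integrable fun y => ‖u y‖ ^ 2 * ‖x - y‖⁻¹ := by
  have hm := measurable_norm_coe u
  refine ⟨Measurable.aestronglyMeasurable (by fun_prop), ?_⟩
  rw [hasFiniteIntegral_iff_ofReal (ae_of_all _ fun y => by positivity)]
  refine lt_of_le_of_lt (le_trans (le_of_eq (lintegral_congr fun y => ?_)) (kato m u x))
    (ENNReal.mul_lt_top ENNReal.ofReal_lt_top hu)
  rw [ENNReal.ofReal_mul (by positivity), norm_sub_rev]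

theorem FiniteKinetic.integral_weight_le {m : ℝ} {u : Hil} (hu : freeAbsForm m u < ∞) (x : R3) :
    ∫ y, ‖u y‖ ^ 2 * ‖x - y‖⁻¹ ≤ Real.pi / 2 * (freeAbsForm m u).toReal := by
  rw [integral_eq_lintegral_of_nonneg_ae (ae_of_all _ fun y => by positivity)
    (FiniteKinetic.integrable_weight hu x).aestronglyMeasurable]
  have h := ENNReal.toReal_mono (ENNReal.mul_lt_top ENNReal.ofReal_lt_top hu).ne (kato m u x)
  rw [ENNReal.toReal_mul, ENNReal.toReal_ofReal (by positivity)] at h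
  refine le_trans (le_of_eq (congrArg _ (lintegral_congr fun y => ?_))) h
  rw [ENNReal.ofReal_mul (by positivity), norm_sub_rev]

theorem FiniteKinetic.integrable_mul_weight {m : ℝ} {k : ℕ → ℝ} {η : ℕ → Hil}
    (h : FiniteKinetic m k η) (x : R3) (n : ℕ) :
    Integrable fun y => k n * (‖η n y‖ ^ 2 * ‖x - y‖⁻¹) := by
  by_cases hn : k n = 0
  · simp [hn]
  · exact (FiniteKinetic.integrable_weight (h.lt_top hn) x).const_mul _

theorem FiniteKinetic.integral_norm_mul_weight_le {m : ℝ} {k : ℕ → ℝ} {η : ℕ → Hil}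
    (h : FiniteKinetic m k η) (x : R3) (n : ℕ) :
    ∫ y, ‖k n * (‖η n y‖ ^ 2 * ‖x - y‖⁻¹)‖ ≤
      Real.pi / 2 * (|k n| * (freeAbsForm m (η n)).toReal) := by
  by_cases hn : k n = 0
  · simp [hn]
  · have h1 : ∀ y, ‖k n * (‖η n y‖ ^ 2 * ‖x - y‖⁻¹)‖ = |k n| * (‖η n y‖ ^ 2 * ‖x - y‖⁻¹) := by
      intro y
      rw [norm_mul, Real.norm_eq_abs, Real.norm_of_nonneg (by positivity)]
    simp only [h1]
    rw [integral_const_mul]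
    have := FiniteKinetic.integral_weight_le (h.lt_top hn) x
    nlinarith [abs_nonneg (k n)]

theorem FiniteKinetic.summable_integral_weight {m : ℝ} {k : ℕ → ℝ} {η : ℕ → Hil}
    (h : FiniteKinetic m k η) (x : R3) :
    Summable fun n => ∫ y, ‖k n * (‖η n y‖ ^ 2 * ‖x - y‖⁻¹)‖ :=
  Summable.of_nonneg_of_le (fun n => integral_nonneg fun y => norm_nonneg _)
    (fun n => h.integral_norm_mul_weight_le x n) (h.summable_mul.mul_left _)

section

variable {m : ℝ} {δ : Hil →L[ℂ] Hil}

theorem hasSum_electricPotential (hm : 0 < m)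
    (hδ : FiniteKinetic m (eigenvalue δ) (eigenvector δ)) (hη : ∀ n, ‖eigenvector δ n‖ = 1)
    (x : R3) : HasSum (fun n => ∫ y, eigenvalue δ n * (‖eigenvector δ n y‖ ^ 2 * ‖x - y‖⁻¹))
      (electricPotential δ x) := by
  have h := hasSum_integral_of_summable_integral_norm (hδ.integrable_mul_weight x)
    (hδ.summable_integral_weight x)
  suffices h2 : (fun y => ∑' n, eigenvalue δ n * (‖eigenvector δ n y‖ ^ 2 * ‖x - y‖⁻¹)) =ᵐ[volume]
      fun y => density δ y / ‖x - y‖ by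
    rwa [integral_congr_ae h2] at h
  filter_upwards [ae_summable_norm_sq (hδ.summable_abs hm hη) hη] with y hy
  have h1 := (sum_tsum_component hy).mul_right ‖x - y‖⁻¹
  rw [← div_eq_mul_inv] at h1
  refine Eq.trans (tsum_congr fun n => ?_) h1.tsum_eq
  ring

theorem abs_electricPotential_le (hm : 0 < m)
    (hδ : FiniteKinetic m (eigenvalue δ) (eigenvector δ)) (hη : ∀ n, ‖eigenvector δ n‖ = 1)
    (x : R3) : |electricPotential δ x| ≤ Real.pi / 2 *
      ∑' n, |eigenvalue δ n| * (freeAbsForm m (eigenvector δ n)).toReal := by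
  have h := hasSum_electricPotential hm hδ hη x
  rw [← h.tsum_eq, ← tsum_mul_left, ← Real.norm_eq_abs]
  refine tsum_of_norm_bounded (hδ.summable_mul.mul_left _).hasSum fun n => ?_
  exact le_trans (norm_integral_le_integral_norm _) (hδ.integral_norm_mul_weight_le x n)

/-- The factor `2` cancels the `1/2` built into `directTerm`; the sum and the double integral are
exchanged by absolute convergence, with the kinetic energy charged to `u`. -/
theorem hasSum_potential_energy (hm : 0 < m)
    (hδ : FiniteKinetic m (eigenvalue δ) (eigenvector δ)) (hη : ∀ n, ‖eigenvector δ n‖ = 1)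
    {u : Hil} (hu : freeAbsForm m u < ∞) :
    HasSum (fun n => 2 * (eigenvalue δ n * directTerm u (eigenvector δ n)))
      (∫ x, electricPotential δ x * ‖u x‖ ^ 2) := by
  set k := eigenvalue δ with hk
  set η := eigenvector δ with hηd
  set F : ℕ → R3 × R3 → ℝ := fun n z =>
    k n * (‖u z.1‖ ^ 2 * ‖η n z.2‖ ^ 2 * ‖z.1 - z.2‖⁻¹) with hF
  have hFi : ∀ n, Integrable (F n) := fun n => (integrable_direct_swap (η n) hu).const_mul _
  have hFv : ∀ n, ∫ z, ‖F n z‖ = 2 * (|k n| * directTerm u (η n)) := by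
    intro n
    have h1 : ∀ z, ‖F n z‖ = |k n| * (‖u z.1‖ ^ 2 * ‖η n z.2‖ ^ 2 * ‖z.1 - z.2‖⁻¹) := by
      intro z
      rw [norm_mul, Real.norm_eq_abs, Real.norm_of_nonneg
        (by positivity : 0 ≤ ‖u z.1‖ ^ 2 * ‖η n z.2‖ ^ 2 * ‖z.1 - z.2‖⁻¹)]
    simp only [h1]
    rw [integral_const_mul, directTerm]
    ring
  have hFs : Summable fun n => ∫ z, ‖F n z‖ := by
    simp only [hFv]
    refine (Summable.of_nonneg_of_le (fun n => mul_nonneg (abs_nonneg _) (directTerm_nonneg _ _))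
      (fun n => ?_) ((hδ.summable_abs hm hη).mul_right
        (Real.pi / 4 * (freeAbsForm m u).toReal))).mul_left 2
    refine mul_le_mul_of_nonneg_left ?_ (abs_nonneg _)
    rw [directTerm_comm]
    refine (directTerm_le (η n) hu).trans (le_of_eq ?_)
    rw [hη, one_pow, one_mul]
  have hpt : (fun z : R3 × R3 => ∑' n, F n z) =ᵐ[volume]
      fun z => density δ z.2 / ‖z.1 - z.2‖ * ‖u z.1‖ ^ 2 := by
    filter_upwards [ae_fst_and_snd (ae_summable_norm_sq (hδ.summable_abs hm hη) hη)] with z hz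
    have h1 := (sum_tsum_component hz.2).mul_right (‖z.1 - z.2‖⁻¹ * ‖u z.1‖ ^ 2)
    rw [div_eq_mul_inv, mul_assoc]
    refine Eq.trans (tsum_congr fun n => ?_) h1.tsum_eq
    simp only [hF]
    ring
  have h4 := hasSum_integral_of_summable_integral_norm hFi hFs
  have h5 := (integrable_tsum_of_summable hFi hFs).congr hpt
  have h6 := (integral_congr_ae hpt).trans (integral_prod _ h5)
  rw [h6] at h4
  simp only [integral_mul_const] at h4
  refine h4.congr_fun fun n => ?_
  simp only [hF]
  rw [integral_const_mul, directTerm]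
  ring

/-- The contribution of one orbital to the exchange potential applied to `u`. -/
noncomputable def orbitalOverlap (η u : Hil) (x : R3) : ℂ :=
  ∫ y, ⟪η y, u y⟫_ℂ * ((‖x - y‖⁻¹ : ℝ) : ℂ)

/-- Each term is dominated by a sum of two parts: one integrable through the kinetic energy of `ηₙ`,
the other through that of `u`, with a weight `|kₙ| |ηₙ(x)|²` summable at the given `x`. -/
theorem hasSum_exchange_apply (hm : 0 < m)
    (hδ : FiniteKinetic m (eigenvalue δ) (eigenvector δ)) (hη : ∀ n, ‖eigenvector δ n‖ = 1)
    {u : Hil} (hu : freeAbsForm m u < ∞) {x : R3}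
    (hx : Summable fun n => |eigenvalue δ n| * ‖eigenvector δ n x‖ ^ 2) (s : Fin 4) :
    HasSum (fun n => (eigenvalue δ n : ℂ) * eigenvector δ n x s *
        orbitalOverlap (eigenvector δ n) u x)
      (∫ y, (∑ t : Fin 4, kernel δ x y s t * u y t) / (‖x - y‖ : ℂ)) := by
  set k := eigenvalue δ with hk
  set η := eigenvector δ with hηd
  have hwm : Measurable fun y : R3 => ((‖x - y‖⁻¹ : ℝ) : ℂ) :=
    Complex.measurable_ofReal.comp (by fun_prop)
  set F : ℕ → R3 → ℂ := fun n y =>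
    (k n : ℂ) * η n x s * (⟪η n y, u y⟫_ℂ * ((‖x - y‖⁻¹ : ℝ) : ℂ)) with hF
  have hFm : ∀ n, AEStronglyMeasurable (F n) volume := fun n =>
    ((stronglyMeasurable_inner (η n) u).aestronglyMeasurable.mul
      hwm.aestronglyMeasurable).const_mul _
  have hb : ∀ n y, ‖F n y‖ ≤ ‖k n * (‖η n y‖ ^ 2 * ‖x - y‖⁻¹)‖ +
      |k n| * ‖η n x‖ ^ 2 * (‖u y‖ ^ 2 * ‖x - y‖⁻¹) := by
    intro n y
    have h1 := PiLp.norm_apply_le (η n x) s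
    have h2 := norm_inner_le_norm (𝕜 := ℂ) (η n y) (u y)
    have h3 : ‖k n * (‖η n y‖ ^ 2 * ‖x - y‖⁻¹)‖ = |k n| * (‖η n y‖ ^ 2 * ‖x - y‖⁻¹) := by
      rw [norm_mul, Real.norm_eq_abs, Real.norm_of_nonneg
        (by positivity : 0 ≤ ‖η n y‖ ^ 2 * ‖x - y‖⁻¹)]
    rw [h3]
    simp only [hF, norm_mul, Complex.norm_real, Real.norm_eq_abs, abs_inv, abs_norm]
    calc |k n| * ‖η n x s‖ * (‖⟪η n y, u y⟫_ℂ‖ * ‖x - y‖⁻¹)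
        ≤ |k n| * ‖η n x‖ * ((‖η n y‖ * ‖u y‖) * ‖x - y‖⁻¹) := by gcongr
      _ = |k n| * ‖x - y‖⁻¹ * (‖η n y‖ * (‖η n x‖ * ‖u y‖)) := by ring
      _ ≤ |k n| * ‖x - y‖⁻¹ * (‖η n y‖ ^ 2 + (‖η n x‖ * ‖u y‖) ^ 2) := by
          refine mul_le_mul_of_nonneg_left ?_ (by positivity)
          nlinarith [sq_nonneg (‖η n y‖ - ‖η n x‖ * ‖u y‖), sq_nonneg ‖η n y‖,
            sq_nonneg (‖η n x‖ * ‖u y‖)]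
      _ = _ := by ring
  have hbi : ∀ n, Integrable fun y => ‖k n * (‖η n y‖ ^ 2 * ‖x - y‖⁻¹)‖ +
      |k n| * ‖η n x‖ ^ 2 * (‖u y‖ ^ 2 * ‖x - y‖⁻¹) := fun n =>
    (hδ.integrable_mul_weight x n).norm.add
      ((FiniteKinetic.integrable_weight hu x).const_mul _)
  have hFi : ∀ n, Integrable (F n) := fun n => (hbi n).mono' (hFm n) (ae_of_all _ (hb n))
  have hFs : Summable fun n => ∫ y, ‖F n y‖ := by
    refine Summable.of_nonneg_of_le (fun n => integral_nonneg fun y => norm_nonneg _)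
      (fun n => integral_mono (hFi n).norm (hbi n) (hb n)) ?_
    have h1 : ∀ n, ∫ y, (‖k n * (‖η n y‖ ^ 2 * ‖x - y‖⁻¹)‖ +
        |k n| * ‖η n x‖ ^ 2 * (‖u y‖ ^ 2 * ‖x - y‖⁻¹)) =
        (∫ y, ‖k n * (‖η n y‖ ^ 2 * ‖x - y‖⁻¹)‖) +
        |k n| * ‖η n x‖ ^ 2 * ∫ y, ‖u y‖ ^ 2 * ‖x - y‖⁻¹ := fun n => by
      rw [integral_add (hδ.integrable_mul_weight x n).norm
        ((FiniteKinetic.integrable_weight hu x).const_mul _), integral_const_mul]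
    simp only [h1]
    exact (hδ.summable_integral_weight x).add (hx.mul_right _)
  have hpt : (fun y => ∑' n, F n y) =ᵐ[volume] fun y =>
      (∑ t : Fin 4, kernel δ x y s t * u y t) / (‖x - y‖ : ℂ) := by
    filter_upwards [ae_summable_norm_sq (hδ.summable_abs hm hη) hη] with y hy
    have h1 : ∀ t, Summable fun n => (k n : ℂ) * η n x s * star (η n y t) := by
      intro t
      refine Summable.of_norm_bounded (hx.add hy) fun n => ?_
      rw [norm_mul, norm_mul, Complex.norm_real, Real.norm_eq_abs, norm_star, ← mul_add, mul_assoc]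
      refine mul_le_mul_of_nonneg_left ?_ (abs_nonneg _)
      have h2 := PiLp.norm_apply_le (η n x) s
      have h3 := PiLp.norm_apply_le (η n y) t
      calc ‖η n x s‖ * ‖η n y t‖ ≤ ‖η n x‖ * ‖η n y‖ := by gcongr
        _ ≤ _ := by nlinarith [sq_nonneg (‖η n x‖ - ‖η n y‖), sq_nonneg ‖η n x‖, sq_nonneg ‖η n y‖]
    have h4 : HasSum (fun n => ∑ t : Fin 4, (k n : ℂ) * η n x s * star (η n y t) * u y t)
        (∑ t : Fin 4, kernel δ x y s t * u y t) :=
      hasSum_sum fun t _ => (h1 t).hasSum.mul_right (u y t)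
    have h5 := h4.mul_right (((‖x - y‖ : ℝ) : ℂ)⁻¹)
    rw [div_eq_mul_inv]
    refine Eq.trans (tsum_congr fun n => ?_) h5.tsum_eq
    simp only [hF]
    rw [PiLp.inner_apply, Complex.ofReal_inv, ← mul_assoc, Finset.mul_sum]
    congr 1
    refine Finset.sum_congr rfl fun t _ => ?_
    rw [RCLike.inner_apply, Complex.star_def]
    ring
  have h4 := hasSum_integral_of_summable_integral_norm hFi hFs
  rw [integral_congr_ae hpt] at h4
  refine h4.congr_fun fun n => ?_
  simp only [hF, orbitalOverlap]
  rw [integral_const_mul]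

theorem hasSum_exchange_energy (hm : 0 < m)
    (hδ : FiniteKinetic m (eigenvalue δ) (eigenvector δ)) (hη : ∀ n, ‖eigenvector δ n‖ = 1)
    {u : Hil} (hu : freeAbsForm m u < ∞) {X : Hil →L[ℂ] Hil}
    (hX : ∀ᵐ x, ∀ s : Fin 4,
      X u x s = ∫ y, (∑ t : Fin 4, kernel δ x y s t * u y t) / (‖x - y‖ : ℂ)) :
    HasSum (fun n => 2 * (eigenvalue δ n * exchangeTerm u (eigenvector δ n)))
      (⟪u, X u⟫_ℂ).re := by
  set k := eigenvalue δ with hk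
  set η := eigenvector δ with hηd
  have hex : ∀ n, Integrable fun z : R3 × R3 =>
      ⟪u z.1, η n z.1⟫_ℂ * ⟪η n z.2, u z.2⟫_ℂ * ((‖z.1 - z.2‖⁻¹ : ℝ) : ℂ) := by
    intro n
    refine ((integrable_direct (η n) hu).add (integrable_direct_swap (η n) hu)).mono'
      (measurable_exchange u (η n) (η n) u) (ae_of_all _ fun z => ?_)
    refine (norm_exchange_le _ _ _ _ (by positivity)).trans (le_of_eq ?_)
    simp only [Pi.add_apply]
    ring
  have hbound : ∀ n, ∫ z : R3 × R3,
      ‖⟪u z.1, η n z.1⟫_ℂ * ⟪η n z.2, u z.2⟫_ℂ * ((‖z.1 - z.2‖⁻¹ : ℝ) : ℂ)‖ ≤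
      Real.pi * (freeAbsForm m u).toReal := by
    intro n
    have h1 := integrable_direct_swap (η n) hu
    have h2 := integrable_direct (η n) hu
    refine (integral_mono (hex n).norm (h1.add h2)
      fun z => norm_exchange_le _ _ _ _ (by positivity)).trans ?_
    have h3 := integral_add h1 h2
    have h4 := directTerm_le (η n) hu
    have h5 := directTerm_comm u (η n)
    rw [hη, one_pow, one_mul] at h4
    refine h3.le.trans ?_
    unfold directTerm at h4 h5
    linarith
  set G : ℕ → R3 → ℂ := fun n x =>
    (k n : ℂ) * ∫ y, ⟪u x, η n x⟫_ℂ * ⟪η n y, u y⟫_ℂ * ((‖x - y‖⁻¹ : ℝ) : ℂ) with hG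
  have hGi : ∀ n, Integrable (G n) := fun n => (hex n).integral_prod_left.const_mul _
  have hGs : Summable fun n => ∫ x, ‖G n x‖ := by
    refine Summable.of_nonneg_of_le (fun n => integral_nonneg fun x => norm_nonneg _)
      (fun n => ?_) ((hδ.summable_abs hm hη).mul_right (Real.pi * (freeAbsForm m u).toReal))
    simp only [hG, norm_mul, Complex.norm_real, Real.norm_eq_abs]
    rw [integral_const_mul]
    refine mul_le_mul_of_nonneg_left (le_trans ?_ (hbound n)) (abs_nonneg _)
    have h1 := integral_prod _ (hex n).norm
    refine le_trans ?_ h1.symm.le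
    exact integral_mono (hex n).integral_prod_left.norm (hex n).norm.integral_prod_left
      fun x => norm_integral_le_integral_norm _
  have hpt : (fun x => ∑' n, G n x) =ᵐ[volume] fun x => ⟪u x, X u x⟫_ℂ := by
    filter_upwards [hX, ae_summable_norm_sq (hδ.summable_abs hm hη) hη] with x hXx hx
    have h1 : HasSum (fun n => ∑ s : Fin 4, (k n : ℂ) * η n x s * orbitalOverlap (η n) u x *
        (starRingEnd ℂ) (u x s)) (∑ s : Fin 4, X u x s * (starRingEnd ℂ) (u x s)) :=
      hasSum_sum fun s _ => by
        rw [hXx s]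
        exact (hasSum_exchange_apply hm hδ hη hu hx s).mul_right _
    rw [PiLp.inner_apply]
    simp only [RCLike.inner_apply]
    refine Eq.trans (tsum_congr fun n => ?_) h1.tsum_eq
    simp only [hG, mul_assoc]
    rw [integral_const_mul]
    change (k n : ℂ) * (⟪u x, η n x⟫_ℂ * orbitalOverlap (η n) u x) = _
    rw [PiLp.inner_apply, Finset.sum_mul, Finset.mul_sum]
    refine Finset.sum_congr rfl fun s _ => ?_
    rw [RCLike.inner_apply]
    ring
  have h4 := hasSum_integral_of_summable_integral_norm hGi hGs
  rw [integral_congr_ae hpt, ← L2.inner_def] at h4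
  refine (Complex.hasSum_re h4).congr_fun fun n => ?_
  simp only [hG]
  rw [integral_const_mul, Complex.re_ofReal_mul, exchangeTerm]
  have h5 := integral_prod _ (hex n)
  have h6 := congrArg Complex.re h5
  simp only at h6
  rw [← h6]
  change 2 * (k n * (1 / 2 * _)) = k n * _
  ring_nf
  rfl

end

/-! ### The form of the Dirac-Fock operator -/

/-- The sesquilinear form of `D₀ - a |x|⁻¹ + W`. -/
noncomputable def perturbedForm (a m : ℝ) (W : Hil →L[ℂ] Hil) (u v : Hil) : ℂ :=
  (∫ ξ, ⟪fourierL2 u ξ, diracSymbol m ξ (fourierL2 v ξ)⟫_ℂ) -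
    (a : ℂ) * (∫ x, ((‖x‖⁻¹ : ℝ) : ℂ) * ⟪u x, v x⟫_ℂ) + ⟪u, W v⟫_ℂ

theorem inner_freeDirac (m : ℝ) (u : Hil) (v : (freeDirac m).domain) :
    ⟪u, freeDirac m v⟫_ℂ = ∫ ξ, ⟪fourierL2 u ξ, diracSymbol m ξ (fourierL2 (v : Hil) ξ)⟫_ℂ := by
  change ⟪u, fourierL2.symm (mulOp (diracSymbol m) ⟨fourierL2 (v : Hil), v.2⟩)⟫_ℂ = _
  rw [← fourierL2.inner_map_map, LinearIsometryEquiv.apply_symm_apply, L2.inner_def]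
  refine integral_congr_ae ?_
  filter_upwards [MemLp.coeFn_toLp (memLp_of_mem_mulDomain v.2)] with ξ hξ
  exact congrArg _ hξ

theorem potOp_ae (V : R3 → ℝ) (v : (potOp V).domain) :
    potOp V v =ᵐ[volume] fun x => (V x : ℂ) • (v : Hil) x :=
  MemLp.coeFn_toLp (memLp_of_mem_mulDomain v.2)

theorem inner_potOp (V : R3 → ℝ) (u : Hil) (v : (potOp V).domain) :
    ⟪u, potOp V v⟫_ℂ = ∫ x, (V x : ℂ) * ⟪u x, (v : Hil) x⟫_ℂ := by
  rw [L2.inner_def]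
  refine integral_congr_ae ?_
  filter_upwards [potOp_ae V v] with x hx
  rw [hx, inner_smul_right]

theorem inner_diracFock (α Z m : ℝ) {δ W : Hil →L[ℂ] Hil}
    (hW : ∀ v : (meanField δ).domain, meanField δ v = W v) (u : Hil)
    (v : (diracFock α Z m δ).domain) :
    ⟪u, diracFock α Z m δ v⟫_ℂ = perturbedForm (α * Z) m ((α : ℂ) • W) u v := by
  have h : diracFock α Z m δ v = freeDirac m ⟨v, v.2.1.1⟩ -
      ((α * Z : ℝ) : ℂ) • potOp (fun x => ‖x‖⁻¹) ⟨v, v.2.1.2⟩ +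
      (α : ℂ) • meanField δ ⟨v, v.2.2⟩ := rfl
  rw [h, hW, inner_add_right, inner_sub_right, inner_smul_right, inner_freeDirac, inner_potOp]
  rfl

/-- Kato's inequality is uniform in the centre, so the electric potential is a bounded function. The
mean field is therefore the restriction of a bounded operator, and the Dirac-Fock form is a bounded
perturbation of that of `D_Z`. -/
theorem exists_meanFieldOperator {m : ℝ} {δ : Hil →L[ℂ] Hil} (hm : 0 < m)
    (hδ : FiniteKinetic m (eigenvalue δ) (eigenvector δ)) (hη : ∀ n, ‖eigenvector δ n‖ = 1) :
    ∃ W : Hil →L[ℂ] Hil, (∀ v : (meanField δ).domain, meanField δ v = W v) ∧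
      ∀ u, (⟪u, W u⟫_ℂ).re =
        (∫ x, electricPotential δ x * ‖u x‖ ^ 2) - (⟪u, exchangeOp δ u⟫_ℂ).re := by
  obtain ⟨Φ, hΦ⟩ := exists_scalarMulOperator (g := fun x => (electricPotential δ x : ℂ))
    (Complex.continuous_ofReal.comp_aestronglyMeasurable
      (stronglyMeasurable_electricPotential δ).aestronglyMeasurable)
    fun x => by
      rw [Complex.norm_real]
      exact abs_electricPotential_le hm hδ hη x
  refine ⟨Φ - exchangeOp δ, fun v => ?_, fun u => ?_⟩
  · have h : meanField δ v = potOp (electricPotential δ) ⟨v, v.2.1⟩ - exchangeOp δ v := rfl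
    rw [h, sub_apply]
    refine congrArg (· - _) (Lp.ext ?_)
    filter_upwards [potOp_ae (electricPotential δ) ⟨v, v.2.1⟩, hΦ v] with x h1 h2
    rw [h1, h2]
  · rw [sub_apply, inner_sub_right, Complex.sub_re, L2.inner_def,
      ← Complex.ofReal_re (∫ x, electricPotential δ x * ‖u x‖ ^ 2), ← integral_complex_ofReal]
    refine congrArg (· - _) (congrArg Complex.re (integral_congr_ae ?_))
    filter_upwards [hΦ u] with x hx
    rw [hx, inner_smul_right, inner_self_eq_norm_sq_to_K]
    push_cast
    rfl

theorem norm_sq_le_freeAbsForm {m : ℝ} (hm : 0 < m) {u : Hil} (hu : freeAbsForm m u < ∞) :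
    ‖u‖ ^ 2 ≤ m⁻¹ * (freeAbsForm m u).toReal := by
  have h := ENNReal.toReal_mono hu.ne (freeAbsForm_ge m u)
  rw [ENNReal.toReal_mul, ENNReal.toReal_ofReal (abs_nonneg _), ENNReal.toReal_ofReal (by positivity),
    abs_of_pos hm] at h
  rw [inv_mul_eq_div, le_div_iff₀ hm]
  linarith

theorem toReal_freeAbsForm_smul (m t : ℝ) (u : Hil) :
    (freeAbsForm m ((t : ℂ) • u)).toReal = t ^ 2 * (freeAbsForm m u).toReal := by
  rw [freeAbsForm_smul, ENNReal.toReal_mul, ENNReal.toReal_ofReal (by positivity), Complex.norm_real,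
    Real.norm_eq_abs, sq_abs]

theorem freeAbsForm_smul_lt_top {m : ℝ} (c : ℂ) {u : Hil} (hu : freeAbsForm m u < ∞) :
    freeAbsForm m (c • u) < ∞ := by
  rw [freeAbsForm_smul]
  exact ENNReal.mul_lt_top ENNReal.ofReal_lt_top hu

theorem norm_diracInner_le_add (m : ℝ) (ξ : R3) (s t : Spinor) :
    ‖⟪s, diracSymbol m ξ t⟫_ℂ‖ ≤
      symbolBound * (freeEnergy m ξ * ‖s‖ ^ 2 + freeEnergy m ξ * ‖t‖ ^ 2) := by
  refine (norm_diracInner_le m ξ s t).trans (mul_le_mul_of_nonneg_left ?_ symbolBound_nonneg)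
  rw [← mul_add]
  refine mul_le_mul_of_nonneg_left ?_ (freeEnergy_nonneg m ξ)
  nlinarith [sq_nonneg (‖s‖ - ‖t‖), sq_nonneg ‖s‖, sq_nonneg ‖t‖]

theorem norm_coulombInner_le_add (x : R3) (s t : Spinor) :
    ‖((‖x‖⁻¹ : ℝ) : ℂ) * ⟪s, t⟫_ℂ‖ ≤ ‖s‖ ^ 2 * ‖x‖⁻¹ + ‖t‖ ^ 2 * ‖x‖⁻¹ := by
  rw [norm_mul, Complex.norm_real, Real.norm_of_nonneg (by positivity), ← add_mul, mul_comm]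
  refine mul_le_mul_of_nonneg_right ((norm_inner_le_norm _ _).trans ?_) (by positivity)
  nlinarith [sq_nonneg (‖s‖ - ‖t‖), sq_nonneg ‖s‖, sq_nonneg ‖t‖]

theorem integrable_diracBilin {m : ℝ} {u v : Hil} (hu : freeAbsForm m u < ∞)
    (hv : freeAbsForm m v < ∞) :
    Integrable fun ξ => ⟪fourierL2 u ξ, diracSymbol m ξ (fourierL2 v ξ)⟫_ℂ :=
  (((integrable_freeEnergy hu).add (integrable_freeEnergy hv)).const_mul symbolBound).mono'
    (stronglyMeasurable_diracInner m _ _).aestronglyMeasurable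
    (ae_of_all _ fun ξ => norm_diracInner_le_add m ξ _ _)

theorem integrable_coulombBilin {m : ℝ} {u v : Hil} (hu : freeAbsForm m u < ∞)
    (hv : freeAbsForm m v < ∞) :
    Integrable fun x => ((‖x‖⁻¹ : ℝ) : ℂ) * ⟪u x, v x⟫_ℂ :=
  ((integrable_coulomb hu).add (integrable_coulomb hv)).mono'
    ((Complex.measurable_ofReal.comp measurable_norm.fun_inv).aestronglyMeasurable.mul
      ((Lp.aestronglyMeasurable u).inner (Lp.aestronglyMeasurable v)))
    (ae_of_all _ fun x => norm_coulombInner_le_add x _ _)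

theorem norm_perturbedForm_le_add (a : ℝ) {m : ℝ} (hm : 0 < m) (W : Hil →L[ℂ] Hil) {u v : Hil}
    (hu : freeAbsForm m u < ∞) (hv : freeAbsForm m v < ∞) :
    ‖perturbedForm a m W u v‖ ≤ (symbolBound + |a| * (Real.pi / 2) + ‖W‖ * m⁻¹) *
      ((freeAbsForm m u).toReal + (freeAbsForm m v).toReal) := by
  have h1 : ‖∫ ξ, ⟪fourierL2 u ξ, diracSymbol m ξ (fourierL2 v ξ)⟫_ℂ‖ ≤
      symbolBound * ((freeAbsForm m u).toReal + (freeAbsForm m v).toReal) := by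
    rw [← integral_freeEnergy, ← integral_freeEnergy,
      ← integral_add (integrable_freeEnergy hu) (integrable_freeEnergy hv), ← integral_const_mul]
    exact norm_integral_le_of_norm_le
      (((integrable_freeEnergy hu).add (integrable_freeEnergy hv)).const_mul symbolBound)
      (ae_of_all _ fun ξ => norm_diracInner_le_add m ξ _ _)
  have h2 : ‖∫ x, ((‖x‖⁻¹ : ℝ) : ℂ) * ⟪u x, v x⟫_ℂ‖ ≤
      Real.pi / 2 * ((freeAbsForm m u).toReal + (freeAbsForm m v).toReal) := by
    refine (norm_integral_le_of_norm_le ((integrable_coulomb hu).add (integrable_coulomb hv))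
      (ae_of_all _ fun x => norm_coulombInner_le_add x _ _)).trans ?_
    rw [show (∫ x, ((fun x => ‖u x‖ ^ 2 * ‖x‖⁻¹) + fun x => ‖v x‖ ^ 2 * ‖x‖⁻¹ : R3 → ℝ) x) =
      (∫ x, ‖u x‖ ^ 2 * ‖x‖⁻¹) + ∫ x, ‖v x‖ ^ 2 * ‖x‖⁻¹ from
      integral_add (integrable_coulomb hu) (integrable_coulomb hv)]
    rw [mul_add]
    exact add_le_add (integral_coulomb_le hu) (integral_coulomb_le hv)
  have h3 : ‖⟪u, W v⟫_ℂ‖ ≤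
      ‖W‖ * m⁻¹ * ((freeAbsForm m u).toReal + (freeAbsForm m v).toReal) := by
    refine (norm_inner_le_norm _ _).trans ?_
    have h4 := norm_sq_le_freeAbsForm hm hu
    have h5 := norm_sq_le_freeAbsForm hm hv
    calc ‖u‖ * ‖W v‖ ≤ ‖u‖ * (‖W‖ * ‖v‖) := by
          gcongr
          exact W.le_opNorm v
      _ = ‖W‖ * (‖u‖ * ‖v‖) := by ring
      _ ≤ ‖W‖ * (‖u‖ ^ 2 + ‖v‖ ^ 2) := by
          gcongr
          nlinarith [sq_nonneg (‖u‖ - ‖v‖), sq_nonneg ‖u‖, sq_nonneg ‖v‖]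
      _ ≤ ‖W‖ * (m⁻¹ * (freeAbsForm m u).toReal + m⁻¹ * (freeAbsForm m v).toReal) := by
          gcongr
      _ = _ := by ring
  unfold perturbedForm
  refine (norm_add_le _ _).trans ?_
  rw [add_mul, add_mul]
  refine add_le_add ((norm_sub_le _ _).trans (add_le_add h1 ?_)) h3
  rw [norm_mul, Complex.norm_real, Real.norm_eq_abs, mul_assoc]
  gcongr

theorem perturbedForm_smul_smul (a m : ℝ) (W : Hil →L[ℂ] Hil) (s t : ℝ) (u v : Hil) :
    perturbedForm a m W ((s : ℂ) • u) ((t : ℂ) • v) =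
      ((s * t : ℝ) : ℂ) * perturbedForm a m W u v := by
  unfold perturbedForm
  have h1 : ∫ ξ, ⟪fourierL2 ((s : ℂ) • u) ξ, diracSymbol m ξ (fourierL2 ((t : ℂ) • v) ξ)⟫_ℂ =
      ((s * t : ℝ) : ℂ) * ∫ ξ, ⟪fourierL2 u ξ, diracSymbol m ξ (fourierL2 v ξ)⟫_ℂ := by
    rw [← integral_const_mul, map_smul, map_smul]
    refine integral_congr_ae ?_
    filter_upwards [Lp.coeFn_smul (s : ℂ) (fourierL2 u), Lp.coeFn_smul (t : ℂ) (fourierL2 v)]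
      with ξ h1 h2
    rw [h1, h2, Pi.smul_apply, Pi.smul_apply, map_smul, inner_smul_left, inner_smul_right,
      Complex.conj_ofReal]
    push_cast
    ring
  have h2 : ∫ x, ((‖x‖⁻¹ : ℝ) : ℂ) * ⟪((s : ℂ) • u : Hil) x, ((t : ℂ) • v : Hil) x⟫_ℂ =
      ((s * t : ℝ) : ℂ) * ∫ x, ((‖x‖⁻¹ : ℝ) : ℂ) * ⟪u x, v x⟫_ℂ := by
    rw [← integral_const_mul]
    refine integral_congr_ae ?_
    filter_upwards [Lp.coeFn_smul (s : ℂ) u, Lp.coeFn_smul (t : ℂ) v] with ξ h1 h2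
    rw [h1, h2, Pi.smul_apply, Pi.smul_apply, inner_smul_left, inner_smul_right,
      Complex.conj_ofReal]
    push_cast
    ring
  rw [h1, h2, map_smul, inner_smul_left, inner_smul_right, Complex.conj_ofReal]
  push_cast
  ring

theorem perturbedForm_sub (a : ℝ) {m : ℝ} (W : Hil →L[ℂ] Hil) {u v w : Hil}
    (hu : freeAbsForm m u < ∞) (hv : freeAbsForm m v < ∞) (hw : freeAbsForm m w < ∞) :
    perturbedForm a m W u (v - w) = perturbedForm a m W u v - perturbedForm a m W u w := by
  unfold perturbedForm
  have h1 : ∫ ξ, ⟪fourierL2 u ξ, diracSymbol m ξ (fourierL2 (v - w) ξ)⟫_ℂ =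
      (∫ ξ, ⟪fourierL2 u ξ, diracSymbol m ξ (fourierL2 v ξ)⟫_ℂ) -
      ∫ ξ, ⟪fourierL2 u ξ, diracSymbol m ξ (fourierL2 w ξ)⟫_ℂ := by
    rw [← integral_sub (integrable_diracBilin hu hv) (integrable_diracBilin hu hw), map_sub]
    refine integral_congr_ae ?_
    filter_upwards [Lp.coeFn_sub (fourierL2 v) (fourierL2 w)] with ξ h
    rw [h, Pi.sub_apply, map_sub, inner_sub_right]
  have h2 : ∫ x, ((‖x‖⁻¹ : ℝ) : ℂ) * ⟪u x, (v - w : Hil) x⟫_ℂ =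
      (∫ x, ((‖x‖⁻¹ : ℝ) : ℂ) * ⟪u x, v x⟫_ℂ) - ∫ x, ((‖x‖⁻¹ : ℝ) : ℂ) * ⟪u x, w x⟫_ℂ := by
    rw [← integral_sub (integrable_coulombBilin hu hv) (integrable_coulombBilin hu hw)]
    refine integral_congr_ae ?_
    filter_upwards [Lp.coeFn_sub v w] with x h
    rw [h, Pi.sub_apply, inner_sub_right, mul_sub]
  rw [h1, h2, map_sub, inner_sub_right]
  ring

theorem norm_perturbedForm_le (a : ℝ) {m : ℝ} (hm : 0 < m) (W : Hil →L[ℂ] Hil) {u v : Hil}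
    (hu : freeAbsForm m u < ∞) (hv : freeAbsForm m v < ∞) :
    ‖perturbedForm a m W u v‖ ≤ 2 * (symbolBound + |a| * (Real.pi / 2) + ‖W‖ * m⁻¹) *
      √(freeAbsForm m u).toReal * √(freeAbsForm m v).toReal :=
  norm_form_le (D := {u | freeAbsForm m u < ∞}) (fun _ => ENNReal.toReal_nonneg)
    (toReal_freeAbsForm_smul m) (perturbedForm_smul_smul a m W)
    (fun t _ h => freeAbsForm_smul_lt_top t h)
    (fun _ h _ h' => norm_perturbedForm_le_add a hm W h h') hu hv

theorem perturbedForm_self_re (α Z m : ℝ) (W : Hil →L[ℂ] Hil) (u : Hil) :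
    (perturbedForm (α * Z) m ((α : ℂ) • W) u u).re =
      coulombDiracForm α Z m u + α * (⟪u, W u⟫_ℂ).re := by
  have h : ∫ x, ((‖x‖⁻¹ : ℝ) : ℂ) * ⟪u x, u x⟫_ℂ = ((∫ x, ‖u x‖ ^ 2 / ‖x‖ : ℝ) : ℂ) := by
    rw [← integral_complex_ofReal]
    refine integral_congr_ae (ae_of_all _ fun x => ?_)
    simp only []
    rw [inner_self_eq_norm_sq_to_K]
    push_cast
    exact (mul_comm _ _).trans (div_eq_mul_inv _ _).symm
  rw [perturbedForm, coulombDiracForm, h, smul_apply, inner_smul_right, Complex.add_re,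
    Complex.sub_re, Complex.re_ofReal_mul, Complex.re_ofReal_mul, Complex.ofReal_re]

/-- The mean-field energy of an orbital lies between `0` and `(π/2) (tr δ) ⟪u, |D₀| u⟫`. -/
theorem meanField_energy_mem {m : ℝ} {δ : Hil →L[ℂ] Hil} (hm : 0 < m)
    (hδ : FiniteKinetic m (eigenvalue δ) (eigenvector δ)) (hη : ∀ n, ‖eigenvector δ n‖ = 1)
    (hk : ∀ n, 0 ≤ eigenvalue δ n) {u : Hil} (hu : freeAbsForm m u < ∞) :
    (∫ x, electricPotential δ x * ‖u x‖ ^ 2) - (⟪u, exchangeOp δ u⟫_ℂ).re ∈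
      Icc 0 (Real.pi / 2 * (∑' n, eigenvalue δ n) * (freeAbsForm m u).toReal) := by
  have h1 := hasSum_potential_energy hm hδ hη hu
  have hs : Summable (eigenvalue δ) := hδ.summable hm hη
  have h2 : HasSum (fun n => Real.pi / 2 * eigenvalue δ n * (freeAbsForm m u).toReal)
      (Real.pi / 2 * (∑' n, eigenvalue δ n) * (freeAbsForm m u).toReal) :=
    (hs.hasSum.mul_left _).mul_right _
  have h3 : ∀ n, 2 * (eigenvalue δ n * directTerm u (eigenvector δ n)) ≤
      Real.pi / 2 * eigenvalue δ n * (freeAbsForm m u).toReal := fun n => by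
    have := directTerm_le (eigenvector δ n) hu
    rw [hη, one_pow, one_mul, directTerm_comm] at this
    nlinarith [hk n]
  have hfin : ∀ n, eigenvalue δ n = 0 ∨ freeAbsForm m (eigenvector δ n) < ∞ := fun n =>
    or_iff_not_imp_left.2 fun h => hδ.lt_top h
  -- Both bounds survive the default `exchangeOp δ = 0`: the direct term alone is nonnegative and
  -- obeys the same upper bound.
  by_cases hX : ∃ X : Hil →L[ℂ] Hil, ∀ ψ : Hil, ∀ᵐ x, ∀ s : Fin 4,
      X ψ x s = ∫ y, (∑ t : Fin 4, kernel δ x y s t * ψ y t) / (‖x - y‖ : ℂ)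
  · have h4 := hasSum_exchange_energy hm hδ hη hu (X := exchangeOp δ) (by
      rw [exchangeOp, dif_pos hX]
      exact hX.choose_spec u)
    refine ⟨(h1.sub h4).nonneg fun n => ?_, hasSum_le (fun n => ?_) (h1.sub h4) h2⟩
    · rcases hfin n with h | h
      · simp [h]
      · have := pairTerm_nonneg u h
        rw [pairTerm] at this
        nlinarith [hk n]
    · rcases hfin n with h | h
      · simp [h]
      · have := exchangeTerm_nonneg u h
        nlinarith [hk n, h3 n]
  · rw [exchangeOp, dif_neg hX, zero_apply, inner_zero_right, Complex.zero_re, sub_zero]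
    refine ⟨h1.nonneg fun n => ?_, hasSum_le h3 h1 h2⟩
    exact mul_nonneg zero_le_two (mul_nonneg (hk n) (directTerm_nonneg _ _))

theorem exists_freeAbsForm_pos {m : ℝ} (hm : 0 < m) : ∃ u : Hil, freeAbsForm m u ≠ 0 := by
  have := infiniteDimensional_Hil
  obtain ⟨u, hu⟩ : ∃ u : Hil, u ≠ 0 := by
    by_contra! h
    exact this (Module.Finite.of_surjective (0 : ℂ →ₗ[ℂ] Hil) fun u => ⟨0, (h u).symm⟩)
  refine ⟨u, fun h => ?_⟩
  have h1 := freeAbsForm_ge m u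
  rw [h, nonpos_iff_eq_zero, ← ENNReal.ofReal_mul (abs_nonneg _), ENNReal.ofReal_eq_zero] at h1
  have : 0 < |m| * ‖u‖ ^ 2 := by positivity
  linarith

/-- The gap of the Dirac-Fock operator on its spectral subspaces, in terms of the form of `D_Z`. -/
theorem exists_projPlus_gap (Z : ℝ) {α m c : ℝ} (hα : 0 ≤ α) (hm : 0 < m) (hc : 0 < c)
    {δ : Hil →L[ℂ] Hil} (hδ : FiniteKinetic m (eigenvalue δ) (eigenvector δ))
    (hη : ∀ n, ‖eigenvector δ n‖ = 1) (hk : ∀ n, 0 ≤ eigenvalue δ n)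
    (hf : ∀ u, ENNReal.ofReal c * freeAbsForm m u ≤ absForm (diracFock α Z m δ) u) :
    IsStarProjection (projPlus α Z m δ) ∧
    (∀ u, freeAbsForm m u < ∞ → projPlus α Z m δ u = u →
      (c - α * (Real.pi / 2) * ∑' n, eigenvalue δ n) * (freeAbsForm m u).toReal ≤
        coulombDiracForm α Z m u) ∧
    (∀ u, freeAbsForm m u < ∞ → projPlus α Z m δ u = 0 →
      coulombDiracForm α Z m u ≤ -c * (freeAbsForm m u).toReal) := by
  -- Without a spectral measure `absForm` would be the default `0`, which cannot dominate `c |D₀|`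
  -- with `c > 0`. The hypothesis on `c` thus provides the spectral resolution.
  have hE : ∃ E : SpectralMeasure Hil, E.Represents (diracFock α Z m δ) := by
    by_contra h
    obtain ⟨u, hu⟩ := exists_freeAbsForm_pos hm
    have := hf u
    rw [absForm, dif_neg h, nonpos_iff_eq_zero, mul_eq_zero, ENNReal.ofReal_eq_zero] at this
    exact this.elim hc.not_ge hu
  have hP : projPlus α Z m δ = hE.choose.proj (Ici 0) := by
    rw [projPlus, spectralProj, dif_pos hE]
  have hf' : ∀ u, ENNReal.ofReal c * freeAbsForm m u ≤
      ∫⁻ t, ENNReal.ofReal |t| ∂(hE.choose.measure u) := fun u => by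
    have := hf u
    rwa [absForm, dif_pos hE] at this
  obtain ⟨W, hW, hWu⟩ := exists_meanFieldOperator hm hδ hη
  -- The sign `σ` of `t` on `s` turns the bound on `|D^(δ)|` into one on `σ D^(δ)`; it is used with
  -- `+1` on `[0, ∞)` and `-1` on its complement.
  have key : ∀ (s : Set ℝ) (_ : MeasurableSet s) (σ : ℝ) (_ : ∀ t ∈ s, σ * t = |t|) (u : Hil)
      (_ : freeAbsForm m u < ∞) (_ : hE.choose.proj s u = u), c * (freeAbsForm m u).toReal ≤
        σ * (coulombDiracForm α Z m u + α * (⟪u, W u⟫_ℂ).re) := fun s hs σ hσ u hu hsu => by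
    rw [← perturbedForm_self_re]
    exact form_lower_bound hE.choose_spec hc hf'
      (fun u v _ _ => inner_diracFock α Z m hW u v)
      (fun u v h h' => norm_perturbedForm_le (α * Z) hm _ h h')
      (fun u v w h h' h'' => perturbedForm_sub (α * Z) _ h h' h'') hs hσ hu hsu
  refine ⟨hP ▸ hE.choose.isStarProjection _ measurableSet_Ici, fun u hu hPu => ?_,
    fun u hu hPu => ?_⟩
  · have h1 := key (Ici 0) measurableSet_Ici 1 (fun t ht => by rw [one_mul, abs_of_nonneg ht]) u hu
      (hP ▸ hPu)
    have h2 := (meanField_energy_mem hm hδ hη hk hu).2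
    rw [← hWu] at h2
    nlinarith [mul_le_mul_of_nonneg_left h2 hα]
  -- On the negative subspace the nonnegative mean field is simply dropped, so the full constant `c`
  -- remains; on the positive one its upper bound had to be subtracted.
  · have h1 := key (Ici 0)ᶜ measurableSet_Ici.compl (-1)
      (fun t ht => by rw [abs_of_neg (not_le.1 (mem_Ici.not.1 ht))]; ring) u hu (by
        rw [SpectralMeasure.proj_compl _ measurableSet_Ici, sub_apply, one_apply_eq_self, ← hP, hPu,
          sub_zero])
    have h2 := (meanField_energy_mem hm hδ hη hk hu).1
    rw [← hWu] at h2
    nlinarith [mul_nonneg hα h2]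

/-! ### Density matrices and their eigensystems -/

/-- The hypothesis says `a p = p a p`; the right side is self-adjoint, and taking adjoints gives `p
a = a p`. -/
theorem commute_of_compl_mul_mul_eq_zero {R : Type*} [Ring R] [StarRing R] {p a : R}
    (hp : IsStarProjection p) (ha : IsSelfAdjoint a) (h : (1 - p) * a * p = 0) : p * a = a * p := by
  have h1 : a * p = p * a * p := by
    rw [sub_mul, sub_mul, one_mul, sub_eq_zero] at h
    exact h
  have h2 := congrArg star h1
  rw [star_mul, star_mul, star_mul, ha.star_eq, hp.isSelfAdjoint.star_eq, ← mul_assoc, ← h1] at h2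
  exact h2

theorem eigenvalue_mem_of_le {H : Type*} [NormedAddCommGroup H] [InnerProductSpace ℂ H]
    {A B T : H →L[ℂ] H} (hA : A ≤ T) (hB : T ≤ B) {a b l : ℝ} {y : H} (hy : y ≠ 0)
    (hl : T y = (l : ℂ) • y) (ha : A y = (a : ℂ) • y) (hb : B y = (b : ℂ) • y) :
    a ≤ l ∧ l ≤ b := by
  have hy2 : 0 < ‖y‖ ^ 2 := by positivity
  have key : ∀ s t : ℝ, (RCLike.re ⟪y, (s : ℂ) • y - (t : ℂ) • y⟫_ℂ : ℝ) = (s - t) * ‖y‖ ^ 2 := by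
    intro s t
    rw [← sub_smul, inner_smul_right, inner_self_eq_norm_sq_to_K, ← Complex.ofReal_sub]
    have : ((s - t : ℝ) : ℂ) * ((‖y‖ : ℝ) : ℂ) ^ 2 = (((s - t) * ‖y‖ ^ 2 : ℝ) : ℂ) := by
      push_cast
      ring
    exact (congrArg _ this).trans (Complex.ofReal_re _)
  have h1 := ((ContinuousLinearMap.le_def _ _).1 hA).re_inner_nonneg_right y
  have h2 := ((ContinuousLinearMap.le_def _ _).1 hB).re_inner_nonneg_right y
  rw [sub_apply, hl, ha, key] at h1
  rw [sub_apply, hl, hb, key] at h2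
  exact ⟨sub_nonneg.1 (nonneg_of_mul_nonneg_left h1 hy2),
    sub_nonneg.1 (nonneg_of_mul_nonneg_left h2 hy2)⟩

/-- Eigenvectors of `γ` with `-(1 - P) ≤ γ ≤ P` and `(1 - P) γ P = 0`. -/
theorem eigenvector_spectral {H : Type*} [NormedAddCommGroup H] [InnerProductSpace ℂ H]
    [CompleteSpace H] {P T : H →L[ℂ] H} (hP : IsStarProjection P) (hT : IsSelfAdjoint T)
    (h0 : (1 - P) * T * P = 0) (h1 : -(1 - P) ≤ T) (h2 : T ≤ P) {l : ℝ} {x : H} (hx : x ≠ 0)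
    (hl : T x = (l : ℂ) • x) : l ≤ 1 ∧ -1 ≤ l ∧ (0 < l → P x = x) ∧ (l < 0 → P x = 0) := by
  have hc := commute_of_compl_mul_mul_eq_zero hP hT h0
  have hTP : T (P x) = (l : ℂ) • P x := by
    have h : T (P x) = P (T x) := (DFunLike.congr_fun hc x).symm
    rw [h, hl, map_smul]
  have hPP : P (P x) = P x := DFunLike.congr_fun hP.isIdempotentElem.eq x
  -- By commutation `P x` and `x - P x` are eigenvectors for the same `l` whenever they are nonzero.
  -- The operator bounds then put `l` in `[0, 1]` or in `[-1, 0]`, so a nonzero `l` allows only one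
  -- of them.
  have hA : P x ≠ 0 → 0 ≤ l ∧ l ≤ 1 := fun h =>
    eigenvalue_mem_of_le h1 h2 h hTP (by simp [hPP]) (by simp [hPP])
  have hB : x - P x ≠ 0 → -1 ≤ l ∧ l ≤ 0 := fun h =>
    eigenvalue_mem_of_le h1 h2 h (by rw [map_sub, hl, hTP, smul_sub]) (by simp [hPP])
      (by simp [hPP])
  by_cases hPx : P x = 0
  · have h3 := hB (by rwa [hPx, sub_zero])
    exact ⟨by linarith, h3.1, fun h => absurd h (not_lt.2 h3.2), fun _ => hPx⟩
  · have h3 := hA hPx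
    refine ⟨h3.2, by linarith, fun h => ?_, fun h => absurd h (not_lt.2 h3.1)⟩
    by_contra h4
    exact absurd h (not_lt.2 (hB (sub_ne_zero.2 (Ne.symm h4))).2)

theorem exists_operator_of_summable {H : Type*} [NormedAddCommGroup H] [InnerProductSpace ℂ H]
    [CompleteSpace H] (ξ : HilbertBasis ℕ ℂ H) {l : ℕ → ℝ} (hl : Summable fun n => |l n|) :
    ∃ T : H →L[ℂ] H, ∀ n, T (ξ n) = (l n : ℂ) • ξ n := by
  have hs : Summable fun n => (l n : ℂ) • InnerProductSpace.rankOne ℂ (ξ n) (ξ n) := by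
    refine Summable.of_norm_bounded hl fun n => ?_
    rw [norm_smul, InnerProductSpace.norm_rankOne, ξ.orthonormal.1, Complex.norm_real,
      Real.norm_eq_abs, mul_one, mul_one]
  refine ⟨∑' n, (l n : ℂ) • InnerProductSpace.rankOne ℂ (ξ n) (ξ n), fun m => ?_⟩
  have h := hs.hasSum.mapL (ContinuousLinearMap.apply ℂ H (ξ m))
  refine h.unique ((hasSum_single m fun n hn => ?_).congr_fun fun n => rfl) |>.trans ?_
  · simp [InnerProductSpace.rankOne_apply, ξ.orthonormal.2 hn]
  · simp [InnerProductSpace.rankOne_apply, inner_self_eq_norm_sq_to_K, ξ.orthonormal.1]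

theorem eq_of_eigenbasis {H : Type*} [NormedAddCommGroup H] [InnerProductSpace ℂ H]
    [CompleteSpace H] (ξ : HilbertBasis ℕ ℂ H) {l : ℕ → ℝ} {S T : H →L[ℂ] H}
    (hS : ∀ n, S (ξ n) = (l n : ℂ) • ξ n) (hT : ∀ n, T (ξ n) = (l n : ℂ) • ξ n) : S = T := by
  ext1 v
  exact (hasSum_of_eigenbasis ξ hS v).unique (hasSum_of_eigenbasis ξ hT v)

theorem nonneg_of_eigenbasis {H : Type*} [NormedAddCommGroup H] [InnerProductSpace ℂ H]
    [CompleteSpace H] (ξ : HilbertBasis ℕ ℂ H) {l : ℕ → ℝ} {T : H →L[ℂ] H}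
    (hT : ∀ n, T (ξ n) = (l n : ℂ) • ξ n) (hl : ∀ n, 0 ≤ l n) : T.IsPositive := by
  refine ⟨isSymmetric_of_eigenbasis ξ hT, fun x => ?_⟩
  rw [ContinuousLinearMap.reApplyInnerSelf_apply, inner_re_symm]
  exact (hasSum_inner_of_eigenbasis ξ hT x).nonneg fun n => mul_nonneg (hl n) (by positivity)

/-- Expand `⟪x, P x⟫ = ‖P x‖²` in the basis. For occupied modes `⟪ξₙ, P x⟫ = ⟪ξₙ, x⟫`, so the
comparison holds term by term. -/
theorem le_of_eigenbasis {H : Type*} [NormedAddCommGroup H] [InnerProductSpace ℂ H]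
    [CompleteSpace H] (ξ : HilbertBasis ℕ ℂ H) {l : ℕ → ℝ} {P T : H →L[ℂ] H}
    (hP : IsStarProjection P) (hT : ∀ n, T (ξ n) = (l n : ℂ) • ξ n) (h1 : ∀ n, l n ≤ 1)
    (hPξ : ∀ n, l n ≠ 0 → P (ξ n) = ξ n) : T ≤ P := by
  have hsym : (P : H →ₗ[ℂ] H).IsSymmetric :=
    ContinuousLinearMap.isSelfAdjoint_iff_isSymmetric.1 hP.isSelfAdjoint
  rw [ContinuousLinearMap.le_def]
  refine ⟨hsym.sub (isSymmetric_of_eigenbasis ξ hT), fun x => ?_⟩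
  rw [ContinuousLinearMap.reApplyInnerSelf_apply, inner_re_symm, sub_apply, inner_sub_right, map_sub,
    sub_nonneg]
  have hPx : (RCLike.re ⟪x, P x⟫_ℂ : ℝ) = ‖P x‖ ^ 2 := by
    have h : P (P x) = P x := DFunLike.congr_fun hP.isIdempotentElem.eq x
    rw [← h, ← show ⟪P x, P x⟫_ℂ = ⟪x, P (P x)⟫_ℂ from hsym x (P x), h]
    exact inner_self_eq_norm_sq _
  rw [hPx]
  refine hasSum_le (fun n => ?_) (hasSum_inner_of_eigenbasis ξ hT x) (hasSum_norm_inner_sq ξ (P x))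
  by_cases hn : l n = 0
  · simp only [hn, zero_mul]
    positivity
  · rw [show ⟪ξ n, P x⟫_ℂ = ⟪ξ n, x⟫_ℂ from (hsym (ξ n) x).symm.trans (by
      change ⟪P (ξ n), x⟫_ℂ = _
      rw [hPξ n hn])]
    exact mul_le_of_le_one_left (by positivity) (h1 n)

theorem compl_mul_eq_zero_of_eigenbasis {H : Type*} [NormedAddCommGroup H] [InnerProductSpace ℂ H]
    [CompleteSpace H] (ξ : HilbertBasis ℕ ℂ H) {l : ℕ → ℝ} {P T : H →L[ℂ] H}
    (hT : ∀ n, T (ξ n) = (l n : ℂ) • ξ n) (hPξ : ∀ n, l n ≠ 0 → P (ξ n) = ξ n) :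
    (1 - P) * T = 0 := by
  rw [eq_of_eigenbasis ξ (S := (1 - P) * T) (T := 0) (l := 0) (fun n => ?_) fun n => ?_]
  · rw [show ((1 - P) * T) (ξ n) = (1 - P) (T (ξ n)) from rfl, hT, map_smul, sub_apply, one_apply_eq_self]
    by_cases hn : l n = 0
    · simp [hn]
    · simp [hPξ n hn]
  · simp

/-- The value of the Hartree-Fock functional at `∑ₙ lₙ |ξₙ⟩⟨ξₙ|`. -/
noncomputable def modeEnergy (α Z m : ℝ) (ξ : ℕ → Hil) (l : ℕ → ℝ) : ℝ :=
  ∑' n, l n * coulombDiracForm α Z m (ξ n) +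
    α * ∑' p : ℕ × ℕ, l p.1 * l p.2 * pairTerm (ξ p.1) (ξ p.2)

/-- Supplies the trial states: occupations in `[0, 1]` carried by electronic modes form an
admissible density matrix, so minimality becomes a statement on sequences. -/
theorem exists_densityMatrix_energy_eq (α Z : ℝ) {m : ℝ} {δ : Hil →L[ℂ] Hil} (hm : 0 < m)
    (hP : IsStarProjection (projPlus α Z m δ)) {ξ : HilbertBasis ℕ ℂ Hil} {l : ℕ → ℝ}
    (hl : FiniteKinetic m l ξ) (h0 : ∀ n, 0 ≤ l n) (h1 : ∀ n, l n ≤ 1)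
    (hPξ : ∀ n, l n ≠ 0 → projPlus α Z m δ (ξ n) = ξ n) {q : ℝ} (hq : ∑' n, l n = q) :
    ∃ T ∈ densityMatricesOfCharge α Z m δ q, energy α Z m T = modeEnergy α Z m ξ l := by
  obtain ⟨T, hT⟩ := exists_operator_of_summable ξ (hl.summable_abs hm ξ.orthonormal.1)
  have hE := energy_eq α Z hm hT hl
  have hpos : 0 ≤ T :=
    (ContinuousLinearMap.nonneg_iff_isPositive T).2 (nonneg_of_eigenbasis ξ hT h0)
  refine ⟨T, ⟨⟨hE.1, ?_, le_of_eigenbasis ξ hP hT h1 hPξ, ?_⟩, ?_⟩, hE.2⟩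
  · refine le_trans ?_ hpos
    rw [neg_nonpos]
    exact hP.one_sub.nonneg
  · rw [projMinus, compl_mul_eq_zero_of_eigenbasis ξ hT hPξ, zero_mul]
  · rw [opTrace_of_eigenbasis ξ hT (hl.summable hm ξ.orthonormal.1), hq]

/-! ### Interaction energies of occupation numbers -/

/-- The interaction of the states `∑ₙ kₙ |ξₙ⟩⟨ξₙ|` and `∑ₙ lₙ |ξₙ⟩⟨ξₙ|`. -/
noncomputable def pairSum (ξ : ℕ → Hil) (k l : ℕ → ℝ) : ℝ :=
  ∑' p : ℕ × ℕ, k p.1 * l p.2 * pairTerm (ξ p.1) (ξ p.2)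

/-- The kinetic energy of the state `∑ₙ lₙ |ξₙ⟩⟨ξₙ|`. -/
noncomputable def kineticSum (m : ℝ) (ξ : ℕ → Hil) (l : ℕ → ℝ) : ℝ :=
  ∑' n, l n * (freeAbsForm m (ξ n)).toReal

theorem pairSum_comm (ξ : ℕ → Hil) (k l : ℕ → ℝ) : pairSum ξ k l = pairSum ξ l k := by
  unfold pairSum
  rw [← (Equiv.prodComm ℕ ℕ).tsum_eq]
  refine tsum_congr fun p => ?_
  change k p.2 * l p.1 * pairTerm (ξ p.2) (ξ p.1) = _
  rw [pairTerm_comm]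
  ring

theorem modeEnergy_smul (α Z m θ : ℝ) (ξ : ℕ → Hil) (l : ℕ → ℝ) :
    modeEnergy α Z m ξ (fun n => θ * l n) =
      θ * ∑' n, l n * coulombDiracForm α Z m (ξ n) + α * (θ ^ 2 * pairSum ξ l l) := by
  rw [modeEnergy, pairSum, ← tsum_mul_left (a := θ), ← tsum_mul_left (a := θ ^ 2)]
  refine congrArg₂ (· + α * ·) (tsum_congr fun n => ?_) (tsum_congr fun p => ?_) <;> ring

section

variable {m : ℝ} {ξ : HilbertBasis ℕ ℂ Hil} {k l : ℕ → ℝ}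

theorem FiniteKinetic.summable_kinetic (h : FiniteKinetic m l ξ) :
    Summable fun n => l n * (freeAbsForm m (ξ n)).toReal := by
  refine Summable.of_norm_bounded h.summable_mul fun n => ?_
  rw [norm_mul, Real.norm_eq_abs, Real.norm_of_nonneg ENNReal.toReal_nonneg]

theorem pairSum_nonneg (hl : FiniteKinetic m l ξ) (hk0 : ∀ n, 0 ≤ k n) (hl0 : ∀ n, 0 ≤ l n) :
    0 ≤ pairSum ξ k l := by
  refine tsum_nonneg fun p => ?_
  by_cases h : l p.2 = 0
  · simp [h]
  · exact mul_nonneg (mul_nonneg (hk0 _) (hl0 _)) (pairTerm_nonneg _ (hl.lt_top h))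

/-- Exchange is dropped and Kato's inequality is applied to the orbital of the second factor. By
symmetry of `pairSum` the kinetic energy may be charged to either factor. -/
theorem pairSum_le (hm : 0 < m) (hk : FiniteKinetic m k ξ) (hl : FiniteKinetic m l ξ)
    (hk0 : ∀ n, 0 ≤ k n) (hl0 : ∀ n, 0 ≤ l n) :
    pairSum ξ k l ≤ Real.pi / 4 * ((∑' n, k n) * kineticSum m ξ l) := by
  have h1 := hk.summable hm ξ.orthonormal.1
  have h2 := hl.summable_kinetic
  have h3 : Summable fun p : ℕ × ℕ => k p.1 * (l p.2 * (freeAbsForm m (ξ p.2)).toReal) :=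
    Summable.mul_of_nonneg h1 h2 hk0 fun n => mul_nonneg (hl0 n) ENNReal.toReal_nonneg
  rw [kineticSum, h1.tsum_mul_tsum h2 h3, ← tsum_mul_left, pairSum]
  refine (hk.summable_pairTerm hm hl).tsum_le_tsum (fun p => ?_) (h3.mul_left _)
  by_cases h : l p.2 = 0
  · simp [h]
  · have h4 := (pairTerm_le_directTerm (ξ p.1) (hl.lt_top h)).trans (directTerm_le _ (hl.lt_top h))
    rw [ξ.orthonormal.1, one_pow, one_mul] at h4
    calc k p.1 * l p.2 * pairTerm (ξ p.1) (ξ p.2) ≤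
        k p.1 * l p.2 * (Real.pi / 4 * (freeAbsForm m (ξ p.2)).toReal) :=
          mul_le_mul_of_nonneg_left h4 (mul_nonneg (hk0 _) (hl0 _))
      _ = _ := by ring

theorem pairSum_sub_sub (hm : 0 < m) (hk : FiniteKinetic m k ξ) (hl : FiniteKinetic m l ξ) :
    pairSum ξ (fun n => k n - l n) (fun n => k n - l n) =
      pairSum ξ k k - 2 * pairSum ξ k l + pairSum ξ l l := by
  have h1 := (hk.summable_pairTerm hm hk).hasSum
  have h2 := (hk.summable_pairTerm hm hl).hasSum
  have h3 := (hl.summable_pairTerm hm hk).hasSum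
  have h4 := (hl.summable_pairTerm hm hl).hasSum
  have h := (((h1.sub h2).sub h3).add h4).congr_fun
    (g := fun p : ℕ × ℕ => (k p.1 - l p.1) * (k p.2 - l p.2) * pairTerm (ξ p.1) (ξ p.2))
    fun p => by ring
  have h5 : pairSum ξ (fun n => k n - l n) (fun n => k n - l n) =
      pairSum ξ k k - pairSum ξ k l - pairSum ξ l k + pairSum ξ l l := h.tsum_eq
  rw [h5, pairSum_comm ξ l k]
  ring

/-- The exchange energy of `|l| ≤ 1` is at most half of the kinetic energy times `π/2`. -/
theorem neg_le_pairSum_self (hm : 0 < m) (hl : FiniteKinetic m l ξ) (h1 : ∀ n, |l n| ≤ 1) :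
    -(Real.pi / 4 * kineticSum m ξ fun n => |l n|) ≤ pairSum ξ l l := by
  have hs := hl.summable_pairTerm hm hl
  -- Squares `S ×ˢ S` are cofinal among finite sets of pairs. The double series is thus a limit of
  -- finite quadratic forms, to which Coulomb positivity and the exchange estimate apply.
  have ht : Tendsto (fun S : Finset ℕ => S ×ˢ S) atTop atTop := by
    refine tendsto_atTop.2 fun b => ?_
    filter_upwards [eventually_ge_atTop (b.image Prod.fst ∪ b.image Prod.snd)] with S hS p hp
    exact Finset.mem_product.2 ⟨hS (Finset.mem_union_left _ (Finset.mem_image_of_mem _ hp)),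
      hS (Finset.mem_union_right _ (Finset.mem_image_of_mem _ hp))⟩
  refine ge_of_tendsto (hs.hasSum.comp ht) (Eventually.of_forall fun S => ?_)
  have hfilter : ∑ p ∈ S ×ˢ S, l p.1 * l p.2 * pairTerm (ξ p.1) (ξ p.2) =
      ∑ n ∈ S with l n ≠ 0, ∑ j ∈ S with l j ≠ 0, l n * l j * pairTerm (ξ n) (ξ j) := by
    rw [Finset.sum_product, Finset.sum_filter]
    refine Finset.sum_congr rfl fun n _ => ?_
    by_cases hn : l n = 0
    · simp [hn]
    · rw [if_pos hn, Finset.sum_filter]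
      refine Finset.sum_congr rfl fun j _ => ?_
      by_cases hj : l j = 0
      · simp [hj]
      · rw [if_pos hj]
  have hfin : ∀ n ∈ S.filter fun n => l n ≠ 0, freeAbsForm m (ξ n) < ∞ := fun n hn =>
    hl.lt_top (Finset.mem_filter.1 hn).2
  have hD := sum_directTerm_nonneg _ l hfin
  have hX := sum_exchangeTerm_le _ l ξ.orthonormal hfin
  -- Here `|lₙ| ≤ 1` enters: the exchange weights satisfy `lₙ² ≤ |lₙ|`.
  have hK : ∑ n ∈ S with l n ≠ 0, l n ^ 2 * (freeAbsForm m (ξ n)).toReal ≤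
      kineticSum m ξ fun n => |l n| := by
    refine le_trans (Finset.sum_le_sum fun n _ => ?_) (hl.summable_mul.sum_le_tsum _ fun n _ =>
      mul_nonneg (abs_nonneg _) ENNReal.toReal_nonneg)
    refine mul_le_mul_of_nonneg_right ?_ ENNReal.toReal_nonneg
    rw [← sq_abs]
    nlinarith [h1 n, abs_nonneg (l n)]
  change _ ≤ ∑ p ∈ S ×ˢ S, l p.1 * l p.2 * pairTerm (ξ p.1) (ξ p.2)
  rw [hfilter]
  have hsplit : ∑ n ∈ S with l n ≠ 0, ∑ j ∈ S with l j ≠ 0, l n * l j * pairTerm (ξ n) (ξ j) =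
      ∑ n ∈ S with l n ≠ 0, ∑ j ∈ S with l j ≠ 0, l n * l j * directTerm (ξ n) (ξ j) -
      ∑ n ∈ S with l n ≠ 0, ∑ j ∈ S with l j ≠ 0, l n * l j * exchangeTerm (ξ n) (ξ j) := by
    rw [← Finset.sum_sub_distrib]
    refine Finset.sum_congr rfl fun n _ => ?_
    rw [← Finset.sum_sub_distrib]
    refine Finset.sum_congr rfl fun j _ => ?_
    rw [pairTerm, mul_sub]
  rw [hsplit]
  nlinarith [Real.pi_pos, mul_le_mul_of_nonneg_left hK (by positivity : 0 ≤ Real.pi / 4)]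

/-- The parallelogram identity for a quadratic functional: linear parts cancel and only the
interaction of the perturbation with itself survives. -/
theorem modeEnergy_add_add_modeEnergy_sub (α Z : ℝ) (hm : 0 < m) (hk : FiniteKinetic m k ξ)
    (hl : FiniteKinetic m l ξ) :
    modeEnergy α Z m ξ (fun n => l n + k n) + modeEnergy α Z m ξ (fun n => l n - k n) =
      2 * modeEnergy α Z m ξ l + 2 * (α * pairSum ξ k k) := by
  have h1 := (hl.summable_coulombDiracForm α Z).hasSum
  have h2 := (hk.summable_coulombDiracForm α Z).hasSum
  have h3 := (h1.add h2).congr_fun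
    (g := fun n => (l n + k n) * coulombDiracForm α Z m (ξ n)) fun n => by ring
  have h4 := (h1.sub h2).congr_fun
    (g := fun n => (l n - k n) * coulombDiracForm α Z m (ξ n)) fun n => by ring
  have q1 := (hl.summable_pairTerm hm hl).hasSum
  have q2 := (hl.summable_pairTerm hm hk).hasSum
  have q3 := (hk.summable_pairTerm hm hl).hasSum
  have q4 := (hk.summable_pairTerm hm hk).hasSum
  have q5 := (((q1.add q2).add q3).add q4).congr_fun
    (g := fun p : ℕ × ℕ => (l p.1 + k p.1) * (l p.2 + k p.2) * pairTerm (ξ p.1) (ξ p.2))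
    fun p => by ring
  have q6 := (((q1.sub q2).sub q3).add q4).congr_fun
    (g := fun p : ℕ × ℕ => (l p.1 - k p.1) * (l p.2 - k p.2) * pairTerm (ξ p.1) (ξ p.2))
    fun p => by ring
  rw [modeEnergy, modeEnergy, modeEnergy, pairSum, h3.tsum_eq, h4.tsum_eq, q5.tsum_eq, q6.tsum_eq]
  ring

end

/-- A summable sequence of occupation numbers in `{0, 1}` has an integral sum. -/
theorem exists_tsum_eq_natCast {l : ℕ → ℝ} (hs : Summable l) (h : ∀ n, l n = 0 ∨ l n = 1) :
    ∃ N : ℕ, ∑' n, l n = N := by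
  have hfin : {n | ¬ l n < 1}.Finite := by
    have := hs.tendsto_cofinite_zero.eventually_lt_const zero_lt_one
    exact this
  refine ⟨hfin.toFinset.card, ?_⟩
  rw [tsum_eq_sum (s := hfin.toFinset) fun n hn => ?_, Finset.sum_congr rfl fun n hn => ?_,
    Finset.sum_const, nsmul_eq_mul, mul_one]
  · rcases h n with h | h
    · rw [hfin.mem_toFinset] at hn
      exact absurd (by rw [h]; exact zero_lt_one) hn
    · exact h
  · rcases h n with h | h
    · exact h
    · rw [hfin.mem_toFinset] at hn
      exact absurd (fun h2 => by rw [h] at h2; exact lt_irrefl _ h2) hn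

/-- Occupation numbers in `[0, 1]` with an integral sum are either all in `{0, 1}` or fractional at
two indices at least. -/
theorem exists_ne_fractional {l : ℕ → ℝ} (hs : Summable l) (h0 : ∀ n, 0 ≤ l n) (h1 : ∀ n, l n ≤ 1)
    {q : ℕ} (hq : ∑' n, l n = q) {a : ℕ} (ha0 : 0 < l a) (ha1 : l a < 1) :
    ∃ b, b ≠ a ∧ 0 < l b ∧ l b < 1 := by
  by_contra! hb
  -- If `a` were the only fractional index, the other occupations would sum to an integer `N`, and
  -- `l a = q - N` would be an integer strictly between `0` and `1`.
  obtain ⟨N, hN⟩ := exists_tsum_eq_natCast (l := fun n => if n = a then 0 else l n)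
    (hs.of_nonneg_of_le (fun n => by split_ifs <;> simp [h0 n])
      fun n => by split_ifs <;> simp [h0 n]) fun n => by
    by_cases hn : n = a
    · simp [hn]
    · simp only [hn, if_false]
      rcases (h0 n).eq_or_lt with h | h
      · exact Or.inl h.symm
      · exact Or.inr (le_antisymm (h1 n) (hb n hn h))
  have h2 := hs.tsum_eq_add_tsum_ite a
  rw [hq, hN] at h2
  have h3 : (N : ℝ) < q := by linarith
  have h4 : (q : ℝ) < N + 1 := by linarith
  have h5 : N < q := by exact_mod_cast h3
  have h6 : q < N + 1 := by exact_mod_cast h4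
  omega

/-- Moderate total charge. A convex combination of the two bounds on the cross term `QX` splits it
between the kinetic energies `KP` of the electrons and `KN` of the positrons, so that each share is
absorbed by the corresponding gain. -/
theorem exchange_balance_of_le {a c M q t θ KP KN QX : ℝ} (ha : 0 < a) (hM : 0 ≤ M)
    (hc : a * (1 / 2 + 2 * M) * KN < c * KN) (hθ : (1 - θ) * (q + t) = t) (hθ1 : θ ≤ 1)
    (hKP : 0 ≤ KP) (hKN : 0 ≤ KN) (hX1 : QX ≤ a / 2 * (t * KP))
    (hX2 : QX ≤ a / 2 * ((q + t) * KN)) (hA : q + t ≤ 3 * M + 1) :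
    2 * QX < (1 - θ) * (a * (1 / 2 + M) * KP) + c * KN := by
  -- The shares must satisfy `s(q+t) ≤ M + 1/2` and `(1-s)(q+t) ≤ 2M + 1/2`. The right sides add up
  -- to `3M + 1`, and this `s` divides that total accordingly.
  set s := (M + 1 / 2) / (3 * M + 1) with hs
  have h3M : 0 < 3 * M + 1 := by linarith
  have hs1 : s * (3 * M + 1) = M + 1 / 2 := div_mul_cancel₀ _ h3M.ne'
  have hs0 : 0 ≤ s := by positivity
  have hsle : s ≤ 1 := (div_le_one h3M).2 (by linarith)
  have h1 := mul_le_mul_of_nonneg_left hX1 hs0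
  have h2 := mul_le_mul_of_nonneg_left hX2 (sub_nonneg.2 hsle)
  have h4 : s * (q + t) ≤ 1 / 2 + M := (mul_le_mul_of_nonneg_left hA hs0).trans (by linarith)
  have h5 : (1 - s) * (q + t) ≤ 1 / 2 + 2 * M :=
    (mul_le_mul_of_nonneg_left hA (sub_nonneg.2 hsle)).trans (by linarith)
  have h6 : s * t ≤ (1 - θ) * (1 / 2 + M) := by
    have h7 : s * t = (1 - θ) * (s * (q + t)) := by rw [mul_left_comm, hθ]
    rw [h7]
    exact mul_le_mul_of_nonneg_left h4 (by linarith)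
  have h8 := mul_le_mul_of_nonneg_right h6 (mul_nonneg ha.le hKP)
  have h9 := mul_le_mul_of_nonneg_right h5 (mul_nonneg ha.le hKN)
  linarith

/-- Large total charge. The bounds on the cross term grow with `q + t`, so the trace-free lower
bound on the whole interaction is used instead. Now `t > 2M + 1`, hence `1 - θ` is large enough to
pay also for the interaction of `θγ₊`. -/
theorem exchange_balance_of_lt {a c M q t θ KP KN : ℝ} (ha : 0 < a) (hM : 0 ≤ M) (hq : 0 ≤ q)
    (hqM : q ≤ M) (hqt : 0 < q + t) (hc : a * (1 / 2 + 2 * M) * KN < c * KN)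
    (hθq : θ * (q + t) = q) (hθ : (1 - θ) * (q + t) = t) (hKP : 0 ≤ KP) (hKN : 0 ≤ KN)
    (hB : 3 * M + 1 < q + t) :
    a / 2 * (KP + KN) + θ ^ 2 * (a / 2 * ((q + t) * KP)) <
      (1 - θ) * (a * (1 / 2 + M) * KP) + c * KN := by
  have h2 : θ ^ 2 * (a / 2 * ((q + t) * KP)) = a / 2 * (θ * q * KP) := by
    have : θ ^ 2 * (a / 2 * ((q + t) * KP)) = a / 2 * (θ * (θ * (q + t)) * KP) := by ring
    rw [this, hθq]
  have h3 : (1 / 2 + θ * q / 2) * (q + t) ≤ (1 - θ) * (1 / 2 + M) * (q + t) := by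
    have h5 : (1 - θ) * (1 / 2 + M) * (q + t) = t * (1 / 2 + M) := by
      rw [mul_right_comm, hθ]
    have h6 : (1 / 2 + θ * q / 2) * (q + t) = (q + t) / 2 + q * (θ * (q + t)) / 2 := by ring
    rw [h5, h6, hθq]
    have h7 : (2 * M + 1) * M ≤ t * M := mul_le_mul_of_nonneg_right (by linarith) hM
    have h8 : q * q ≤ M * M := mul_self_le_mul_self hq hqM
    have h9 : 0 ≤ M * M := mul_self_nonneg M
    linarith
  have h4 := mul_le_mul_of_nonneg_right (le_of_mul_le_mul_right h3 hqt) (mul_nonneg ha.le hKP)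
  have h8 := mul_nonneg (mul_nonneg ha.le hM) hKN
  rw [h2]
  linarith

/-- The elementary inequality behind the absence of positronic components. -/
theorem kinetic_balance {a c τ M q t KP KN DP DN Q QP QX : ℝ} (ha : 0 < a) (hτ : τ ≤ M) (hqM : q ≤ M)
    (hq : 0 ≤ q) (hc : a * (1 / 2 + 2 * M) < c) (ht : 0 < t) (hKP : 0 ≤ KP) (hKN : 0 ≤ KN)
    (hDP : (c - a * τ) * KP ≤ DP) (hDN : DN ≤ -c * KN) (hQ : -(2 * QX) ≤ Q - QP)
    (hQP0 : 0 ≤ QP) (hQP : QP ≤ a / 2 * ((q + t) * KP)) (hX1 : QX ≤ a / 2 * (t * KP))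
    (hX2 : QX ≤ a / 2 * ((q + t) * KN)) (hQ2 : -(a / 2 * (KP + KN)) ≤ Q)
    (hE : DP - DN + Q ≤ q / (q + t) * DP + (q / (q + t)) ^ 2 * QP) : KN = 0 := by
  have hM : 0 ≤ M := hq.trans hqM
  have hqt : 0 < q + t := by linarith
  set θ := q / (q + t)
  have hθ1 : θ * (q + t) = q := div_mul_cancel₀ _ hqt.ne'
  have hθ2 : (1 - θ) * (q + t) = t := by rw [sub_mul, hθ1]; ring
  have hθ0 : 0 ≤ θ := div_nonneg hq hqt.le
  have hθle : θ ≤ 1 := (div_le_one hqt).2 (by linarith)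
  have hcτ : a * (1 / 2 + M) ≤ c - a * τ := by
    have := mul_le_mul_of_nonneg_left hτ ha.le
    linarith
  have hDP' : (1 - θ) * (a * (1 / 2 + M) * KP) ≤ (1 - θ) * DP :=
    mul_le_mul_of_nonneg_left ((mul_le_mul_of_nonneg_right hcτ hKP).trans hDP) (by linarith)
  -- The comparison inequality after inserting both gaps: kinetic gain plus interaction difference
  -- cannot be positive. Either balance lemma contradicts this unless `KN = 0`.
  have hmain : (1 - θ) * (a * (1 / 2 + M) * KP) + c * KN + Q - θ ^ 2 * QP ≤ 0 := by linarith
  by_contra hne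
  have hcKN : a * (1 / 2 + 2 * M) * KN < c * KN :=
    mul_lt_mul_of_pos_right hc (lt_of_le_of_ne hKN (Ne.symm hne))
  rcases le_or_gt (q + t) (3 * M + 1) with hA | hB
  · have h1 := exchange_balance_of_le ha hM hcKN hθ2 hθle hKP hKN hX1 hX2 hA
    have h2 : θ ^ 2 * QP ≤ QP := mul_le_of_le_one_left hQP0 (pow_le_one₀ hθ0 hθle)
    linarith
  · have h1 := exchange_balance_of_lt ha hM hq hqM hqt hcKN hθ1 hθ2 hKP hKN hB
    have h2 := mul_le_mul_of_nonneg_left hQP (sq_nonneg θ)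
    linarith

/-! ### Minimizing occupation numbers -/

theorem toReal_freeAbsForm_pos {m : ℝ} (hm : 0 < m) {u : Hil} (hu : freeAbsForm m u < ∞)
    (h1 : ‖u‖ = 1) : 0 < (freeAbsForm m u).toReal := by
  have h := norm_sq_le_freeAbsForm hm hu
  rw [h1, one_pow] at h
  by_contra h2
  have := mul_nonpos_of_nonneg_of_nonpos (inv_pos.2 hm).le (not_lt.1 h2)
  linarith

/-- The competitor is the positive part of `l`, rescaled by `q/(q+t)` to restore the charge `q`. It
uses only modes with `lₙ > 0`, so it is admissible; `kinetic_balance` then forces the negative part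
to carry no kinetic energy. -/
theorem occupation_nonneg {α Z m c τ M q : ℝ} (hα : 0 < α) (hm : 0 < m) (hτ : τ ≤ M) (hqM : q ≤ M)
    (hq : 0 ≤ q) (hc : α * (Real.pi / 2) * (1 / 2 + 2 * M) < c) {ξ : HilbertBasis ℕ ℂ Hil}
    {l : ℕ → ℝ} (hl : FiniteKinetic m l ξ) (h1 : ∀ n, |l n| ≤ 1) (hsum : ∑' n, l n = q)
    (hplus : ∀ n, 0 < l n → (c - α * (Real.pi / 2) * τ) * (freeAbsForm m (ξ n)).toReal ≤
      coulombDiracForm α Z m (ξ n))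
    (hminus : ∀ n, l n < 0 →
      coulombDiracForm α Z m (ξ n) ≤ -c * (freeAbsForm m (ξ n)).toReal)
    (hopt : ∀ k : ℕ → ℝ, FiniteKinetic m k ξ → (∀ n, 0 ≤ k n) → (∀ n, k n ≤ 1) →
      (∀ n, k n ≠ 0 → 0 < l n) → ∑' n, k n = q → modeEnergy α Z m ξ l ≤ modeEnergy α Z m ξ k)
    (n : ℕ) : 0 ≤ l n := by
  set lp : ℕ → ℝ := fun n => max (l n) 0 with hlp
  set ln : ℕ → ℝ := fun n => max (-l n) 0 with hln
  have hpn : l = fun n => lp n - ln n := by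
    funext n
    simp only [hlp, hln]
    rcases le_total 0 (l n) with h | h
    · rw [max_eq_left h, max_eq_right (neg_nonpos.2 h), sub_zero]
    · rw [max_eq_right h, max_eq_left (neg_nonneg.2 h), zero_sub, neg_neg]
  have habs : ∀ n, |l n| = lp n + ln n := by
    intro n
    simp only [hlp, hln]
    rcases le_total 0 (l n) with h | h
    · rw [max_eq_left h, max_eq_right (neg_nonpos.2 h), add_zero, abs_of_nonneg h]
    · rw [max_eq_right h, max_eq_left (neg_nonneg.2 h), zero_add, abs_of_nonpos h]
  have hp0 : ∀ n, 0 ≤ lp n := fun n => le_max_right _ _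
  have hn0 : ∀ n, 0 ≤ ln n := fun n => le_max_right _ _
  have hp1 : ∀ n, lp n ≤ 1 := fun n => max_le ((le_abs_self _).trans (h1 n)) zero_le_one
  have hpl : ∀ n, lp n ≠ 0 → 0 < l n := fun n h => by
    by_contra h2
    exact h (max_eq_right (not_lt.1 h2))
  have hnl : ∀ n, ln n ≠ 0 → l n < 0 := fun n h => by
    by_contra h2
    exact h (max_eq_right (neg_nonpos.2 (not_lt.1 h2)))
  have hFp : FiniteKinetic m lp ξ := hl.mono (C := 1) fun n => by
    rw [one_mul, abs_of_nonneg (hp0 n), habs]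
    exact le_add_of_nonneg_right (hn0 n)
  have hFn : FiniteKinetic m ln ξ := hl.mono (C := 1) fun n => by
    rw [one_mul, abs_of_nonneg (hn0 n), habs]
    exact le_add_of_nonneg_left (hp0 n)
  have hSp := hFp.summable hm ξ.orthonormal.1
  have hSn := hFn.summable hm ξ.orthonormal.1
  set t := ∑' n, ln n with ht
  have hpsum : ∑' n, lp n = q + t := by
    have h := hSp.tsum_sub hSn
    rw [← hsum, hpn, h]
    ring
  by_contra hneg
  rw [not_le] at hneg
  have hlnpos : 0 < ln n := lt_max_of_lt_left (neg_pos.2 hneg)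
  have htpos : 0 < t := hlnpos.trans_le (hSn.le_tsum n fun _ _ => hn0 _)
  have hqt : 0 < q + t := by linarith
  have hθ0 : 0 ≤ q / (q + t) := div_nonneg hq hqt.le
  have hθ1 : q / (q + t) ≤ 1 := (div_le_one hqt).2 (by linarith)
  have hE := hopt (fun n => q / (q + t) * lp n)
    (hFp.mono (C := 1) fun n => by
      rw [abs_mul, abs_of_nonneg hθ0]
      exact mul_le_mul_of_nonneg_right hθ1 (abs_nonneg _))
    (fun n => mul_nonneg hθ0 (hp0 n)) (fun n => mul_le_one₀ hθ1 (hp0 n) (hp1 n))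
    (fun n h => hpl n (right_ne_zero_of_mul h))
    (by rw [tsum_mul_left, hpsum, div_mul_cancel₀ _ hqt.ne'])
  have hDs := (hFp.summable_coulombDiracForm α Z).tsum_sub (hFn.summable_coulombDiracForm α Z)
  have hEl : modeEnergy α Z m ξ l = ∑' n, lp n * coulombDiracForm α Z m (ξ n) -
      ∑' n, ln n * coulombDiracForm α Z m (ξ n) + α * pairSum ξ l l := by
    rw [modeEnergy, ← hDs]
    refine congrArg (· + _) (tsum_congr fun n => ?_)
    rw [← sub_mul, ← congrFun hpn n]
  rw [modeEnergy_smul, hEl] at hE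
  have hQ := pairSum_sub_sub hm hFp hFn
  rw [← hpn] at hQ
  have hQNN := pairSum_nonneg hFn hn0 hn0
  have hKK : kineticSum m ξ (fun n => |l n|) = kineticSum m ξ lp + kineticSum m ξ ln := by
    unfold kineticSum
    rw [← hFp.summable_kinetic.tsum_add hFn.summable_kinetic]
    exact tsum_congr fun n => (congrArg (· * _) (habs n)).trans (add_mul _ _ _)
  have hQ2 := neg_le_pairSum_self hm hl h1
  rw [hKK] at hQ2
  have hX1 := pairSum_le hm hFn hFp hn0 hp0
  rw [pairSum_comm] at hX1
  have hX2 := pairSum_le hm hFp hFn hp0 hn0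
  have hQP := pairSum_le hm hFp hFp hp0 hp0
  rw [hpsum] at hX2 hQP
  have hDP : (c - α * (Real.pi / 2) * τ) * kineticSum m ξ lp ≤
      ∑' n, lp n * coulombDiracForm α Z m (ξ n) := by
    rw [kineticSum, ← tsum_mul_left]
    refine (hFp.summable_kinetic.mul_left _).tsum_le_tsum (fun n => ?_)
      (hFp.summable_coulombDiracForm α Z)
    by_cases h : lp n = 0
    · simp [h]
    · rw [mul_left_comm]
      exact mul_le_mul_of_nonneg_left (hplus n (hpl n h)) (hp0 n)
  have hDN : ∑' n, ln n * coulombDiracForm α Z m (ξ n) ≤ -c * kineticSum m ξ ln := by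
    rw [kineticSum, ← tsum_mul_left]
    refine (hFn.summable_coulombDiracForm α Z).tsum_le_tsum (fun n => ?_)
      (hFn.summable_kinetic.mul_left _)
    by_cases h : ln n = 0
    · simp [h]
    · rw [mul_left_comm]
      exact mul_le_mul_of_nonneg_left (hminus n (hnl n h)) (hn0 n)
  have hKN := kinetic_balance (a := α * (Real.pi / 2)) (τ := τ) (Q := α * pairSum ξ l l)
    (QP := α * pairSum ξ lp lp) (QX := α * pairSum ξ lp ln)
    (KP := kineticSum m ξ lp) (KN := kineticSum m ξ ln)
    (mul_pos hα (by positivity)) hτ hqM hq hc htpos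
    (tsum_nonneg fun n => mul_nonneg (hp0 n) ENNReal.toReal_nonneg)
    (tsum_nonneg fun n => mul_nonneg (hn0 n) ENNReal.toReal_nonneg) hDP hDN
    (by rw [hQ]; linarith [mul_nonneg hα.le hQNN])
    (mul_nonneg hα.le (pairSum_nonneg hFp hp0 hp0))
    (by linarith [mul_le_mul_of_nonneg_left hQP hα.le])
    (by linarith [mul_le_mul_of_nonneg_left hX1 hα.le])
    (by linarith [mul_le_mul_of_nonneg_left hX2 hα.le])
    (by linarith [mul_le_mul_of_nonneg_left hQ2 hα.le])
    (by linarith)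
  have h2 := hFn.summable_kinetic.le_tsum n fun j _ => mul_nonneg (hn0 j) ENNReal.toReal_nonneg
  rw [show ∑' n, ln n * (freeAbsForm m (ξ n)).toReal = 0 from hKN] at h2
  have h3 := mul_pos hlnpos (toReal_freeAbsForm_pos hm (hFn.lt_top hlnpos.ne') (ξ.orthonormal.1 n))
  linarith

/-- The diagonal terms vanish by `pairTerm_self`; the two equal off-diagonal terms carry the product
`ε · (-ε)`. -/
theorem pairSum_transfer {ξ : HilbertBasis ℕ ℂ Hil} {a b : ℕ} (hab : b ≠ a) (ε : ℝ) :
    pairSum ξ (fun n => ε * ((if n = a then 1 else 0) - if n = b then 1 else 0))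
      (fun n => ε * ((if n = a then 1 else 0) - if n = b then 1 else 0)) =
      -(2 * (ε ^ 2 * pairTerm (ξ a) (ξ b))) := by
  rw [pairSum, tsum_eq_sum (s := {a, b} ×ˢ {a, b}) fun p hp => ?_]
  · rw [Finset.sum_product, Finset.sum_pair hab.symm, Finset.sum_pair hab.symm,
      Finset.sum_pair hab.symm]
    simp only [if_true, if_neg hab, if_neg hab.symm, pairTerm_self, pairTerm_comm (ξ b) (ξ a)]
    ring
  · rw [Finset.mem_product, not_and_or] at hp
    rcases hp with h | h <;>
    · rw [Finset.mem_insert, Finset.mem_singleton, not_or] at h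
      simp [h.1, h.2]

/-- With two fractional modes, charge `±ε` can be moved between them within `[0, 1]` at fixed total
charge. The second difference of the energy is negative by `pairTerm_pos`, so both moves cannot fail
to lower it. -/
theorem occupation_zero_or_one {α Z m : ℝ} {q : ℕ} (hα : 0 < α) (hm : 0 < m)
    {ξ : HilbertBasis ℕ ℂ Hil} {l : ℕ → ℝ} (hl : FiniteKinetic m l ξ) (h0 : ∀ n, 0 ≤ l n)
    (h1 : ∀ n, l n ≤ 1) (hsum : ∑' n, l n = q)
    (hopt : ∀ k : ℕ → ℝ, FiniteKinetic m k ξ → (∀ n, 0 ≤ k n) → (∀ n, k n ≤ 1) →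
      (∀ n, k n ≠ 0 → 0 < l n) → ∑' n, k n = q → modeEnergy α Z m ξ l ≤ modeEnergy α Z m ξ k)
    (a : ℕ) : l a = 0 ∨ l a = 1 := by
  by_contra! ha
  have ha0 : 0 < l a := lt_of_le_of_ne (h0 a) ha.1.symm
  have ha1 : l a < 1 := lt_of_le_of_ne (h1 a) ha.2
  have hs := hl.summable hm ξ.orthonormal.1
  obtain ⟨b, hba, hb0, hb1⟩ := exists_ne_fractional hs h0 h1 hsum ha0 ha1
  obtain ⟨ε, hε, hεa, hεa', hεb, hεb'⟩ : ∃ ε, 0 < ε ∧ ε ≤ l a ∧ ε ≤ 1 - l a ∧ ε ≤ l b ∧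
      ε ≤ 1 - l b :=
    ⟨min (min (l a) (1 - l a)) (min (l b) (1 - l b)),
      lt_min (lt_min ha0 (by linarith)) (lt_min hb0 (by linarith)),
      (min_le_left _ _).trans (min_le_left _ _), (min_le_left _ _).trans (min_le_right _ _),
      (min_le_right _ _).trans (min_le_left _ _), (min_le_right _ _).trans (min_le_right _ _)⟩
  set k : ℕ → ℝ := fun n => ε * ((if n = a then 1 else 0) - if n = b then 1 else 0) with hk
  have hka : k a = ε := by simp [hk, hba.symm]
  have hkb : k b = -ε := by simp [hk, hba]
  have hkn : ∀ n, n ≠ a → n ≠ b → k n = 0 := fun n h h' => by simp [hk, h, h']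
  have habs : ∀ n, |k n| ≤ l n ∧ |k n| ≤ 1 - l n := fun n => by
    by_cases h : n = a
    · rw [h, hka, abs_of_pos hε]
      exact ⟨hεa, hεa'⟩
    · by_cases h' : n = b
      · rw [h', hkb, abs_neg, abs_of_pos hε]
        exact ⟨hεb, hεb'⟩
      · rw [hkn n h h', abs_zero]
        exact ⟨h0 n, sub_nonneg.2 (h1 n)⟩
  have hFk : FiniteKinetic m k ξ := hl.mono (C := 1) fun n => by
    rw [one_mul, abs_of_nonneg (h0 n)]
    exact (habs n).1
  have hksum : HasSum k 0 := by
    have := ((hasSum_ite_eq a (1 : ℝ)).sub (hasSum_ite_eq b (1 : ℝ))).mul_left ε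
    rwa [sub_self, mul_zero] at this
  have hpos : ∀ n, l n = 0 → k n = 0 := fun n hn => by
    have := (habs n).1
    rw [hn] at this
    exact abs_nonpos_iff.1 this
  have hsup : ∀ σ : ℝ, |σ| = 1 → modeEnergy α Z m ξ l ≤ modeEnergy α Z m ξ fun n => l n + σ * k n := by
    intro σ hσ
    have hσk : ∀ n, |σ * k n| = |k n| := fun n => by rw [abs_mul, hσ, one_mul]
    refine hopt _ (hl.add (hFk.mono (C := 1) fun n => by rw [hσk, one_mul])) (fun n => ?_)
      (fun n => ?_) (fun n hn => ?_) ?_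
    · linarith [neg_abs_le (σ * k n), hσk n, (habs n).1]
    · linarith [le_abs_self (σ * k n), hσk n, (habs n).2]
    · refine lt_of_le_of_ne (h0 n) fun h => hn ?_
      rw [hpos n h.symm, ← h, mul_zero, add_zero]
    · have := hs.hasSum.add (hksum.mul_left σ)
      rw [this.tsum_eq, hsum, mul_zero, add_zero]
  have h2 := hsup 1 abs_one
  have h3 := hsup (-1) (by rw [abs_neg, abs_one])
  simp only [one_mul, neg_mul, ← sub_eq_add_neg] at h2 h3
  have h4 := modeEnergy_add_add_modeEnergy_sub α Z hm hFk hl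
  rw [pairSum_transfer hba] at h4
  have h5 := mul_pos hα (mul_pos (pow_pos hε 2) (pairTerm_pos (hl.lt_top hb0.ne')
    (ξ.orthonormal.1 a) (ξ.orthonormal.1 b) (ξ.orthonormal.2 hba.symm)))
  linarith

end DiracFock

/-! ### Proof of the theorem -/

open DiracFock in
theorem mainTheorem2 (α Z m : ℝ) (hm : 0 < m) (hα : 0 ≤ α) (hZ : 0 ≤ α * Z)
    (hαZ : α * Z < Real.sqrt 3 / 2)
    (δ : Hil →L[ℂ] Hil) (hδF : δ ∈ spaceF m) (hδ : 0 ≤ δ) (q : ℕ)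
    (hpos : 0 < Real.pi * α * (1 / 4 + max (opTrace δ).re (q : ℝ)))
    (hlt : Real.pi * α * (1 / 4 + max (opTrace δ).re (q : ℝ)) < modulusConst α Z m δ)
    (γ : Hil →L[ℂ] Hil) (hγ : γ ∈ densityMatricesOfCharge α Z m δ q)
    (hmin : IsMinOn (energy α Z m) (densityMatricesOfCharge α Z m δ q) γ) :
    star γ = γ ∧ γ * γ = γ ∧ projPlus α Z m δ * γ * projPlus α Z m δ = γ := by
  have hα0 : 0 < α := lt_of_le_of_ne hα fun h => by simp [← h] at hpos
  obtain ⟨η, hη, hk⟩ := exists_eigenvector_basis hm hδF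
  have hη1 : ∀ n, ‖eigenvector δ n‖ = 1 := fun n => by rw [hη]; exact η.orthonormal.1 n
  have hδK : FiniteKinetic m (eigenvalue δ) (eigenvector δ) := by
    have := hδF.2
    rwa [normF_eq hk, ← hη] at this
  have hk0 : ∀ n, 0 ≤ eigenvalue δ n := fun n => by
    refine (eigenvalue_mem_of_le hδ le_rfl (η.orthonormal.ne_zero n) (hk n) (a := 0) (by simp)
      (hk n)).1
  have htr : (opTrace δ).re = ∑' n, eigenvalue δ n := by
    rw [opTrace_of_eigenbasis η hk (hδK.summable hm hη1), Complex.ofReal_re]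
  -- Strictness leaves room for an admissible `c` below the supremum, so the supremum need not be
  -- attained; `0` shows that the set is nonempty.
  obtain ⟨c, hcf, hc⟩ := exists_lt_of_lt_csSup
    (⟨0, fun u => by rw [ENNReal.ofReal_zero, zero_mul]; exact zero_le⟩) hlt
  obtain ⟨hP, hplus, hminus⟩ :=
    exists_projPlus_gap Z hα hm (hpos.trans hc) hδK hη1 hk0 hcf
  obtain ⟨⟨hγF, hγ1, hγ2, hγ3⟩, hγq⟩ := hγ
  obtain ⟨ξ, hξ, hl⟩ := exists_eigenvector_basis hm hγF
  set l := eigenvalue γ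
  have hlK : FiniteKinetic m l ξ := by
    have := hγF.2
    rwa [normF_eq hl] at this
  have hspec := fun n =>
    eigenvector_spectral hP hγF.1 hγ3 hγ1 hγ2 (ξ.orthonormal.ne_zero n) (hl n)
  have hsum : ∑' n, l n = q := by
    rw [opTrace_of_eigenbasis ξ hl (hlK.summable hm ξ.orthonormal.1)] at hγq
    exact_mod_cast hγq
  -- Competitors are supported on modes with `lₙ > 0`: these are known to lie in the range of `Λ₊`,
  -- whereas a null vector of `γ` may have components in both subspaces.
  have hopt : ∀ k : ℕ → ℝ, FiniteKinetic m k ξ → (∀ n, 0 ≤ k n) → (∀ n, k n ≤ 1) →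
      (∀ n, k n ≠ 0 → 0 < l n) → ∑' n, k n = q →
      modeEnergy α Z m ξ l ≤ modeEnergy α Z m ξ k := by
    intro k hkK hk0 hk1 hks hkq
    obtain ⟨T, hT, hTE⟩ := exists_densityMatrix_energy_eq α Z hm hP hkK hk0 hk1
      (fun n hn => (hspec n).2.2.1 (hks n hn)) hkq
    rw [← hTE, modeEnergy, ← (energy_eq α Z hm hl hlK).2]
    exact isMinOn_iff.1 hmin T hT
  -- The hypothesis takes the required form through `πα(1/4 + M) = (απ/2)(1/2 + 2M)`.
  have hl0 := occupation_nonneg (M := max (opTrace δ).re q) hα0 hm (htr ▸ le_max_left _ _)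
    (le_max_right _ _) q.cast_nonneg
    (by linarith) hlK (fun n => abs_le.2 ⟨(hspec n).2.1, (hspec n).1⟩) hsum
    (fun n hn => hplus _ (hlK.lt_top hn.ne') ((hspec n).2.2.1 hn))
    (fun n hn => hminus _ (hlK.lt_top hn.ne) ((hspec n).2.2.2 hn)) hopt
  have hl01 := occupation_zero_or_one hα0 hm hlK hl0 (fun n => (hspec n).1) hsum hopt
  refine ⟨hγF.1, eq_of_eigenbasis ξ (fun n => ?_) hl, eq_of_eigenbasis ξ (fun n => ?_) hl⟩
  · change γ (γ (ξ n)) = _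
    rw [hl, map_smul, hl, smul_smul]
    rcases hl01 n with h | h <;> simp [h]
  · have hcomm := commute_of_compl_mul_mul_eq_zero hP hγF.1 hγ3
    have h1 : projPlus α Z m δ * γ * projPlus α Z m δ = projPlus α Z m δ * γ := by
      rw [mul_assoc, ← hcomm, ← mul_assoc, hP.isIdempotentElem.eq]
    rw [h1]
    change projPlus α Z m δ (γ (ξ n)) = _
    rw [hl, map_smul]
    rcases (hl0 n).eq_or_lt with h | h
    · simp [← h]
    · rw [(hspec n).2.2.1 h]
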